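/- Let $n\ge 1$, let $V_{2n}=\mathbb C^{2n}$ be the standard representation of $\mathfrak{sp}_{2n}=\mathfrak{sp}_{2n}(\mathbb C)$ and $\omega$ its symplectic form. For $x,y\in V_{2n}$ define polynomial functions $\beta_{2j}(x,y)$ on $\mathfrak{sp}_{2n}$ by $$\omega\bigl(x,(1-\tau^2A^2)^{-1}y\bigr)\,\det(1-\tau A)^{-1}=\sum_{j\ge 0}\beta_{2j}(x,y)(A)\,\tau^{2j},\qquad A\in\mathfrak{sp}_{2n},$$ and let $r_{2j}(x,y)\in U(\mathfrak{sp}_{2n})$ be the symmetrization of $\beta_{2j}(x,y)\in\mathbb C[\mathfrak{sp}_{2n}]\simeq S(\mathfrak{sp}_{2n})$, where $B\in\mathfrak{sp}_{2n}$ is identified with the linear function $A\mapsto\operatorname{tr}(BA)$. For a finitely supported sequence $\zeta=(\zeta_j)_{j\ge 0}$ of complex numbers, write also $\zeta=\sum_j\zeta_jr_{2j}$ for the corresponding pairing $V_{2n}\times V_{2n}\to U(\mathfrak{sp}_{2n})$, let $$l(\zeta)=\min\{m\in\mathbb Z_{\ge -1}\mid \zeta_j=0\text{ for all }j\ge m+1\},$$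 and let $$H_\zeta(\mathfrak{sp}_{2n})=U(\mathfrak{sp}_{2n})\ltimes T(V_{2n})\big/\bigl([x,y]-\zeta(x,y)\mid x,y\in V_{2n}\bigr).$$ For an integer $N>2l(\zeta)$, the $N$-th standard filtration on $H_\zeta(\mathfrak{sp}_{2n})$ is the one induced from the grading of the tensor algebra $T(\mathfrak{sp}_{2n}\oplus V_{2n})$ with $\deg\mathfrak{sp}_{2n}=2$ and $\deg V_{2n}=N$: its $k$-th piece is the span of the products of elements of $\mathfrak{sp}_{2n}$ and $V_{2n}$ of total degree at most $k$. **Lemma.** Let $\zeta,\zeta'$ be two such parameters and let $N\ge\max\{2l(\zeta)+1,\,2l(\zeta')+1,\,3\}$ be an integer. Then there is an isomorphism of $\mathbb C$-algebras $H_\zeta(\mathfrak{sp}_{2n})\to H_{\zeta'}(\mathfrak{sp}_{2n})$ which maps each piece of the $N$-th standard filtration onto the corresponding piece, if and only if $\zeta'=\theta\zeta$ (that is, $\zeta'_j=\theta\zeta_j$ for all $j$) for some $\theta\in\mathbb C^*$. -/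

import Mathlib

noncomputable section

namespace InfCherednik

open Matrix Module

attribute [local instance 100] LieRing.ofAssociativeRing

/-! ### The symmetrization map `S(L) → U(L)` -/

section Symmetrization

/-- The average of the products of `a 0, …, a (d-1)` over all orderings. -/
def symProd {A : Type*} [Ring A] [Algebra ℂ A] {d : ℕ} (a : Fin d → A) : A :=
  (d.factorial : ℂ)⁻¹ • ∑ σ : Equiv.Perm (Fin d), (List.ofFn fun i => a (σ i)).prod

variable {L : Type*} [LieRing L] [LieAlgebra ℂ L]

/-- The symmetrization map `S(L) → U(L)`, the linear map sending each monomial `B₁ ⋯ B_d` to the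
average of the products of the `B_i` over all orderings.  It is defined on the monomials in a basis
of `L`; see `symmetrization_prod` for arbitrary elements `B_i` of `L`. -/
def symmetrization : SymmetricAlgebra ℂ L →ₗ[ℂ] UniversalEnvelopingAlgebra ℂ L :=
  (Basis.ofVectorSpace ℂ L).symmetricAlgebra.constr ℂ fun m =>
    symProd fun k : Fin (Finsupp.toMultiset m).toList.length =>
      UniversalEnvelopingAlgebra.ι ℂ
        (Basis.ofVectorSpace ℂ L ((Finsupp.toMultiset m).toList.get k))

theorem symProd_comp_equiv {A : Type*} [Ring A] [Algebra ℂ A] {d e : ℕ} (a : Fin e → A)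
    (s : Fin d ≃ Fin e) : symProd (fun i => a (s i)) = symProd a := by
  obtain rfl : d = e := by simpa using Fintype.card_congr s
  unfold symProd
  congr 1
  exact Fintype.sum_equiv (Equiv.mulLeft s) _ _ (fun σ => by simp)

theorem exists_equiv_of_map_eq {α β γ : Type*} [Fintype α] [Fintype β] (f : α → γ) (g : β → γ)
    (h : Finset.univ.val.map f = Finset.univ.val.map g) : ∃ e : α ≃ β, ∀ i, g (e i) = f i := by
  classical
  have hc : ∀ c, Nonempty ({a // f a = c} ≃ {b // g b = c}) := by
    intro c
    apply Fintype.card_eq.mp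
    have := congrArg (Multiset.count c) h
    rw [Multiset.count_map, Multiset.count_map] at this
    rw [Fintype.card_subtype, Fintype.card_subtype]
    simpa [Finset.card, Finset.filter, eq_comm] using this
  exact ⟨Equiv.ofFiberEquiv fun c => (hc c).some, fun i => Equiv.ofFiberEquiv_map _ i⟩

/-- `symProd` as a multilinear map in elements of `L`. -/
def symMultilinear (L : Type*) [LieRing L] [LieAlgebra ℂ L] (d : ℕ) :
    MultilinearMap ℂ (fun _ : Fin d => L) (UniversalEnvelopingAlgebra ℂ L) :=
  (d.factorial : ℂ)⁻¹ • ∑ σ : Equiv.Perm (Fin d),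
    ((MultilinearMap.mkPiAlgebraFin ℂ d (UniversalEnvelopingAlgebra ℂ L)).compLinearMap
      (fun _ => (UniversalEnvelopingAlgebra.ι ℂ : L →ₗ⁅ℂ⁆ _).toLinearMap)).domDomCongr σ

theorem symMultilinear_apply (d : ℕ) (B : Fin d → L) :
    symMultilinear L d B = symProd fun i => UniversalEnvelopingAlgebra.ι ℂ (B i) := by
  simp [symMultilinear, symProd, -UniversalEnvelopingAlgebra.ι_apply]

/-- The defining property of the symmetrization map. -/
theorem symmetrization_prod (d : ℕ) (B : Fin d → L) :
    symmetrization (∏ i, SymmetricAlgebra.ι ℂ L (B i)) =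
      symProd fun i => UniversalEnvelopingAlgebra.ι ℂ (B i) := by
  have key : (symmetrization (L := L)).compMultilinearMap
      ((MultilinearMap.mkPiAlgebra ℂ (Fin d) (SymmetricAlgebra ℂ L)).compLinearMap
        (fun _ => SymmetricAlgebra.ι ℂ L)) = symMultilinear L d := by
    refine Basis.ext_multilinear (fun _ => Basis.ofVectorSpace ℂ L) (fun f => ?_)
    rw [symMultilinear_apply]
    simp only [LinearMap.compMultilinearMap_apply, MultilinearMap.compLinearMap_apply,
      MultilinearMap.mkPiAlgebra_apply]
    set b := Basis.ofVectorSpace ℂ L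
    have h1 : ∏ i, SymmetricAlgebra.ι ℂ L (b (f i)) =
        b.symmetricAlgebra (∑ i, Finsupp.single (f i) 1) := by
      simp only [Basis.symmetricAlgebra, Basis.map_apply, MvPolynomial.coe_basisMonomials,
        AlgEquiv.toLinearEquiv_apply]
      rw [MvPolynomial.monomial_sum_one, map_prod]
      exact Finset.prod_congr rfl fun i _ => (SymmetricAlgebra.equivMvPolynomial_symm_X b _).symm
    rw [h1]
    unfold symmetrization
    rw [Basis.constr_basis]
    set l := (Finsupp.toMultiset (∑ i, Finsupp.single (f i) 1)).toList with hl
    have h2 : (l : Multiset _) = Finset.univ.val.map f := by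
      rw [hl, Multiset.coe_toList, map_sum]
      simp only [Finsupp.toMultiset_single, one_smul]
      rw [Finset.sum, ← Multiset.sum_map_singleton (Finset.univ.val.map f), Multiset.map_map]
      rfl
    have h3 : Finset.univ.val.map l.get = Finset.univ.val.map f := by
      rw [← h2]; simp [Fin.univ_val_map]
    obtain ⟨e, he⟩ := exists_equiv_of_map_eq f l.get h3.symm
    rw [← symProd_comp_equiv _ e]
    simp only [he, b]
  have := congrArg (fun F => F B) key
  simpa [symMultilinear_apply] using this

end Symmetrization

/-! ### The symplectic Lie algebra and the polynomial functions `β_{2j}(x, y)` -/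

/-- The symplectic Lie algebra of `2n × 2n` complex matrices. -/
abbrev Sp (n : ℕ) : Type := LieAlgebra.Symplectic.sp (Fin n) ℂ

/-- The standard representation of dimension `2n`. -/
abbrev Vec (n : ℕ) : Type := Fin n ⊕ Fin n → ℂ

section Beta

variable {n : ℕ} {R S : Type*} [CommRing R] [CommRing S]

/-- The matrix `1 - τ M` over `R⟦τ⟧`. -/
def oneSub (M : Matrix (Fin n ⊕ Fin n) (Fin n ⊕ Fin n) R) :
    Matrix (Fin n ⊕ Fin n) (Fin n ⊕ Fin n) (PowerSeries R) :=
  1 - (PowerSeries.X : PowerSeries R) • M.map PowerSeries.C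

/-- The matrix `1 - τ² M²` over `R⟦τ⟧`. -/
def oneSubSq (M : Matrix (Fin n ⊕ Fin n) (Fin n ⊕ Fin n) R) :
    Matrix (Fin n ⊕ Fin n) (Fin n ⊕ Fin n) (PowerSeries R) :=
  1 - (PowerSeries.X ^ 2 : PowerSeries R) • (M ^ 2).map PowerSeries.C

/-- The symplectic form `ω(x, y) = xᵀ J y`, over any commutative ring. -/
def omega (x y : Fin n ⊕ Fin n → R) : R :=
  x ⬝ᵥ (Matrix.J (Fin n) R *ᵥ y)

/-- The power series `ω(x, (1 - τ² M²)⁻¹ y) · det (1 - τ M)⁻¹` in `τ`.  Both matrices are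
invertible over `R⟦τ⟧`, see `isUnit_det_oneSub` and `isUnit_det_oneSubSq`. -/
def genFun [Algebra ℂ R] (M : Matrix (Fin n ⊕ Fin n) (Fin n ⊕ Fin n) R) (x y : Vec n) : PowerSeries R :=
  omega (fun i => algebraMap ℂ (PowerSeries R) (x i))
      ((oneSubSq M)⁻¹ *ᵥ fun i => algebraMap ℂ (PowerSeries R) (y i)) *
    ((oneSub M)⁻¹).det

theorem isUnit_det_oneSub (M : Matrix (Fin n ⊕ Fin n) (Fin n ⊕ Fin n) R) :
    IsUnit (oneSub M).det := by
  rw [PowerSeries.isUnit_iff_constantCoeff, RingHom.map_det]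
  have : (PowerSeries.constantCoeff (R := R)).mapMatrix (oneSub M) = 1 := by
    ext i j
    by_cases h : i = j <;> simp [oneSub, h, Matrix.one_apply]
  rw [this]; simp

theorem isUnit_det_oneSubSq (M : Matrix (Fin n ⊕ Fin n) (Fin n ⊕ Fin n) R) :
    IsUnit (oneSubSq M).det := by
  rw [PowerSeries.isUnit_iff_constantCoeff, RingHom.map_det]
  have : (PowerSeries.constantCoeff (R := R)).mapMatrix (oneSubSq M) = 1 := by
    ext i j
    by_cases h : i = j <;> simp [oneSubSq, h, Matrix.one_apply]
  rw [this]; simp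

theorem mapMatrix_inv (f : R →+* S)
    (M : Matrix (Fin n ⊕ Fin n) (Fin n ⊕ Fin n) R) (h : IsUnit M.det) :
    f.mapMatrix M⁻¹ = (f.mapMatrix M)⁻¹ := by
  symm
  apply Matrix.inv_eq_right_inv
  rw [← map_mul, Matrix.mul_nonsing_inv _ h, map_one]

/-- The generating function is natural in the ring of coefficients. -/
theorem map_genFun [Algebra ℂ R] [Algebra ℂ S] (f : R →ₐ[ℂ] S) (M : Matrix (Fin n ⊕ Fin n) (Fin n ⊕ Fin n) R) (x y : Vec n) :
    PowerSeries.map (f : R →+* S) (genFun M x y) = genFun (M.map f) x y := by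
  have h1 : (PowerSeries.map (f : R →+* S)).mapMatrix (oneSub M) = oneSub (M.map f) := by
    ext1 i j
    by_cases h : i = j <;> simp [oneSub, h]
  have h2 : (PowerSeries.map (f : R →+* S)).mapMatrix (oneSubSq M) = oneSubSq (M.map f) := by
    have h3 : (M.map f) ^ 2 = (M ^ 2).map f := (map_pow (f : R →+* S).mapMatrix M 2).symm
    ext1 i j
    by_cases h : i = j <;> simp [oneSubSq, h, h3]
  have hc : ∀ c : ℂ, PowerSeries.map (f : R →+* S) (algebraMap ℂ (PowerSeries R) c) =
      algebraMap ℂ (PowerSeries S) c := by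
    intro c
    simp [PowerSeries.algebraMap_apply]
  have hJ : (PowerSeries.map (f : R →+* S)).mapMatrix (Matrix.J (Fin n) (PowerSeries R)) =
      Matrix.J (Fin n) (PowerSeries S) := by
    ext1 i j
    rcases i with i | i <;> rcases j with j | j <;> by_cases h : i = j <;>
      simp [Matrix.J, h]
  unfold genFun omega
  rw [map_mul, RingHom.map_det, mapMatrix_inv _ _ (isUnit_det_oneSub M), h1, ← h2, ← hJ,
    ← mapMatrix_inv _ _ (isUnit_det_oneSubSq M), RingHom.map_dotProduct]
  congr 2
  · funext i
    simp [hc]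
  · funext i
    simp only [Function.comp_apply, RingHom.map_mulVec, RingHom.mapMatrix_apply]
    congr 2
    funext k
    simp [RingHom.map_mulVec, Function.comp_def, hc]

/-- The element of `sp_{2n}` which corresponds, under the trace form, to the matrix entry
`A ↦ A a b` (see `trace_coordElt_mul`): the component in `sp_{2n}` of the matrix unit `E_{ba}`. -/
def coordElt (n : ℕ) (a b : Fin n ⊕ Fin n) : Sp n :=
  ⟨(2 : ℂ)⁻¹ • (Matrix.single b a 1 + Matrix.J (Fin n) ℂ * Matrix.single a b 1 * Matrix.J (Fin n) ℂ),
    by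
      have hJ := Matrix.J_squared (Fin n) ℂ
      have hT := Matrix.J_transpose (Fin n) ℂ
      change _ ∈ skewAdjointMatricesLieSubalgebra (Matrix.J (Fin n) ℂ)
      rw [mem_skewAdjointMatricesLieSubalgebra,
        mem_skewAdjointMatricesSubmodule, Matrix.IsSkewAdjoint, Matrix.IsAdjointPair]
      simp only [Matrix.transpose_smul, Matrix.transpose_add, Matrix.transpose_mul, hT,
        Matrix.transpose_single, smul_mul_assoc, mul_neg, mul_smul_comm, ← smul_neg]
      congr 1
      simp only [add_mul, mul_add, mul_assoc, hJ, neg_mul, mul_neg, mul_one, neg_neg]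
      simp only [← mul_assoc, hJ]
      simp⟩

theorem trace_coordElt_mul (a b : Fin n ⊕ Fin n) (A : Sp n) :
    ((coordElt n a b).1 * A.1).trace = A.1 a b := by
  have hJ := Matrix.J_squared (Fin n) ℂ
  have hA : A.1ᵀ = Matrix.J (Fin n) ℂ * A.1 * Matrix.J (Fin n) ℂ := by
    have h : A.1 ∈ skewAdjointMatricesLieSubalgebra (Matrix.J (Fin n) ℂ) := A.2
    rw [mem_skewAdjointMatricesLieSubalgebra,
      mem_skewAdjointMatricesSubmodule, Matrix.IsSkewAdjoint, Matrix.IsAdjointPair] at h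
    have h' := congrArg (fun X => X * Matrix.J (Fin n) ℂ) h
    simp only [mul_assoc, hJ, mul_neg, neg_mul, mul_one, neg_inj] at h'
    rw [h', mul_assoc]
  have h1 : (Matrix.J (Fin n) ℂ * Matrix.single a b 1 * Matrix.J (Fin n) ℂ * A.1).trace =
      A.1 a b := by
    rw [mul_assoc, mul_assoc, Matrix.trace_mul_comm, mul_assoc, ← hA, Matrix.trace_single_mul]
    simp
  simp only [coordElt, smul_mul_assoc, add_mul, Matrix.trace_smul, Matrix.trace_add, h1,
    Matrix.trace_single_mul]
  simp
  ring

/-- The generic matrix of `sp_{2n}`, with entries in `S(sp_{2n}) ≃ ℂ[sp_{2n}]`, where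
`B ∈ sp_{2n}` is identified with the linear function `A ↦ tr (B A)`. -/
def genericMatrix (n : ℕ) :
    Matrix (Fin n ⊕ Fin n) (Fin n ⊕ Fin n) (SymmetricAlgebra ℂ (Sp n)) :=
  Matrix.of fun a b => SymmetricAlgebra.ι ℂ (Sp n) (coordElt n a b)

/-- `β_{2j}(x, y) ∈ S(sp_{2n}) ≃ ℂ[sp_{2n}]`, the coefficient of `τ^{2j}` in
`ω(x, (1 - τ² A²)⁻¹ y) · det (1 - τ A)⁻¹` for the generic `A ∈ sp_{2n}`. -/
def beta (n j : ℕ) (x y : Vec n) : SymmetricAlgebra ℂ (Sp n) :=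
  PowerSeries.coeff (2 * j) (genFun (genericMatrix n) x y)

/-- The linear function `B ↦ tr (B A)` on `sp_{2n}`. -/
def traceWith (A : Sp n) : Sp n →ₗ[ℂ] ℂ where
  toFun B := (B.1 * A.1).trace
  map_add' B C := by simp [add_mul]
  map_smul' c B := by simp

/-- Evaluation at `A ∈ sp_{2n}` of an element of `S(sp_{2n}) ≃ ℂ[sp_{2n}]`. -/
def evalAt (A : Sp n) : SymmetricAlgebra ℂ (Sp n) →ₐ[ℂ] ℂ :=
  SymmetricAlgebra.lift (traceWith A)

/-- As a polynomial function on `sp_{2n}`, `β_{2j}(x, y)` is given by the expansion of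
`ω(x, (1 - τ² A²)⁻¹ y) · det (1 - τ A)⁻¹`. -/
theorem evalAt_beta (j : ℕ) (x y : Vec n) (A : Sp n) :
    evalAt A (beta n j x y) = PowerSeries.coeff (2 * j) (genFun A.1 x y) := by
  have h : (genericMatrix n).map (evalAt A) = A.1 := by
    ext a b
    simp [genericMatrix, evalAt, traceWith, trace_coordElt_mul]
  rw [← h, ← map_genFun, PowerSeries.coeff_map]
  rfl

end Beta

/-! ### The algebras `H_ζ(sp_{2n})` -/

/-- The universal enveloping algebra of `sp_{2n}`. -/
abbrev USp (n : ℕ) : Type := UniversalEnvelopingAlgebra ℂ (Sp n)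

/-- `r_{2j}(x, y) ∈ U(sp_{2n})`, the symmetrization of `β_{2j}(x, y)`. -/
def r (n j : ℕ) (x y : Vec n) : USp n := symmetrization (beta n j x y)

/-- The pairing `ζ = ∑ⱼ ζⱼ r_{2j}` on `V_{2n}` with values in `U(sp_{2n})`, for a finitely supported
sequence of coefficients `ζⱼ`. -/
def pairing {n : ℕ} (ζ : ℕ →₀ ℂ) (x y : Vec n) : USp n := ζ.sum fun j c => c • r n j x y

/-- The length `l(ζ) = min {m ≥ -1 | ζⱼ = 0 for all j ≥ m + 1}`. -/
def length (ζ : ℕ →₀ ℂ) : ℤ := sInf {m : ℤ | -1 ≤ m ∧ ∀ j : ℕ, m + 1 ≤ (j : ℤ) → ζ j = 0}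

theorem length_isLeast (ζ : ℕ →₀ ℂ) :
    IsLeast {m : ℤ | -1 ≤ m ∧ ∀ j : ℕ, m + 1 ≤ (j : ℤ) → ζ j = 0} (length ζ) := by
  have hb : BddBelow {m : ℤ | -1 ≤ m ∧ ∀ j : ℕ, m + 1 ≤ (j : ℤ) → ζ j = 0} :=
    ⟨-1, fun m hm => hm.1⟩
  refine ⟨Int.csInf_mem ?_ hb, fun m hm => csInf_le hb hm⟩
  refine ⟨(ζ.support.sup id : ℕ), by omega, fun j hj => ?_⟩
  by_contra h
  have := Finset.le_sup (f := id) (Finsupp.mem_support_iff.mpr h)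
  simp only [id] at this
  omega

/-- The generators of the tensor algebra `T(sp_{2n} ⊕ V_{2n})`. -/
def tGen (n : ℕ) : Sp n ⊕ Vec n → TensorAlgebra ℂ (Sp n × Vec n)
  | .inl A => TensorAlgebra.ι ℂ (A, 0)
  | .inr v => TensorAlgebra.ι ℂ (0, v)

/-- The relations `[A, B] = [A, B]_{sp}` and `[A, v] = A v` of the semidirect product
`U(sp_{2n}) ⋉ T(V_{2n})` in the tensor algebra of `sp_{2n} ⊕ V_{2n}`. -/
inductive SemiRel (n : ℕ) :
    TensorAlgebra ℂ (Sp n × Vec n) → TensorAlgebra ℂ (Sp n × Vec n) → Prop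
  | lie (A B : Sp n) :
      SemiRel n (tGen n (.inl A) * tGen n (.inl B) - tGen n (.inl B) * tGen n (.inl A))
        (tGen n (.inl ⁅A, B⁆))
  | act (A : Sp n) (v : Vec n) :
      SemiRel n (tGen n (.inl A) * tGen n (.inr v) - tGen n (.inr v) * tGen n (.inl A))
        (tGen n (.inr (A.1 *ᵥ v)))

/-- The semidirect product algebra `U(sp_{2n}) ⋉ T(V_{2n})`. -/
abbrev Semi (n : ℕ) : Type := RingQuot (SemiRel n)

/-- The generators of `U(sp_{2n}) ⋉ T(V_{2n})`. -/
def semiGen (n : ℕ) (s : Sp n ⊕ Vec n) : Semi n := RingQuot.mkAlgHom ℂ (SemiRel n) (tGen n s)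

/-- The canonical map `U(sp_{2n}) → U(sp_{2n}) ⋉ T(V_{2n})`. -/
def ofUSp (n : ℕ) : USp n →ₐ[ℂ] Semi n :=
  UniversalEnvelopingAlgebra.lift ℂ
    { toFun := fun A => semiGen n (.inl A)
      map_add' := fun A B => by
        have h : ((A + B, 0) : Sp n × Vec n) = (A, 0) + (B, 0) := by simp
        simp only [semiGen, tGen]
        rw [h, map_add, map_add]
      map_smul' := fun c A => by
        have h : ((c • A, 0) : Sp n × Vec n) = c • (A, 0) := by simp
        simp only [semiGen, tGen]
        rw [h, map_smul, map_smul]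
        rfl
      map_lie' := fun {A B} => by
        rw [LieRing.of_associative_ring_bracket]
        have := RingQuot.mkAlgHom_rel ℂ (SemiRel.lie A B)
        simp only [map_sub, map_mul] at this
        exact this.symm }

/-- The relations `[x, y] = ζ(x, y)` for `x, y ∈ V_{2n}`. -/
inductive CherednikRel {n : ℕ} (ζ : ℕ →₀ ℂ) : Semi n → Semi n → Prop
  | comm (x y : Vec n) :
      CherednikRel ζ
        (semiGen n (.inr x) * semiGen n (.inr y) - semiGen n (.inr y) * semiGen n (.inr x))
        (ofUSp n (pairing ζ x y))

/-- The infinitesimal Cherednik algebra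
`H_ζ(sp_{2n}) = (U(sp_{2n}) ⋉ T(V_{2n})) / ([x, y] - ζ(x, y) | x, y ∈ V_{2n})`. -/
abbrev H (n : ℕ) (ζ : ℕ →₀ ℂ) : Type := RingQuot (CherednikRel (n := n) ζ)

/-- The generators of `H_ζ(sp_{2n})`: the images of the elements of `sp_{2n}` and of `V_{2n}`. -/
def gen (n : ℕ) (ζ : ℕ →₀ ℂ) (s : Sp n ⊕ Vec n) : H n ζ :=
  RingQuot.mkAlgHom ℂ (CherednikRel ζ) (semiGen n s)

/-- Degrees of the generators: `deg sp_{2n} = 2` and `deg V_{2n} = N`. -/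
def genDeg (n N : ℕ) : Sp n ⊕ Vec n → ℕ
  | .inl _ => 2
  | .inr _ => N

/-- The `k`-th piece of the `N`-th standard filtration of `H_ζ(sp_{2n})`, which is induced from the
grading of the tensor algebra of `sp_{2n} ⊕ V_{2n}` with `deg sp_{2n} = 2`, `deg V_{2n} = N`: the
linear span of the products of generators of total degree at most `k`. -/
def stdFiltration (n N : ℕ) (ζ : ℕ →₀ ℂ) (k : ℕ) : Submodule ℂ (H n ζ) :=
  Submodule.span ℂ
    {a | ∃ w : List (Sp n ⊕ Vec n), (w.map (genDeg n N)).sum ≤ k ∧ (w.map (gen n ζ)).prod = a}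

/-- `H_ζ(sp_{2n})` and `H_ζ'(sp_{2n})` are isomorphic as `N`-standardly filtered algebras. -/
def FilteredIsomorphic (n N : ℕ) (ζ ζ' : ℕ →₀ ℂ) : Prop :=
  ∃ Φ : H n ζ ≃ₐ[ℂ] H n ζ', ∀ k : ℕ,
    (stdFiltration n N ζ k).map Φ.toLinearMap = stdFiltration n N ζ' k

end InfCherednik

end

noncomputable section

namespace InfCherednik

open Matrix Module TrivSqZeroExt
open scoped TensorProduct

attribute [local instance 100] LieRing.ofAssociativeRing

/-! ### Symmetrization and inner derivations -/

section SymmetrizationMaps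

variable {L : Type*} [LieRing L] [LieAlgebra ℂ L] {A B : Type*} [Ring A] [Algebra ℂ A]
  [Ring B] [Algebra ℂ B]

/-! If θ = d², the substitution v ↦ d⁻¹ v on V_{2n} carries the relations of H_ζ to those of H_{θζ}
and respects every filtration; this is one direction (`filteredIsomorphic_smul`).

Conversely, let Φ be a filtered isomorphism. Since N ≥ 3, the piece of degree 2 lies in ℂ + sp_{2n}
and the piece of degree N lies in U(sp_{2n}) + V_{2n}, so Φ(A) = l(A) + φ(A) and Φ(v) = t(v) + ψ(v).
Here l is a character of sp_{2n}, hence zero. Twisted by φ and ψ, t becomes an equivariant map from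
V_{2n} to U(sp_{2n}), hence zero: diag(1, -1) has only even weights on U(sp_{2n}) and weights ±1 on
V_{2n}. The map ψ intertwines A with φ(A), so it pulls ω back to an invariant form, which is cω with
c ≠ 0. Thus ψ is a symplectic similitude and φ is conjugation by it. If f extends φ to U(sp_{2n}),
the formula for β gives ζ(ψx, ψy) = c f(ζ(x, y)), while applying Φ to [x, y] gives f(ζ(x, y)) =
ζ'(ψx, ψy). So ζ and cζ' agree as pairings, and they agree as sequences because the r_{2j} are
linearly independent (`eq_zero_of_pairing_eq_zero`). Independence is seen on leading symbols,
evaluated at diag(1, -1).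

Comparing components in H_{ζ'} requires that U(sp_{2n}) and V_{2n} remain independent there, a
fragment of the PBW theorem (`exists_proj`). To obtain it, H_ζ is made to act on polynomials with
coefficients in U(sp_{2n}). The basis vector e_i acts by X_i = z_i + C_i, where C_i lowers the
degree; it is determined recursively by the wanted commutators κ_ij = ζ(e_i, e_j) and the symmetric
ordering condition ∑ X_j d_j = E, with E the Euler operator. That these operators satisfy the
relations rests on the Jacobi identity for ζ (`jacobi_r`). Commutators with a vector differentiate
the symmetrized polynomial, so that identity becomes one for derivatives of the generating function
of β in directions of rank two. There the derivative of the determinant factor cancels that of the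
first factor (`cyclic_omega_identity`). -/

theorem map_symProd (f : A →ₐ[ℂ] B) {d : ℕ} (a : Fin d → A) :
    f (symProd a) = symProd fun i => f (a i) := by
  simp only [symProd, map_smul, map_sum, map_list_prod, List.map_ofFn]
  rfl

/-- Linear maps on a symmetric algebra are determined by their values on monomials. -/
theorem symmetricAlgebra_linearMap_ext {L W : Type*} [AddCommGroup L] [Module ℂ L]
    [AddCommGroup W] [Module ℂ W] {F G : SymmetricAlgebra ℂ L →ₗ[ℂ] W}
    (h : ∀ (d : ℕ) (b : Fin d → L), F (∏ i, SymmetricAlgebra.ι ℂ L (b i)) =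
      G (∏ i, SymmetricAlgebra.ι ℂ L (b i))) : F = G := by
  have hspan : Submodule.span ℂ {s : SymmetricAlgebra ℂ L |
      ∃ (d : ℕ) (b : Fin d → L), ∏ i, SymmetricAlgebra.ι ℂ L (b i) = s} = ⊤ := by
    rw [eq_top_iff]
    rintro s -
    induction s using SymmetricAlgebra.induction with
    | algebraMap c =>
      rw [Algebra.algebraMap_eq_smul_one]
      exact Submodule.smul_mem _ _ (Submodule.subset_span ⟨0, Fin.elim0, by simp⟩)
    | ι x => exact Submodule.subset_span ⟨1, fun _ => x, by simp⟩
    | add a b ha hb => exact Submodule.add_mem _ ha hb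
    | mul a b ha hb =>
      refine (Submodule.span_mul_span ℂ _ _).le.trans (Submodule.span_mono ?_)
        (Submodule.mul_mem_mul ha hb)
      rintro _ ⟨_, ⟨d, b, rfl⟩, _, ⟨e, c, rfl⟩, rfl⟩
      exact ⟨d + e, Fin.append b c, by simp [Fin.prod_univ_add]⟩
  refine LinearMap.ext_on hspan ?_
  rintro _ ⟨d, b, rfl⟩
  exact h d b

/-- The symmetrization map `S(A) → A` of an associative algebra. -/
def symA (A : Type*) [Ring A] [Algebra ℂ A] : SymmetricAlgebra ℂ A →ₗ[ℂ] A :=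
  (UniversalEnvelopingAlgebra.lift ℂ (LieHom.id : A →ₗ⁅ℂ⁆ A)).toLinearMap ∘ₗ symmetrization

theorem symA_prod {d : ℕ} (a : Fin d → A) :
    symA A (∏ i, SymmetricAlgebra.ι ℂ A (a i)) = symProd a := by
  rw [symA, LinearMap.comp_apply, symmetrization_prod, AlgHom.toLinearMap_apply, map_symProd]
  congr 1
  funext i
  exact UniversalEnvelopingAlgebra.lift_ι_apply ℂ _ _

/-- Functoriality of the symmetric algebra. -/
def symMap {L L' : Type*} [AddCommGroup L] [Module ℂ L] [AddCommGroup L'] [Module ℂ L']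
    (j : L →ₗ[ℂ] L') : SymmetricAlgebra ℂ L →ₐ[ℂ] SymmetricAlgebra ℂ L' :=
  SymmetricAlgebra.lift (SymmetricAlgebra.ι ℂ L' ∘ₗ j)

@[simp] theorem symMap_ι {L L' : Type*} [AddCommGroup L] [Module ℂ L] [AddCommGroup L']
    [Module ℂ L'] (j : L →ₗ[ℂ] L') (x : L) :
    symMap j (SymmetricAlgebra.ι ℂ L x) = SymmetricAlgebra.ι ℂ L' (j x) := by
  simp [symMap]

/-- Lets the symmetrization be computed inside any algebra that receives U(L). Commutators with
elements outside U(L), such as vectors of V_{2n} in the semidirect product, then make sense. -/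
theorem symA_symMap (f : UniversalEnvelopingAlgebra ℂ L →ₐ[ℂ] A) (s : SymmetricAlgebra ℂ L) :
    symA A (symMap (f.toLinearMap ∘ₗ (UniversalEnvelopingAlgebra.ι ℂ : L →ₗ⁅ℂ⁆ _).toLinearMap) s) =
      f (symmetrization s) := by
  have : symA A ∘ₗ (symMap (f.toLinearMap ∘ₗ
      (UniversalEnvelopingAlgebra.ι ℂ : L →ₗ⁅ℂ⁆ _).toLinearMap)).toLinearMap =
      f.toLinearMap ∘ₗ symmetrization := by
    refine symmetricAlgebra_linearMap_ext fun d b => ?_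
    simp only [LinearMap.comp_apply, AlgHom.toLinearMap_apply, map_prod, symMap_ι, symA_prod,
      symmetrization_prod, map_symProd]
    rfl
  exact congrArg (fun F => F s) this

theorem symmetrization_symMap {L' : Type*} [LieRing L'] [LieAlgebra ℂ L'] (φ : L →ₗ⁅ℂ⁆ L')
    (f : UniversalEnvelopingAlgebra ℂ L →ₐ[ℂ] UniversalEnvelopingAlgebra ℂ L')
    (hf : ∀ x, f (UniversalEnvelopingAlgebra.ι ℂ x) = UniversalEnvelopingAlgebra.ι ℂ (φ x))
    (s : SymmetricAlgebra ℂ L) :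
    symmetrization (symMap φ.toLinearMap s) = f (symmetrization s) := by
  have : symmetrization ∘ₗ (symMap φ.toLinearMap).toLinearMap =
      f.toLinearMap ∘ₗ symmetrization := by
    refine symmetricAlgebra_linearMap_ext fun d b => ?_
    simp only [LinearMap.comp_apply, AlgHom.toLinearMap_apply, map_prod, symMap_ι,
      symmetrization_prod, map_symProd, hf]
    rfl
  exact congrArg (fun F => F s) this

theorem lie_prod_ofFn {A : Type*} [Ring A] (c : A) : ∀ {d : ℕ} (a : Fin d → A),
    c * (List.ofFn a).prod - (List.ofFn a).prod * c =
      ∑ i, (List.ofFn (Function.update a i (c * a i - a i * c))).prod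
  | 0, a => by simp
  | d + 1, a => by
    have ih := lie_prod_ofFn c (fun i => a i.succ)
    have h1 : ∀ i : Fin d, (fun k : Fin d => Function.update a i.succ
        (c * a i.succ - a i.succ * c) k.succ) = Function.update (fun i => a i.succ) i
        (c * a i.succ - a i.succ * c) := by
      intro i
      funext k
      by_cases h : k = i
      · subst h; simp
      · simp [Function.update_of_ne, h, Fin.succ_inj]
    simp only [Fin.sum_univ_succ, List.ofFn_succ, List.prod_cons, Function.update_self, h1,
      ← Finset.mul_sum]
    have h2 : ∀ i : Fin d, Function.update a i.succ (c * a i.succ - a i.succ * c) 0 = a 0 :=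
      fun i => Function.update_of_ne (Fin.succ_ne_zero i).symm _ _
    have h3 : (fun k : Fin d => Function.update a 0 (c * a 0 - a 0 * c) k.succ) =
        fun k => a k.succ := by
      funext k; exact Function.update_of_ne (Fin.succ_ne_zero k) _ _
    simp only [h2, h3, ← Finset.mul_sum, ← ih]
    noncomm_ring

/-- Commutation with `c` is a derivation, and the Leibniz rule is compatible with averaging over
orderings: the position of the altered factor is reindexed by the permutation. -/
theorem lie_symProd (c : A) {d : ℕ} (a : Fin d → A) :
    c * symProd a - symProd a * c =
      ∑ i, symProd (Function.update a i (c * a i - a i * c)) := by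
  simp only [symProd, mul_smul_comm, smul_mul_assoc, ← smul_sub, ← Finset.smul_sum,
    Finset.mul_sum, Finset.sum_mul, ← Finset.sum_sub_distrib, lie_prod_ofFn]
  congr 1
  rw [Finset.sum_comm (s := (Finset.univ : Finset (Fin d)))]
  refine Finset.sum_congr rfl fun σ _ => ?_
  refine Fintype.sum_equiv σ _ _ fun i => ?_
  congr 2
  funext k
  by_cases h : k = i
  · subst h; simp
  · simp [Function.update_of_ne, h]

/-- The first order deformation `b ↦ j b + ε [c, j b]` of the map `S(L) → S(A)` induced by `j`. -/
def adDeform {L : Type*} [AddCommGroup L] [Module ℂ L] (j : L →ₗ[ℂ] A) (c : A) :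
    SymmetricAlgebra ℂ L →ₐ[ℂ] DualNumber (SymmetricAlgebra ℂ A) :=
  SymmetricAlgebra.lift
    ((inlAlgHom ℂ (SymmetricAlgebra ℂ A) (SymmetricAlgebra ℂ A)).toLinearMap ∘ₗ
        SymmetricAlgebra.ι ℂ A ∘ₗ j +
      (inrHom (SymmetricAlgebra ℂ A) (SymmetricAlgebra ℂ A)).restrictScalars ℂ ∘ₗ
        SymmetricAlgebra.ι ℂ A ∘ₗ (LinearMap.mulLeft ℂ c - LinearMap.mulRight ℂ c) ∘ₗ j)

theorem adDeform_ι {L : Type*} [AddCommGroup L] [Module ℂ L] (j : L →ₗ[ℂ] A) (c : A) (x : L) :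
    adDeform j c (SymmetricAlgebra.ι ℂ L x) =
      inl (SymmetricAlgebra.ι ℂ A (j x)) + inr (SymmetricAlgebra.ι ℂ A (c * j x - j x * c)) := by
  simp [adDeform]

/-- The Leibniz rule: since ε² = 0, only terms with at most one perturbed factor survive. -/
theorem dualNumber_prod {R α : Type*} [CommRing R] [DecidableEq α] (s : Finset α) (a b : α → R) :
    (∏ i ∈ s, (inl (a i) + inr (b i) : DualNumber R)) =
      inl (∏ i ∈ s, a i) + inr (∑ i ∈ s, ∏ k ∈ s, Function.update a i (b i) k) := by
  induction s using Finset.induction_on with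
  | empty => simp
  | insert x s hx ih =>
    rw [Finset.prod_insert hx, ih, Finset.prod_insert hx, Finset.sum_insert hx,
      Finset.prod_insert hx]
    have h1 : ∏ k ∈ s, Function.update a x (b x) k = ∏ k ∈ s, a k :=
      Finset.prod_congr rfl fun k hk => Function.update_of_ne (by rintro rfl; exact hx hk) _ _
    have h2 : ∀ i ∈ s, ∏ k ∈ insert x s, Function.update a i (b i) k =
        a x * ∏ k ∈ s, Function.update a i (b i) k := by
      intro i hi
      rw [Finset.prod_insert hx, Function.update_of_ne (by rintro rfl; exact hx hi)]
    rw [Finset.sum_congr rfl h2, ← Finset.mul_sum, h1]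
    ext
    · simp
    · simp; ring

/-- Symmetrization intertwines the derivation of S(A) extending ad c with ad c itself. Since that
derivation is the ε-part of an algebra homomorphism, a commutator with `symA A (symMap j s)` can be
found by substituting b + ε[c, b] into a closed formula for `s`. -/
theorem symA_snd_adDeform {L : Type*} [AddCommGroup L] [Module ℂ L] (j : L →ₗ[ℂ] A) (c : A)
    (s : SymmetricAlgebra ℂ L) :
    symA A (snd (adDeform j c s)) = c * symA A (symMap j s) - symA A (symMap j s) * c := by
  have : symA A ∘ₗ ((sndHom (SymmetricAlgebra ℂ A) (SymmetricAlgebra ℂ A)).restrictScalars ℂ) ∘ₗ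
      (adDeform j c).toLinearMap =
      (LinearMap.mulLeft ℂ c - LinearMap.mulRight ℂ c) ∘ₗ symA A ∘ₗ (symMap j).toLinearMap := by
    refine symmetricAlgebra_linearMap_ext fun d b => ?_
    simp only [LinearMap.comp_apply, AlgHom.toLinearMap_apply, map_prod, symMap_ι, symA_prod,
      adDeform_ι, dualNumber_prod, LinearMap.restrictScalars_apply, sndHom_apply,
      LinearMap.sub_apply, LinearMap.mulLeft_apply, LinearMap.mulRight_apply, lie_symProd]
    simp only [snd_add, snd_inl, snd_inr, zero_add, map_sum]
    refine Finset.sum_congr rfl fun i _ => ?_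
    rw [← symA_prod]
    congr 1
    refine Finset.prod_congr rfl fun k _ => ?_
    by_cases h : k = i
    · subst h; simp
    · simp [Function.update_of_ne, h]
  exact congrArg (fun F => F s) this

end SymmetrizationMaps

/-! ### Inverse and determinant to first order -/

section Perturbation

variable {m : Type*} [Fintype m] [DecidableEq m] {T : Type*} [CommRing T]

/-- The Neumann series stops after the linear term because `e * e = 0`. -/
theorem inv_sub_smul {Q Z : Matrix m m T} (hQ : IsUnit Q.det) {e : T} (he : e * e = 0) :
    (Q - e • Z)⁻¹ = Q⁻¹ + e • (Q⁻¹ * Z * Q⁻¹) := by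
  apply Matrix.inv_eq_right_inv
  have h1 : Q * Q⁻¹ = 1 := Matrix.mul_nonsing_inv _ hQ
  have h2 : (Q - e • Z) * (Q⁻¹ + e • (Q⁻¹ * Z * Q⁻¹)) =
      Q * Q⁻¹ + e • (Q * Q⁻¹ * Z * Q⁻¹) - e • (Z * Q⁻¹) - (e * e) • (Z * Q⁻¹ * Z * Q⁻¹) := by
    simp only [sub_mul, mul_add, smul_mul_assoc, mul_smul_comm, mul_smul, mul_assoc, smul_sub]
    abel
  rw [h2, he, h1]
  simp

theorem det_inv_sub_smul {D W : Matrix m m T} (hD : IsUnit D.det) {e : T} (he : e * e = 0) :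
    ((D - e • W)⁻¹).det = (D⁻¹).det * (1 + e * (D⁻¹ * W).trace) := by
  have h1 : D⁻¹ + e • (D⁻¹ * W * D⁻¹) = D⁻¹ * (1 + e • (W * D⁻¹)) := by
    simp [mul_add, mul_assoc]
  have he2 : e ^ 2 = 0 := by rw [sq, he]
  rw [inv_sub_smul hD he, h1, Matrix.det_mul, Matrix.det_one_add_smul, he2,
    Matrix.trace_mul_comm W]
  ring

end Perturbation

/-! ### The derivative of the generating function -/

section Derivative

variable {n : ℕ} {R S : Type*} [CommRing R] [Algebra ℂ R]

/-- A complex vector as a vector of constant power series. -/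
def cvec (R : Type*) [CommRing R] [Algebra ℂ R] (x : Vec n) : Fin n ⊕ Fin n → PowerSeries R :=
  fun i => algebraMap ℂ (PowerSeries R) (x i)

/-- The derivative of `genFun` at `M` in the direction `N`. -/
def dGenFun (M N : Matrix (Fin n ⊕ Fin n) (Fin n ⊕ Fin n) R) (x y : Vec n) : PowerSeries R :=
  (omega (cvec R x) (((oneSubSq M)⁻¹ * ((PowerSeries.X ^ 2 : PowerSeries R) •
      (M * N + N * M).map PowerSeries.C) * (oneSubSq M)⁻¹) *ᵥ cvec R y) +
    omega (cvec R x) ((oneSubSq M)⁻¹ *ᵥ cvec R y) *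
      ((oneSub M)⁻¹ * ((PowerSeries.X : PowerSeries R) • N.map PowerSeries.C)).trace) *
    ((oneSub M)⁻¹).det

theorem omega_add_right {T : Type*} [CommRing T] (x y z : Fin n ⊕ Fin n → T) :
    omega x (y + z) = omega x y + omega x z := by
  simp [omega, mulVec_add]

theorem omega_smul_right {T : Type*} [CommRing T] (x y : Fin n ⊕ Fin n → T) (c : T) :
    omega x (c • y) = c * omega x y := by
  simp [omega, mulVec_smul]

theorem map_omega {T T' : Type*} [CommRing T] [CommRing T'] (f : T →+* T')
    (x y : Fin n ⊕ Fin n → T) :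
    f (omega x y) = omega (fun i => f (x i)) (fun i => f (y i)) := by
  have hJ : f.mapMatrix (Matrix.J (Fin n) T) = Matrix.J (Fin n) T' := by
    ext1 i j
    rcases i with i | i <;> rcases j with j | j <;> by_cases h : i = j <;>
      simp [Matrix.J, h]
  unfold omega
  rw [← hJ, RingHom.map_dotProduct]
  congr 1
  funext i
  simp only [Function.comp_apply, RingHom.map_mulVec, RingHom.mapMatrix_apply]
  rfl

/-- The first order Taylor expansion at M in the direction N; it certifies `dGenFun` as the
derivative. -/
theorem genFun_dual (M N : Matrix (Fin n ⊕ Fin n) (Fin n ⊕ Fin n) R) (x y : Vec n) :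
    genFun (M.map inl + N.map inr : Matrix _ _ (DualNumber R)) x y =
      PowerSeries.map (inlHom R R) (genFun M x y) +
        PowerSeries.C (DualNumber.eps : DualNumber R) *
          PowerSeries.map (inlHom R R) (dGenFun M N x y) := by
  set j : PowerSeries R →+* PowerSeries (DualNumber R) := PowerSeries.map (inlHom R R) with hj
  set e : PowerSeries (DualNumber R) := PowerSeries.C (DualNumber.eps : DualNumber R) with he
  have hee : e * e = 0 := by rw [he, ← map_mul, DualNumber.eps_mul_eps, map_zero]
  have hN : (N.map inr : Matrix _ _ (DualNumber R)) =
      (DualNumber.eps : DualNumber R) • N.map inl := by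
    ext1 a b
    simp only [Matrix.map_apply, Matrix.smul_apply, smul_eq_mul]
    ext <;> simp
  have hcC : ∀ A : Matrix (Fin n ⊕ Fin n) (Fin n ⊕ Fin n) R,
      (A.map inl : Matrix _ _ (DualNumber R)).map PowerSeries.C =
        j.mapMatrix (A.map PowerSeries.C) := by
    intro A
    ext1 a b
    simp [hj]
  have hX : j PowerSeries.X = PowerSeries.X := by simp [hj]
  have h1 : oneSub (M.map inl + N.map inr : Matrix _ _ (DualNumber R)) =
      j.mapMatrix (oneSub M) -
        e • j.mapMatrix ((PowerSeries.X : PowerSeries R) • N.map PowerSeries.C) := by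
    have ha : (M.map inl + N.map inr : Matrix _ _ (DualNumber R)).map PowerSeries.C =
        j.mapMatrix (M.map PowerSeries.C) + e • j.mapMatrix (N.map PowerSeries.C) := by
      rw [hN, ← hcC, ← hcC]
      ext1 a b
      simp [he]
    rw [oneSub, ha, oneSub, map_sub, map_one, smul_add, smul_comm _ e, ← sub_sub]
    congr 2
    · ext1 a b; simp [hX]
    · ext1 a b; simp [hX]
  have h2 : oneSubSq (M.map inl + N.map inr : Matrix _ _ (DualNumber R)) =
      j.mapMatrix (oneSubSq M) -
        e • j.mapMatrix ((PowerSeries.X ^ 2 : PowerSeries R) •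
          (M * N + N * M).map PowerSeries.C) := by
    have ha : ((M.map inl + N.map inr : Matrix _ _ (DualNumber R)) ^ 2).map PowerSeries.C =
        j.mapMatrix ((M ^ 2).map PowerSeries.C) +
          e • j.mapMatrix ((M * N + N * M).map PowerSeries.C) := by
      have hmul : ∀ A B : Matrix (Fin n ⊕ Fin n) (Fin n ⊕ Fin n) R,
          (A.map inl * B.map inl : Matrix _ _ (DualNumber R)) = (A * B).map inl :=
        fun A B => ((inlHom R R).mapMatrix.map_mul A B).symm
      have hsq : (M.map inl + N.map inr : Matrix _ _ (DualNumber R)) ^ 2 =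
          (M ^ 2).map inl + (DualNumber.eps : DualNumber R) • (M * N + N * M).map inl := by
        have hadd : ((M * N + N * M).map inl : Matrix _ _ (DualNumber R)) =
            (M * N).map inl + (N * M).map inl := by
          ext1 a b
          simp
        rw [hN, sq, sq, hadd]
        simp only [add_mul, mul_add, smul_mul_assoc, mul_smul_comm, hmul, smul_smul,
          DualNumber.eps_mul_eps, zero_smul, add_zero, smul_add]
        abel
      rw [hsq, ← hcC, ← hcC]
      ext1 a b
      simp [he]
    rw [oneSubSq, ha, oneSubSq, map_sub, map_one, smul_add, smul_comm _ e, ← sub_sub]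
    congr 2
    · ext1 a b; simp [hX]
    · ext1 a b; simp [hX]
  have hdet : ∀ A : Matrix (Fin n ⊕ Fin n) (Fin n ⊕ Fin n) (PowerSeries R), IsUnit A.det →
      IsUnit (j.mapMatrix A).det := fun A hA => by
    rw [← RingHom.map_det]; exact hA.map j
  have hc : ∀ v : Vec n, (fun i => algebraMap ℂ (PowerSeries (DualNumber R)) (v i)) =
      fun i => j (cvec R v i) := by
    intro v
    funext i
    simp [hj, cvec, PowerSeries.algebraMap_apply]
    rfl
  have hmv : ∀ (A : Matrix (Fin n ⊕ Fin n) (Fin n ⊕ Fin n) (PowerSeries R))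
      (v w : Fin n ⊕ Fin n → PowerSeries R),
      omega (fun i => j (w i)) (j.mapMatrix A *ᵥ fun i => j (v i)) = j (omega w (A *ᵥ v)) := by
    intro A v w
    rw [map_omega]
    congr 1
    funext i
    rw [RingHom.map_mulVec]
    rfl
  have hg : genFun M x y = omega (cvec R x) ((oneSubSq M)⁻¹ *ᵥ cvec R y) * ((oneSub M)⁻¹).det := rfl
  have htr : ∀ A : Matrix (Fin n ⊕ Fin n) (Fin n ⊕ Fin n) (PowerSeries R),
      (j.mapMatrix A).trace = j A.trace := fun A => (AddMonoidHom.map_trace j A).symm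
  rw [genFun, h1, h2, det_inv_sub_smul (hdet _ (isUnit_det_oneSub M)) hee,
    inv_sub_smul (hdet _ (isUnit_det_oneSubSq M)) hee,
    ← mapMatrix_inv _ _ (isUnit_det_oneSub M), ← mapMatrix_inv _ _ (isUnit_det_oneSubSq M),
    hc, hc, ← map_mul, ← map_mul, ← map_mul, ← RingHom.map_det, htr, add_mulVec, smul_mulVec,
    omega_add_right, omega_smul_right, hmv, hmv, hg, dGenFun]
  simp only [map_mul, map_add]
  -- What remains is the product of the two first order terms, a multiple of `e * e`.
  linear_combination (j (((oneSub M)⁻¹).det) * j (omega (cvec R x)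
    (((oneSubSq M)⁻¹ * ((PowerSeries.X ^ 2 : PowerSeries R) •
      (M * N + N * M).map PowerSeries.C) * (oneSubSq M)⁻¹) *ᵥ cvec R y)) *
      j ((oneSub M)⁻¹ * ((PowerSeries.X : PowerSeries R) • N.map PowerSeries.C)).trace) * hee

theorem snd_coeff_genFun_dual (M N : Matrix (Fin n ⊕ Fin n) (Fin n ⊕ Fin n) R) (x y : Vec n)
    (k : ℕ) :
    snd (PowerSeries.coeff k (genFun (M.map inl + N.map inr : Matrix _ _ (DualNumber R)) x y)) =
      PowerSeries.coeff k (dGenFun M N x y) := by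
  rw [genFun_dual, map_add, PowerSeries.coeff_C_mul, PowerSeries.coeff_map, PowerSeries.coeff_map]
  simp

end Derivative

/-! ### Calculus with the symplectic form and the cyclic identity -/

section OmegaCalculus

variable {n : ℕ} {T : Type*} [CommRing T]

theorem omega_add_left (x y z : Fin n ⊕ Fin n → T) :
    omega (x + y) z = omega x z + omega y z := by
  simp [omega]

theorem omega_smul_left (x y : Fin n ⊕ Fin n → T) (c : T) :
    omega (c • x) y = c * omega x y := by
  simp [omega]

theorem omega_sub_right (x y z : Fin n ⊕ Fin n → T) :
    omega x (y - z) = omega x y - omega x z := by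
  simp [omega, mulVec_sub]

theorem omega_neg_right (x y : Fin n ⊕ Fin n → T) : omega x (-y) = -omega x y := by
  simp [omega, mulVec_neg]

theorem omega_swap (x y : Fin n ⊕ Fin n → T) : omega y x = -omega x y := by
  rw [omega, omega, Matrix.dotProduct_mulVec, ← Matrix.mulVec_transpose, Matrix.J_transpose,
    Matrix.neg_mulVec, neg_dotProduct, dotProduct_comm]

theorem omega_mulVec_left (A B : Matrix (Fin n ⊕ Fin n) (Fin n ⊕ Fin n) T)
    (h : Aᵀ * Matrix.J (Fin n) T = Matrix.J (Fin n) T * B) (x y : Fin n ⊕ Fin n → T) :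
    omega (A *ᵥ x) y = omega x (B *ᵥ y) := by
  rw [omega, omega, ← Matrix.vecMul_transpose, ← Matrix.dotProduct_mulVec, Matrix.mulVec_mulVec,
    Matrix.mulVec_mulVec, h]

/-- The cyclic identity behind the Jacobi identity: `m` is skew and `P` self-adjoint for the
symplectic form, they commute, and `N z` is the generic element of rank two through `z`. -/
theorem cyclic_omega_identity (m P : Matrix (Fin n ⊕ Fin n) (Fin n ⊕ Fin n) T)
    (hm : mᵀ * Matrix.J (Fin n) T = Matrix.J (Fin n) T * -m)
    (hP : Pᵀ * Matrix.J (Fin n) T = Matrix.J (Fin n) T * P) (hc : m * P = P * m) (q : Fin n ⊕ Fin n → T)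
    (N : (Fin n ⊕ Fin n → T) → Matrix (Fin n ⊕ Fin n) (Fin n ⊕ Fin n) T)
    (hN : ∀ z v, (N z + N z) *ᵥ v = omega v q • z + omega v z • q)
    (x y z : Fin n ⊕ Fin n → T) :
    let F := fun x y z : Fin n ⊕ Fin n → T =>
      omega x ((P * (m * (N z + N z) + (N z + N z) * m) * P) *ᵥ y) +
        2 * omega x (P *ᵥ y) * omega (m *ᵥ (P *ᵥ z)) q
    F x y z + F y z x + F z x y = 0 := by
  intro F
  have hm' : ∀ x y, omega (m *ᵥ x) y = -omega x (m *ᵥ y) := fun x y => by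
    rw [omega_mulVec_left m (-m) hm, neg_mulVec, omega_neg_right]
  have hP' : ∀ x y, omega (P *ᵥ x) y = omega x (P *ᵥ y) := omega_mulVec_left P P hP
  have hcv : ∀ v, P *ᵥ (m *ᵥ v) = m *ᵥ (P *ᵥ v) := fun v => by
    rw [mulVec_mulVec, mulVec_mulVec, hc]
  have hF : ∀ x y z, F x y z = omega x (m *ᵥ (P *ᵥ z)) * omega y (P *ᵥ q)
      + omega x (m *ᵥ (P *ᵥ q)) * omega y (P *ᵥ z)
      - omega y (m *ᵥ (P *ᵥ q)) * omega x (P *ᵥ z)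
      - omega y (m *ᵥ (P *ᵥ z)) * omega x (P *ᵥ q)
      - 2 * omega x (P *ᵥ y) * omega z (m *ᵥ (P *ᵥ q)) := by
    intro x y z
    have hW := hN z
    simp only [F]
    generalize N z + N z = W at hW ⊢
    simp only [mul_add, add_mul, mul_assoc, add_mulVec, ← mulVec_mulVec, hW, mulVec_add, mulVec_smul, omega_add_right, omega_smul_right, hm', hP', hcv]
    ring
  -- The form ω(x, P y) is antisymmetric and ω(x, m P y) is symmetric. After normalizing the
  -- arguments with these two rules, the cyclic sum cancels term by term.
  have hs : ∀ x y, omega y (P *ᵥ x) = -omega x (P *ᵥ y) := fun x y => by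
    rw [omega_swap, hP']
  have hr : ∀ x y, omega y (m *ᵥ (P *ᵥ x)) = omega x (m *ᵥ (P *ᵥ y)) := fun x y => by
    rw [omega_swap, hm', hP', hcv, neg_neg]
  simp only [hF]
  rw [hs x y, hs x z, hs y z, hr x y, hr x z, hr y z]
  ring

end OmegaCalculus

/-! ### The trace form and the generic matrix -/

section GenericMatrix

variable {n : ℕ}

theorem transpose_mul_J (A : Sp n) : A.1ᵀ * Matrix.J (Fin n) ℂ = Matrix.J (Fin n) ℂ * -A.1 := by
  have h : A.1 ∈ skewAdjointMatricesLieSubalgebra (Matrix.J (Fin n) ℂ) := A.2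
  rwa [mem_skewAdjointMatricesLieSubalgebra,
      mem_skewAdjointMatricesSubmodule, Matrix.IsSkewAdjoint, Matrix.IsAdjointPair] at h

theorem mem_sp_of_transpose_mul_J {A : Matrix (Fin n ⊕ Fin n) (Fin n ⊕ Fin n) ℂ}
    (h : Aᵀ * Matrix.J (Fin n) ℂ = Matrix.J (Fin n) ℂ * -A) :
    A ∈ LieAlgebra.Symplectic.sp (Fin n) ℂ := by
  change A ∈ skewAdjointMatricesLieSubalgebra (Matrix.J (Fin n) ℂ)
  rwa [mem_skewAdjointMatricesLieSubalgebra,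
      mem_skewAdjointMatricesSubmodule, Matrix.IsSkewAdjoint, Matrix.IsAdjointPair]

/-- The trace form on `sp_{2n}` is nondegenerate. -/
theorem sp_ext_trace {A B : Sp n} (h : ∀ C : Sp n, (A.1 * C.1).trace = (B.1 * C.1).trace) :
    A = B := by
  ext a b
  rw [← trace_coordElt_mul, ← trace_coordElt_mul, Matrix.trace_mul_comm, h,
    Matrix.trace_mul_comm]

theorem sum_coordElt (A : Sp n) : ∑ a, ∑ b, A.1 b a • coordElt n a b = A := by
  apply sp_ext_trace
  intro C
  have h : (∑ a, ∑ b, A.1 b a • coordElt n a b : Sp n).1 =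
      ∑ a, ∑ b, A.1 b a • (coordElt n a b).1 := by
    simp
  rw [h]
  simp only [Finset.sum_mul, Matrix.trace_sum, smul_mul_assoc, Matrix.trace_smul,
    trace_coordElt_mul, smul_eq_mul]
  simp only [Matrix.trace, Matrix.diag_apply, Matrix.mul_apply]
  exact Finset.sum_comm

/-- The equations that cut out sp_{2n} are linear. They hold for the matrix entries as functions on
sp_{2n}, hence for the elements `coordElt n a b` dual to them under the trace form, and so for the
images of these under any linear map. -/
theorem genericMatrix_transpose_mul_J {R : Type*} [CommRing R] [Algebra ℂ R] (f : Sp n →ₗ[ℂ] R) :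
    (Matrix.of fun a b => f (coordElt n a b))ᵀ * Matrix.J (Fin n) R =
      Matrix.J (Fin n) R * -(Matrix.of fun a b => f (coordElt n a b)) := by
  have key : ∀ a b, ∑ c, Matrix.J (Fin n) ℂ c b • coordElt n c a =
      -∑ c, Matrix.J (Fin n) ℂ a c • coordElt n c b := by
    intro a b
    apply sp_ext_trace
    intro C
    have h := congrFun (congrFun (transpose_mul_J C) a) b
    have h1 : (∑ c, Matrix.J (Fin n) ℂ c b • coordElt n c a : Sp n).1 =
      ∑ c, Matrix.J (Fin n) ℂ c b • (coordElt n c a).1 := by simp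
    have h2 : (-∑ c, Matrix.J (Fin n) ℂ a c • coordElt n c b : Sp n).1 =
      -∑ c, Matrix.J (Fin n) ℂ a c • (coordElt n c b).1 := by simp
    rw [h1, h2]
    simp only [neg_mul, Finset.sum_mul, Matrix.trace_neg, Matrix.trace_sum, smul_mul_assoc,
      Matrix.trace_smul, trace_coordElt_mul, smul_eq_mul]
    rw [Matrix.mul_apply, Matrix.mul_apply] at h
    simpa [mul_comm] using h
  have hJ : ∀ a b, Matrix.J (Fin n) R a b = algebraMap ℂ R (Matrix.J (Fin n) ℂ a b) := by
    intro i j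
    rcases i with i | i <;> rcases j with j | j <;> by_cases h : i = j <;>
      simp [Matrix.J, h]
  ext1 a b
  have := congrArg f (key a b)
  simp only [map_neg, map_sum, map_smul, Algebra.smul_def] at this
  rw [Matrix.mul_apply, Matrix.mul_apply]
  simpa [hJ, mul_comm] using this

end GenericMatrix

/-! ### Derivatives along conjugation and along rank two directions -/

section Skew

variable {n : ℕ} {R : Type*} [CommRing R] [Algebra ℂ R]

theorem transpose_mul_J_map {R T : Type*} [CommRing R] [CommRing T] (f : R →+* T)
    {A B : Matrix (Fin n ⊕ Fin n) (Fin n ⊕ Fin n) R}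
    (h : Aᵀ * Matrix.J (Fin n) R = Matrix.J (Fin n) R * B) :
    (A.map f)ᵀ * Matrix.J (Fin n) T = Matrix.J (Fin n) T * B.map f := by
  have hJ : f.mapMatrix (Matrix.J (Fin n) R) = Matrix.J (Fin n) T := by
    ext1 i j
    rcases i with i | i <;> rcases j with j | j <;> by_cases h : i = j <;>
      simp [Matrix.J, h]
  have h' := congrArg f.mapMatrix h
  rw [map_mul, map_mul, hJ] at h'
  exact h'

theorem oneSubSq_eq (M : Matrix (Fin n ⊕ Fin n) (Fin n ⊕ Fin n) R) :
    oneSubSq M = 1 - (PowerSeries.X ^ 2 : PowerSeries R) •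
      (M.map PowerSeries.C * M.map PowerSeries.C) := by
  have : (M ^ 2).map (PowerSeries.C : R →+* _) = M.map PowerSeries.C * M.map PowerSeries.C := by
    rw [sq]
    exact (PowerSeries.C : R →+* _).mapMatrix.map_mul M M
  rw [oneSubSq, this]

theorem oneSubSq_inv_comm (M : Matrix (Fin n ⊕ Fin n) (Fin n ⊕ Fin n) R) :
    M.map PowerSeries.C * (oneSubSq M)⁻¹ = (oneSubSq M)⁻¹ * M.map PowerSeries.C := by
  have h1 := Matrix.mul_nonsing_inv _ (isUnit_det_oneSubSq M)
  have h2 := Matrix.nonsing_inv_mul _ (isUnit_det_oneSubSq M)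
  have h3 : M.map PowerSeries.C * oneSubSq M = oneSubSq M * M.map PowerSeries.C := by
    rw [oneSubSq_eq]
    simp [mul_sub, sub_mul, mul_assoc]
  calc _ = ((oneSubSq M)⁻¹ * oneSubSq M) * M.map PowerSeries.C * (oneSubSq M)⁻¹ := by
        rw [h2, one_mul]
    _ = (oneSubSq M)⁻¹ * (oneSubSq M * M.map PowerSeries.C) * (oneSubSq M)⁻¹ := by
        simp only [mul_assoc]
    _ = (oneSubSq M)⁻¹ * M.map PowerSeries.C * (oneSubSq M * (oneSubSq M)⁻¹) := by
        rw [← h3]; simp only [mul_assoc]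
    _ = _ := by rw [h1, mul_one]

/-- From (1 - τM)⁻¹ = (1 + τM)(1 - τ²M²)⁻¹; the two summands are the even and odd parts in τ. -/
theorem oneSub_inv (M : Matrix (Fin n ⊕ Fin n) (Fin n ⊕ Fin n) R) :
    (oneSub M)⁻¹ = (oneSubSq M)⁻¹ +
      (PowerSeries.X : PowerSeries R) • (M.map PowerSeries.C * (oneSubSq M)⁻¹) := by
  apply Matrix.inv_eq_right_inv
  have h1 := Matrix.mul_nonsing_inv _ (isUnit_det_oneSubSq M)
  have h2 : (1 - (PowerSeries.X ^ 2 : PowerSeries R) •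
      (M.map PowerSeries.C * M.map PowerSeries.C)) * (oneSubSq M)⁻¹ = 1 := by
    rw [← oneSubSq_eq, h1]
  rw [← h2]
  simp only [oneSub, sub_mul, mul_add, one_mul, smul_mul_assoc, mul_smul_comm, smul_sub, mul_smul,
    sq, mul_assoc]
  abel

theorem oneSubSq_inv_transpose_mul_J {M : Matrix (Fin n ⊕ Fin n) (Fin n ⊕ Fin n) R}
    (hM : Mᵀ * Matrix.J (Fin n) R = Matrix.J (Fin n) R * -M) :
    ((oneSubSq M)⁻¹)ᵀ * Matrix.J (Fin n) (PowerSeries R) =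
      Matrix.J (Fin n) (PowerSeries R) * (oneSubSq M)⁻¹ := by
  set J := Matrix.J (Fin n) (PowerSeries R)
  have hm : (M.map PowerSeries.C)ᵀ * J = J * -(M.map PowerSeries.C) := by
    have := transpose_mul_J_map (PowerSeries.C : R →+* PowerSeries R) hM
    rw [this]
    congr 1
    ext1 a b
    simp
  have hQ : (oneSubSq M)ᵀ * J = J * oneSubSq M := by
    rw [oneSubSq_eq]
    simp only [transpose_sub, transpose_smul, transpose_mul, transpose_one, sub_mul, mul_sub,
      one_mul, mul_one, smul_mul_assoc, mul_smul_comm, mul_assoc, hm]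
    rw [← mul_assoc, hm]
    simp [mul_assoc]
  have h1 := Matrix.mul_nonsing_inv _ (isUnit_det_oneSubSq M)
  calc _ = ((oneSubSq M)⁻¹)ᵀ * (J * oneSubSq M) * (oneSubSq M)⁻¹ := by
        rw [mul_assoc, mul_assoc, h1, mul_one]
    _ = (oneSubSq M * (oneSubSq M)⁻¹)ᵀ * J * (oneSubSq M)⁻¹ := by
        rw [← hQ, transpose_mul]; simp only [mul_assoc]
    _ = _ := by rw [h1, transpose_one, one_mul]

theorem map_C_mul_add (M N : Matrix (Fin n ⊕ Fin n) (Fin n ⊕ Fin n) R) :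
    (M * N + N * M).map (PowerSeries.C : R →+* PowerSeries R) =
      M.map PowerSeries.C * N.map PowerSeries.C + N.map PowerSeries.C * M.map PowerSeries.C := by
  have := (PowerSeries.C : R →+* PowerSeries R).mapMatrix.map_add (M * N) (N * M)
  rw [map_mul, map_mul] at this
  exact this

/-- Infinitesimal invariance under conjugation: moving M along its orbit amounts to moving x and y.
The determinant, being a class function, does not contribute. -/
theorem dGenFun_commutator {M : Matrix (Fin n ⊕ Fin n) (Fin n ⊕ Fin n) R} (C : Sp n) (x y : Vec n) :
    dGenFun M (M * C.1.map (algebraMap ℂ R) - C.1.map (algebraMap ℂ R) * M) x y =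
      genFun M (C.1 *ᵥ x) y + genFun M x (C.1 *ᵥ y) := by
  set P := (oneSubSq M)⁻¹ with hPdef
  set m := M.map (PowerSeries.C : R →+* PowerSeries R) with hm
  set c : Matrix (Fin n ⊕ Fin n) (Fin n ⊕ Fin n) (PowerSeries R) :=
    C.1.map (algebraMap ℂ (PowerSeries R)) with hc
  have hcm : (C.1.map (algebraMap ℂ R)).map (PowerSeries.C : R →+* PowerSeries R) = c := by
    ext1 a b
    simp [hc, PowerSeries.algebraMap_apply]
  have hN : (M * C.1.map (algebraMap ℂ R) - C.1.map (algebraMap ℂ R) * M).map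
      (PowerSeries.C : R →+* PowerSeries R) = m * c - c * m := by
    have := (PowerSeries.C : R →+* PowerSeries R).mapMatrix.map_sub
      (M * C.1.map (algebraMap ℂ R)) (C.1.map (algebraMap ℂ R) * M)
    rw [map_mul, map_mul] at this
    simp only [RingHom.mapMatrix_apply] at this
    rw [this, hcm]
  have hcx : ∀ x : Vec n, cvec R (C.1 *ᵥ x) = c *ᵥ cvec R x := by
    intro x
    funext i
    simp only [cvec, RingHom.map_mulVec]
    rfl
  have hcJ : ∀ x y, omega (c *ᵥ x) y = omega x (-c *ᵥ y) := by
    refine omega_mulVec_left _ _ ?_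
    rw [hc, transpose_mul_J_map _ (transpose_mul_J C)]
    congr 1
    ext1 a b
    simp
  have h1 := Matrix.mul_nonsing_inv _ (isUnit_det_oneSubSq M)
  have h2 := Matrix.nonsing_inv_mul _ (isUnit_det_oneSubSq M)
  have hQ := oneSubSq_eq M
  have hcomm := oneSubSq_inv_comm M
  -- The matrix (1 - τM)⁻¹ commutes with M, so its trace against a commutator with M vanishes.
  have htr : ((oneSub M)⁻¹ * ((PowerSeries.X : PowerSeries R) • (m * c - c * m))).trace = 0 := by
    have hD : m * (oneSub M)⁻¹ = (oneSub M)⁻¹ * m := by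
      rw [oneSub_inv]
      simp only [mul_add, add_mul, smul_mul_assoc, mul_smul_comm]
      rw [mul_assoc (M.map PowerSeries.C) _ m, ← hcomm]
    rw [mul_smul_comm, trace_smul, mul_sub, trace_sub, ← mul_assoc, ← mul_assoc, ← hD,
      Matrix.trace_mul_comm (_ * c), ← mul_assoc, sub_self, smul_zero]
  have hmid : P * ((PowerSeries.X ^ 2 : PowerSeries R) • (m * (m * c - c * m) + (m * c - c * m) * m)) * P
      = P * c - c * P := by
    have e1 : (PowerSeries.X ^ 2 : PowerSeries R) • (m * (m * c - c * m) + (m * c - c * m) * m) =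
        c * oneSubSq M - oneSubSq M * c := by
      rw [hQ]
      simp only [mul_sub, sub_mul, mul_one, one_mul, smul_mul_assoc, mul_smul_comm, smul_sub,
        smul_add, mul_assoc]
      abel
    rw [e1, mul_sub, sub_mul, mul_assoc, mul_assoc, h1, mul_one, ← mul_assoc, h2, one_mul]
  have hg : ∀ x y, genFun M x y = omega (cvec R x) (P *ᵥ cvec R y) * ((oneSub M)⁻¹).det :=
    fun _ _ => rfl
  rw [dGenFun, map_C_mul_add, hN, htr, hmid, hg, hg, hcx, hcx, hcJ, sub_mulVec, omega_sub_right,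
    neg_mulVec, omega_neg_right, mulVec_mulVec, mulVec_mulVec]
  ring

/-- Up to a common factor, each derivative is the expression of `cyclic_omega_identity`. The
directions `N z` are given through their doubles, and the inverse of 2 reappears in that common
factor. -/
theorem sum_dGenFun_cyclic {M : Matrix (Fin n ⊕ Fin n) (Fin n ⊕ Fin n) R}
    (hM : Mᵀ * Matrix.J (Fin n) R = Matrix.J (Fin n) R * -M) (q : Fin n ⊕ Fin n → R)
    (N : Vec n → Matrix (Fin n ⊕ Fin n) (Fin n ⊕ Fin n) R)
    (hN : ∀ z, N z + N z =
      vecMulVec (fun i => algebraMap ℂ R (z i)) (Matrix.J (Fin n) R *ᵥ q) +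
      vecMulVec q (Matrix.J (Fin n) R *ᵥ fun i => algebraMap ℂ R (z i))) (x y z : Vec n) :
    dGenFun M (N z) x y + dGenFun M (N x) y z + dGenFun M (N y) z x = 0 := by
  set P := (oneSubSq M)⁻¹ with hPdef
  set m := M.map (PowerSeries.C : R →+* PowerSeries R) with hm
  set J := Matrix.J (Fin n) (PowerSeries R) with hJdef
  set q' : Fin n ⊕ Fin n → PowerSeries R := fun i => PowerSeries.C (q i) with hq'
  have hJ : (Matrix.J (Fin n) R).map (PowerSeries.C : R →+* PowerSeries R) = J := by
    ext1 i j
    rcases i with i | i <;> rcases j with j | j <;> by_cases h : i = j <;>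
      simp [hJdef, Matrix.J, h]
  have hmJ : mᵀ * J = J * -m := by
    rw [hm, transpose_mul_J_map _ hM]
    congr 1
    ext1 a b
    simp
  have hPJ : Pᵀ * J = J * P := oneSubSq_inv_transpose_mul_J hM
  have hcomm : m * P = P * m := oneSubSq_inv_comm M
  set N' : (Fin n ⊕ Fin n → PowerSeries R) → Matrix (Fin n ⊕ Fin n) (Fin n ⊕ Fin n) (PowerSeries R) :=
    fun v => algebraMap ℂ (PowerSeries R) (2⁻¹) • (vecMulVec v (J *ᵥ q') + vecMulVec q' (J *ᵥ v)) with hN'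
  have hhalf : algebraMap ℂ (PowerSeries R) (2⁻¹) + algebraMap ℂ (PowerSeries R) (2⁻¹) = 1 := by
    rw [← map_add]; norm_num
  have hN2 : ∀ v, N' v + N' v = vecMulVec v (J *ᵥ q') + vecMulVec q' (J *ᵥ v) := by
    intro v
    rw [hN', ← add_smul, hhalf, one_smul]
  have hNv : ∀ v w, (N' v + N' v) *ᵥ w = omega w q' • v + omega w v • q' := by
    intro v w
    rw [hN2, add_mulVec, vecMulVec_mulVec, vecMulVec_mulVec]
    simp only [omega, dotProduct_comm w, op_smul_eq_smul]
    rfl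
  have hNN : ∀ v : Vec n, (N v).map (PowerSeries.C : R →+* PowerSeries R) +
      (N v).map (PowerSeries.C : R →+* PowerSeries R) = N' (cvec R v) + N' (cvec R v) := by
    intro v
    have h := congrArg (PowerSeries.C : R →+* PowerSeries R).mapMatrix (hN v)
    rw [map_add] at h
    simp only [RingHom.mapMatrix_apply] at h
    have hJq : ∀ (u : Fin n ⊕ Fin n → R) b, PowerSeries.C ((Matrix.J (Fin n) R *ᵥ u) b) =
        (J *ᵥ fun i => PowerSeries.C (u i)) b := by
      intro u b
      rw [RingHom.map_mulVec]
      rw [hJ]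
      rfl
    rw [h, hN2]
    ext1 a b
    have hcv : (fun i => PowerSeries.C (algebraMap ℂ R (v i))) = cvec R v := by
      funext i
      simp [cvec, PowerSeries.algebraMap_apply]
    simp only [Matrix.map_apply, Matrix.add_apply, vecMulVec_apply, map_add, map_mul, hJq, hq', hcv]
    rw [show PowerSeries.C (algebraMap ℂ R (v a)) = cvec R v a from congrFun hcv a]
  have hNeq : ∀ v : Vec n, (N v).map (PowerSeries.C : R →+* PowerSeries R) = N' (cvec R v) := by
    intro v
    have h := congrArg (fun X => algebraMap ℂ (PowerSeries R) (2⁻¹) • X) (hNN v)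
    simpa only [smul_add, ← add_smul, hhalf, one_smul] using h
  have hcyc := cyclic_omega_identity m P hmJ hPJ hcomm q' N' hNv (cvec R x) (cvec R y) (cvec R z)
  have hm' : ∀ x y, omega (m *ᵥ x) y = -omega x (m *ᵥ y) := fun x y => by
    rw [omega_mulVec_left m (-m) hmJ, neg_mulVec, omega_neg_right]
  have hP' : ∀ x y, omega (P *ᵥ x) y = omega x (P *ᵥ y) := omega_mulVec_left P P hPJ
  have htr : ∀ v, ((oneSub M)⁻¹ * ((PowerSeries.X : PowerSeries R) • N' v)).trace =
      PowerSeries.X ^ 2 * omega (m *ᵥ (P *ᵥ v)) q' := by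
    intro v
    have h0 : ((oneSub M)⁻¹ * (N' v + N' v)).trace = omega ((oneSub M)⁻¹ *ᵥ v) q' +
        omega ((oneSub M)⁻¹ *ᵥ q') v := by
      rw [hN2, mul_add, trace_add, mul_vecMulVec, mul_vecMulVec, trace_vecMulVec, trace_vecMulVec]
      rfl
    -- The even part of (1 - τM)⁻¹ is self-adjoint and its two contributions cancel; the odd part is
    -- skew and its contributions agree. This is the source of the factor τ² in `htr`.
    have h1 : omega ((oneSub M)⁻¹ *ᵥ v) q' + omega ((oneSub M)⁻¹ *ᵥ q') v =
        2 * (PowerSeries.X * omega (m *ᵥ (P *ᵥ v)) q') := by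
      have e1 : omega (P *ᵥ q') v = -omega (P *ᵥ v) q' := by rw [hP', omega_swap]
      have e2 : omega (m *ᵥ (P *ᵥ q')) v = omega (m *ᵥ (P *ᵥ v)) q' := by
        rw [hm', hP', omega_swap, neg_neg]
        simp only [mulVec_mulVec, hcomm]
      rw [oneSub_inv, add_mulVec, add_mulVec, omega_add_left, omega_add_left, smul_mulVec,
        smul_mulVec, omega_smul_left, omega_smul_left, ← mulVec_mulVec, ← mulVec_mulVec]
      change omega (P *ᵥ v) q' + PowerSeries.X * omega (m *ᵥ (P *ᵥ v)) q' +
        (omega (P *ᵥ q') v + PowerSeries.X * omega (m *ᵥ (P *ᵥ q')) v) = _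
      rw [e1, e2]
      ring
    rw [mul_add, trace_add] at h0
    rw [mul_smul_comm, trace_smul, smul_eq_mul]
    linear_combination (algebraMap ℂ (PowerSeries R) (2⁻¹)) * PowerSeries.X * (h0.trans h1) -
      (PowerSeries.X * ((oneSub M)⁻¹ * N' v).trace -
        PowerSeries.X ^ 2 * omega (m *ᵥ (P *ᵥ v)) q') * hhalf
  have hd : ∀ x y z, dGenFun M (N z) x y = algebraMap ℂ (PowerSeries R) (2⁻¹) *
      PowerSeries.X ^ 2 * ((oneSub M)⁻¹).det *
      (omega (cvec R x) ((P * (m * (N' (cvec R z) + N' (cvec R z)) +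
        (N' (cvec R z) + N' (cvec R z)) * m) * P) *ᵥ cvec R y) +
        2 * omega (cvec R x) (P *ᵥ cvec R y) * omega (m *ᵥ (P *ᵥ cvec R z)) q') := by
    intro x y z
    have e1 : m * (N' (cvec R z) + N' (cvec R z)) + (N' (cvec R z) + N' (cvec R z)) * m =
        (2 : PowerSeries R) • (m * N' (cvec R z) + N' (cvec R z) * m) := by
      rw [two_smul, mul_add, add_mul]
      abel
    rw [dGenFun, map_C_mul_add, hNeq, htr, e1]
    simp only [mul_smul_comm, smul_mul_assoc, smul_mulVec, omega_smul_right]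
    linear_combination -((oneSub M)⁻¹).det * (PowerSeries.X ^ 2 * omega (cvec R x)
      ((P * (m * N' (cvec R z) + N' (cvec R z) * m) * P) *ᵥ cvec R y) +
      PowerSeries.X ^ 2 * omega (cvec R x) (P *ᵥ cvec R y) * omega (m *ᵥ (P *ᵥ cvec R z)) q') * hhalf
  rw [hd, hd, hd, ← mul_add, ← mul_add, hcyc, mul_zero]

end Skew

/-! ### Equivariance and the Jacobi identity for the elements r -/

section StructureOfR

variable {n : ℕ} {A : Type*} [Ring A] [Algebra ℂ A]

theorem snd_adDeform_beta (j : Sp n →ₗ[ℂ] A) (c : A) (k : ℕ) (x y : Vec n) :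
    snd (adDeform j c (beta n k x y)) = PowerSeries.coeff (2 * k)
      (dGenFun (Matrix.of fun a b => SymmetricAlgebra.ι ℂ A (j (coordElt n a b)))
        (Matrix.of fun a b => SymmetricAlgebra.ι ℂ A
          (c * j (coordElt n a b) - j (coordElt n a b) * c)) x y) := by
  have h : (genericMatrix n).map (adDeform j c) =
      (Matrix.of fun a b => SymmetricAlgebra.ι ℂ A (j (coordElt n a b))).map inl +
      (Matrix.of fun a b => SymmetricAlgebra.ι ℂ A
          (c * j (coordElt n a b) - j (coordElt n a b) * c)).map inr := by
    ext1 a b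
    simp only [genericMatrix, Matrix.map_apply, Matrix.of_apply, adDeform_ι, Matrix.add_apply]
  rw [← snd_coeff_genFun_dual, ← h, ← map_genFun, PowerSeries.coeff_map]
  rfl

theorem symMap_beta {L : Type*} [AddCommGroup L] [Module ℂ L] (j : Sp n →ₗ[ℂ] L) (k : ℕ) (x y : Vec n) :
    symMap j (beta n k x y) = PowerSeries.coeff (2 * k)
      (genFun (Matrix.of fun a b => SymmetricAlgebra.ι ℂ L (j (coordElt n a b))) x y) := by
  have h : (genericMatrix n).map (symMap j) =
      Matrix.of fun a b => SymmetricAlgebra.ι ℂ L (j (coordElt n a b)) := by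
    ext1 a b
    simp only [genericMatrix, Matrix.map_apply, Matrix.of_apply, symMap_ι]
  rw [← h, ← map_genFun, PowerSeries.coeff_map]
  rfl

/-- The bracket with C is skew for the trace form, so on elements dual to matrix entries it is read
off from the entries of [A, C]. -/
theorem lie_coordElt (C : Sp n) (a b : Fin n ⊕ Fin n) :
    ⁅C, coordElt n a b⁆ = ∑ k, (C.1 k b • coordElt n a k - C.1 a k • coordElt n k b) := by
  apply sp_ext_trace
  intro A
  have h1 : (∑ k, (C.1 k b • coordElt n a k - C.1 a k • coordElt n k b) : Sp n).1 =
      ∑ k, (C.1 k b • (coordElt n a k).1 - C.1 a k • (coordElt n k b).1) := by simp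
  have h2 : (⁅C, coordElt n a b⁆ : Sp n).1 = C.1 * (coordElt n a b).1 - (coordElt n a b).1 * C.1 :=
    rfl
  have h3 := trace_coordElt_mul a b ⁅A, C⁆
  have h4 : (⁅A, C⁆ : Sp n).1 = A.1 * C.1 - C.1 * A.1 := rfl
  rw [h4, mul_sub, trace_sub, ← mul_assoc, ← mul_assoc] at h3
  rw [h1, h2, sub_mul, trace_sub, mul_assoc, Matrix.trace_mul_comm, h3]
  simp only [Finset.sum_mul, Matrix.trace_sum, sub_mul, smul_mul_assoc, trace_sub,
    Matrix.trace_smul, trace_coordElt_mul, smul_eq_mul, Matrix.sub_apply, Matrix.mul_apply,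
    Finset.sum_sub_distrib]
  simp [mul_comm]

/-- When `c` acts on the generators through C, the deformation of the generic matrix is its
commutator with C, and `dGenFun_commutator` applies. -/
theorem lie_symA_beta (j : Sp n →ₗ[ℂ] A) (c : A) (C : Sp n)
    (hbr : ∀ B, c * j B - j B * c = j ⁅C, B⁆) (k : ℕ) (x y : Vec n) :
    c * symA A (symMap j (beta n k x y)) - symA A (symMap j (beta n k x y)) * c =
      symA A (symMap j (beta n k (C.1 *ᵥ x) y)) + symA A (symMap j (beta n k x (C.1 *ᵥ y))) := by
  rw [← symA_snd_adDeform, snd_adDeform_beta, symMap_beta, symMap_beta, ← map_add, ← map_add,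
    ← dGenFun_commutator C]
  have hN : (Matrix.of fun a b => SymmetricAlgebra.ι ℂ A
      (c * j (coordElt n a b) - j (coordElt n a b) * c)) =
      (Matrix.of fun a b => SymmetricAlgebra.ι ℂ A (j (coordElt n a b))) *
        C.1.map (algebraMap ℂ (SymmetricAlgebra ℂ A)) -
      C.1.map (algebraMap ℂ (SymmetricAlgebra ℂ A)) *
        (Matrix.of fun a b => SymmetricAlgebra.ι ℂ A (j (coordElt n a b))) := by
    ext1 a b
    rw [Matrix.of_apply, hbr, lie_coordElt, Matrix.sub_apply, Matrix.mul_apply, Matrix.mul_apply,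
      ← Finset.sum_sub_distrib, map_sum, map_sum]
    refine Finset.sum_congr rfl fun i _ => ?_
    rw [map_sub, map_sub, map_smul, map_smul, map_smul, map_smul, Algebra.smul_def,
      Algebra.smul_def, mul_comm]
    rfl
  rw [hN]

/-- `r_{2k}` is equivariant under `sp_{2n}`. -/
theorem lie_r (C : Sp n) (k : ℕ) (x y : Vec n) :
    UniversalEnvelopingAlgebra.ι ℂ C * r n k x y - r n k x y * UniversalEnvelopingAlgebra.ι ℂ C =
      r n k (C.1 *ᵥ x) y + r n k x (C.1 *ᵥ y) := by
  have hs := symA_symMap (L := Sp n) (AlgHom.id ℂ (USp n))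
  have key := lie_symA_beta ((AlgHom.id ℂ (USp n)).toLinearMap ∘ₗ
    (UniversalEnvelopingAlgebra.ι ℂ : Sp n →ₗ⁅ℂ⁆ USp n).toLinearMap)
    (UniversalEnvelopingAlgebra.ι ℂ C) C (fun B => by
      have := (UniversalEnvelopingAlgebra.ι ℂ : Sp n →ₗ⁅ℂ⁆ USp n).map_lie C B
      rw [LieRing.of_associative_ring_bracket] at this
      exact this.symm) k x y
  rw [hs, hs, hs] at key
  exact key

theorem coordElt_mulVec (a b : Fin n ⊕ Fin n) (z : Vec n) :
    (coordElt n a b).1 *ᵥ z = (2 : ℂ)⁻¹ • (z a • Pi.single b 1 +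
      (Matrix.J (Fin n) ℂ *ᵥ z) b • fun i => Matrix.J (Fin n) ℂ i a) := by
  simp only [coordElt, smul_mulVec, add_mulVec, ← mulVec_mulVec, Matrix.single_mulVec]
  congr 2
  · ext i; by_cases h : i = b <;> simp [h]
  · ext i
    have : (Function.update 0 a (1 * (Matrix.J (Fin n) ℂ *ᵥ z) b) : Vec n) =
      Pi.single a ((Matrix.J (Fin n) ℂ *ᵥ z) b) := by rw [one_mul]; rfl
    rw [this]
    simp [Matrix.mulVec_single, mul_comm]

/-- The generators in `sp_{2n}`, as a linear map. -/
def semiG (n : ℕ) : Sp n →ₗ[ℂ] Semi n :=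
  (RingQuot.mkAlgHom ℂ (SemiRel n)).toLinearMap ∘ₗ TensorAlgebra.ι ℂ ∘ₗ LinearMap.inl ℂ _ _

/-- The generators in `V_{2n}`, as a linear map. -/
def semiV (n : ℕ) : Vec n →ₗ[ℂ] Semi n :=
  (RingQuot.mkAlgHom ℂ (SemiRel n)).toLinearMap ∘ₗ TensorAlgebra.ι ℂ ∘ₗ LinearMap.inr ℂ _ _

theorem semiG_apply (B : Sp n) : semiG n B = semiGen n (.inl B) := rfl

theorem semiV_apply (v : Vec n) : semiV n v = semiGen n (.inr v) := rfl

theorem ofUSp_ι (B : Sp n) : ofUSp n (UniversalEnvelopingAlgebra.ι ℂ B) = semiGen n (.inl B) := by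
  rw [ofUSp, UniversalEnvelopingAlgebra.lift_ι_apply]
  rfl

theorem semi_act (B : Sp n) (v : Vec n) :
    semiGen n (.inl B) * semiGen n (.inr v) - semiGen n (.inr v) * semiGen n (.inl B) =
      semiGen n (.inr (B.1 *ᵥ v)) := by
  have := RingQuot.mkAlgHom_rel ℂ (SemiRel.act B v)
  simp only [map_sub, map_mul] at this
  exact this

/-- The commutator of `g z` with an entry of the generic matrix is minus g of `coordElt n a b`
applied to z. As a matrix in a and b this is a direction of rank two, built from z and the vector p
of generators g(e_i), so `sum_dGenFun_cyclic` applies. -/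
theorem jacobi_symA_beta (j : Sp n →ₗ[ℂ] A) (g : Vec n →ₗ[ℂ] A)
    (hbr : ∀ B z, j B * g z - g z * j B = g (B.1 *ᵥ z)) (k : ℕ) (x y z : Vec n) :
    let F := fun x y => symA A (symMap j (beta n k x y))
    (g z * F x y - F x y * g z) + (g x * F y z - F y z * g x) + (g y * F z x - F z x * g y) = 0 := by
  intro F
  simp only [F]
  rw [← symA_snd_adDeform, ← symA_snd_adDeform, ← symA_snd_adDeform, ← map_add, ← map_add,
    snd_adDeform_beta, snd_adDeform_beta, snd_adDeform_beta, ← map_add, ← map_add]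
  set R := SymmetricAlgebra ℂ A
  set p : Fin n ⊕ Fin n → R := fun i => SymmetricAlgebra.ι ℂ A (g (Pi.single i 1)) with hp
  have hv : ∀ v : Vec n, SymmetricAlgebra.ι ℂ A (g v) = ∑ i, algebraMap ℂ R (v i) * p i := by
    intro v
    conv_lhs => rw [pi_eq_sum_univ' v]
    simp only [map_sum, map_smul, ← Algebra.smul_def, hp]
  have hJ : (Matrix.J (Fin n) ℂ).map (algebraMap ℂ R) = Matrix.J (Fin n) R := by
    ext1 i j
    rcases i with i | i <;> rcases j with j | j <;> by_cases h : i = j <;>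
      simp [Matrix.J, h]
  have hcyc := sum_dGenFun_cyclic (R := R)
    (M := Matrix.of fun a b => SymmetricAlgebra.ι ℂ A (j (coordElt n a b)))
    (genericMatrix_transpose_mul_J (SymmetricAlgebra.ι ℂ A ∘ₗ j))
    -- The second vector is taken to be J p, so that the factor J q of the rank two formula is -p.
    (Matrix.J (Fin n) R *ᵥ p)
    (fun z => Matrix.of fun a b => SymmetricAlgebra.ι ℂ A
          (g z * j (coordElt n a b) - j (coordElt n a b) * g z)) ?_ x y z
  · rw [hcyc, map_zero, map_zero]
  intro z
  ext1 a b
  have h1 : g z * j (coordElt n a b) - j (coordElt n a b) * g z = -g ((coordElt n a b).1 *ᵥ z) := by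
    rw [← hbr, neg_sub]
  have h2 : SymmetricAlgebra.ι ℂ A (g ((coordElt n a b).1 *ᵥ z)) +
      SymmetricAlgebra.ι ℂ A (g ((coordElt n a b).1 *ᵥ z)) =
      algebraMap ℂ R (z a) * p b - (Matrix.J (Fin n) R *ᵥ fun i => algebraMap ℂ R (z i)) b *
        (Matrix.J (Fin n) R *ᵥ p) a := by
    have e0 : (coordElt n a b).1 *ᵥ z + (coordElt n a b).1 *ᵥ z = z a • Pi.single b 1 +
      (Matrix.J (Fin n) ℂ *ᵥ z) b • fun i => Matrix.J (Fin n) ℂ i a := by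
      rw [coordElt_mulVec, ← add_smul]
      norm_num
    rw [← map_add, ← map_add, e0]
    simp only [map_add, map_smul]
    have e1 : (Matrix.J (Fin n) R *ᵥ fun i => algebraMap ℂ R (z i)) b =
        algebraMap ℂ R ((Matrix.J (Fin n) ℂ *ᵥ z) b) := by
      rw [RingHom.map_mulVec, hJ]
      rfl
    have e2 : SymmetricAlgebra.ι ℂ A (g fun i => Matrix.J (Fin n) ℂ i a) =
        -(Matrix.J (Fin n) R *ᵥ p) a := by
      rw [hv, ← neg_eq_iff_eq_neg, ← Finset.sum_neg_distrib]
      simp only [Matrix.mulVec, dotProduct]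
      refine Finset.sum_congr rfl fun i _ => ?_
      have := congrFun (congrFun (Matrix.J_transpose (Fin n) R) a) i
      rw [Matrix.transpose_apply, Matrix.neg_apply] at this
      rw [← neg_mul]
      congr 1
      rw [← neg_eq_iff_eq_neg] at this
      rw [← this, ← hJ]
      rfl
    rw [e2, e1, Algebra.smul_def, Algebra.smul_def]
    ring
  have h3 : (Matrix.J (Fin n) R *ᵥ (Matrix.J (Fin n) R *ᵥ p)) b = -p b := by
    rw [mulVec_mulVec, Matrix.J_squared, neg_mulVec, one_mulVec]
    rfl
  simp only [Matrix.add_apply, Matrix.of_apply, vecMulVec_apply, h1, map_neg, h3]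
  rw [← neg_add, h2]
  ring

/-- The Jacobi identity for `r_{2k}` in the semidirect product. -/
theorem jacobi_r (k : ℕ) (x y z : Vec n) :
    (semiV n z * ofUSp n (r n k x y) - ofUSp n (r n k x y) * semiV n z) +
    (semiV n x * ofUSp n (r n k y z) - ofUSp n (r n k y z) * semiV n x) +
    (semiV n y * ofUSp n (r n k z x) - ofUSp n (r n k z x) * semiV n y) = 0 := by
  have hs := symA_symMap (ofUSp n)
  have key := jacobi_symA_beta ((ofUSp n).toLinearMap ∘ₗ
    (UniversalEnvelopingAlgebra.ι ℂ : Sp n →ₗ⁅ℂ⁆ USp n).toLinearMap) (semiV n) (fun B z => by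
      have h : ((ofUSp n).toLinearMap ∘ₗ (UniversalEnvelopingAlgebra.ι ℂ :
        Sp n →ₗ⁅ℂ⁆ USp n).toLinearMap) B = semiGen n (.inl B) := ofUSp_ι B
      rw [h, semiV_apply, semi_act, semiV_apply]) k x y z
  simp only [hs] at key
  exact key

end StructureOfR

/-! ### Deforming multiplication operators on a Fock space -/

section Fock

/-- The filtration of a space by the order of nilpotency of a family of operators. -/
def derivFil {I M : Type*} [AddCommGroup M] [Module ℂ M] (d : I → End ℂ M) : ℕ → Submodule ℂ M
  | 0 => ⊥
  | k + 1 => ⨅ i, (derivFil d k).comap (d i)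

theorem mem_derivFil_succ {I M : Type*} [AddCommGroup M] [Module ℂ M] {d : I → End ℂ M} {k : ℕ}
    {m : M} : m ∈ derivFil d (k + 1) ↔ ∀ i, d i m ∈ derivFil d k := by
  simp [derivFil]

theorem derivFil_mono {I M : Type*} [AddCommGroup M] [Module ℂ M] (d : I → End ℂ M) :
    Monotone (derivFil d) := by
  refine monotone_nat_of_le_succ fun k => ?_
  induction k with
  | zero => simp [derivFil]
  | succ k ih =>
    exact fun _ hm => mem_derivFil_succ.2 fun i => ih (mem_derivFil_succ.1 hm i)

/-- Operators on a polynomial Fock space: multiplications `z i` by the variables, derivatives `d i`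
and inverses `G (c + 1)` of the shifted Euler operators `∑ i, z i * d i + (c + 1)`. -/
structure FockOps (I : Type*) [Fintype I] [DecidableEq I] (M : Type*) [AddCommGroup M]
    [Module ℂ M] where
  /-- multiplication by a variable -/
  z : I → End ℂ M
  /-- partial derivative -/
  d : I → End ℂ M
  /-- inverse of a shifted Euler operator -/
  G : ℕ → End ℂ M
  d_z : ∀ i j, d i * z j = z j * d i + if i = j then 1 else 0
  d_d : ∀ i j, d i * d j = d j * d i
  z_z : ∀ i j, z i * z j = z j * z i
  d_G : ∀ i c, d i * G c = G (c + 1) * d i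
  G_euler : ∀ c : ℕ, G (c + 1) * (∑ i, z i * d i + (c + 1 : ℂ) • 1) = 1
  euler_G : ∀ c : ℕ, (∑ i, z i * d i + (c + 1 : ℂ) • 1) * G (c + 1) = 1
  exhaust : ∀ m : M, ∃ k : ℕ, m ∈ derivFil d k

/-- A pointwise eventually constant sequence of linear maps has a limit. -/
theorem exists_eventual_limit {M : Type*} [AddCommGroup M] [Module ℂ M] (T : ℕ → End ℂ M)
    (h : ∀ m, ∃ k, ∀ s ≥ k, T s m = T k m) :
    ∃ L : End ℂ M, ∀ m, ∀ᶠ s in Filter.atTop, T s m = L m := by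
  choose k hk using h
  have hu : ∀ m m', (∀ᶠ s in Filter.atTop, T s m = m') → T (k m) m = m' := by
    intro m m' h
    obtain ⟨s, hs, hs'⟩ := (h.and (Filter.eventually_ge_atTop (k m))).exists
    rw [← hs, hk m s hs']
  have hev : ∀ m, ∀ᶠ s in Filter.atTop, T s m = T (k m) m := fun m =>
    (Filter.eventually_ge_atTop (k m)).mono (hk m)
  refine ⟨{ toFun := fun m => T (k m) m, map_add' := fun a b => ?_, map_smul' := fun c a => ?_ },
    hev⟩
  · exact hu _ _ (((hev a).and (hev b)).mono fun s hs => by rw [map_add, hs.1, hs.2])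
  · exact hu _ _ ((hev a).mono fun s hs => by rw [map_smul, hs]; rfl)

namespace FockOps

variable {I : Type*} [Fintype I] [DecidableEq I] {M : Type*} [AddCommGroup M] [Module ℂ M]
  (F : FockOps I M)

/-- The Euler operator. -/
def E : End ℂ M := ∑ i, F.z i * F.d i

/-- The filtration by degree: `Fil k` consists of the elements of degree less than `k`. -/
def Fil : ℕ → Submodule ℂ M := derivFil F.d

theorem mem_Fil_succ {k : ℕ} {m : M} : m ∈ F.Fil (k + 1) ↔ ∀ i, F.d i m ∈ F.Fil k :=
  mem_derivFil_succ

theorem Fil_mono {k l : ℕ} (h : k ≤ l) : F.Fil k ≤ F.Fil l :=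
  derivFil_mono F.d h

theorem mem_Fil_zero {m : M} : m ∈ F.Fil 0 ↔ m = 0 := by simp [Fil, derivFil]

theorem exists_mem_Fil (m : M) : ∃ k, m ∈ F.Fil k := F.exhaust m

theorem z_mem_Fil {k : ℕ} {m : M} (hm : m ∈ F.Fil k) (i : I) : F.z i m ∈ F.Fil (k + 1) := by
  induction k generalizing m with
  | zero => rw [F.mem_Fil_zero] at hm; simp [hm]
  | succ k ih =>
    refine F.mem_Fil_succ.2 fun j => ?_
    have := congrArg (fun f => f m) (F.d_z j i)
    simp only [Module.End.mul_apply, LinearMap.add_apply] at this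
    rw [this]
    refine Submodule.add_mem _ (ih (F.mem_Fil_succ.1 hm j)) ?_
    split_ifs
    · exact hm
    · simp

theorem G_mem_Fil {k : ℕ} {m : M} (hm : m ∈ F.Fil k) (c : ℕ) : F.G c m ∈ F.Fil k := by
  induction k generalizing m c with
  | zero => rw [F.mem_Fil_zero] at hm; simp [hm]
  | succ k ih =>
    refine F.mem_Fil_succ.2 fun j => ?_
    rw [← Module.End.mul_apply, F.d_G]
    exact ih (F.mem_Fil_succ.1 hm j) _

theorem d_mem_Fil {k : ℕ} {m : M} (hm : m ∈ F.Fil (k + 1)) (i : I) : F.d i m ∈ F.Fil k :=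
  F.mem_Fil_succ.1 hm i

theorem E_z (i : I) : F.E * F.z i = F.z i * (F.E + 1) := by
  simp only [E, Finset.sum_mul, mul_add, Finset.mul_sum, mul_one]
  have : ∀ j, F.z j * F.d j * F.z i = F.z i * (F.z j * F.d j) + if j = i then F.z i else 0 := by
    intro j
    rw [mul_assoc, F.d_z, mul_add, ← mul_assoc, F.z_z, mul_assoc]
    split_ifs with h
    · rw [h, mul_one]
    · simp
  simp only [this, Finset.sum_add_distrib, Finset.sum_ite_eq', Finset.mem_univ, if_true]

theorem d_E (i : I) : F.d i * F.E = (F.E + 1) * F.d i := by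
  simp only [E, Finset.mul_sum, add_mul, Finset.sum_mul, one_mul]
  have : ∀ j, F.d i * (F.z j * F.d j) = F.z j * F.d j * F.d i + if i = j then F.d i else 0 := by
    intro j
    rw [← mul_assoc, F.d_z, add_mul, mul_assoc, F.d_d, ← mul_assoc]
    split_ifs with h
    · rw [h, one_mul]
    · simp
  simp only [this, Finset.sum_add_distrib, Finset.sum_ite_eq, Finset.mem_univ, if_true]

theorem G_E (c : ℕ) : F.G (c + 1) * (F.E + (c + 1 : ℂ) • 1) = 1 := F.G_euler c

theorem E_G (c : ℕ) : (F.E + (c + 1 : ℂ) • 1) * F.G (c + 1) = 1 := F.euler_G c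

variable (κ : I → I → End ℂ M)

/-- Successive approximations of the correction terms `C`. -/
def corrSeq : ℕ → I → End ℂ M
  | 0, _ => 0
  | s + 1, i => ∑ j, ((F.z j + corrSeq s j) * corrSeq s i + κ i j) * F.d j * F.G 1

variable {κ}

theorem d_G_mem_Fil {k : ℕ} {m : M} (hm : m ∈ F.Fil (k + 1)) (i : I) (c : ℕ) :
    F.d i (F.G c m) ∈ F.Fil k := F.d_mem_Fil (F.G_mem_Fil hm c) i

/-- In the recursion a derivative lowers the degree first, a correction term lowers it again, and at
most one multiplication raises it. The net effect is to lower the degree by one. -/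
theorem corrSeq_mem_Fil (hκ : ∀ i j k m, m ∈ F.Fil k → κ i j m ∈ F.Fil k) (s : ℕ) (i : I)
    {k : ℕ} {m : M} (hm : m ∈ F.Fil k) : F.corrSeq κ s i m ∈ F.Fil (k - 1) := by
  induction s generalizing i k m with
  | zero => simp [corrSeq]
  | succ s ih =>
    rcases k with _ | k
    · rw [F.mem_Fil_zero] at hm; simp [hm]
    simp only [corrSeq, LinearMap.sum_apply, Module.End.mul_apply, LinearMap.add_apply,
      Nat.add_sub_cancel]
    refine Submodule.sum_mem _ fun j _ => ?_
    have hw := F.d_G_mem_Fil hm j 1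
    rcases k with _ | k
    · rw [F.mem_Fil_zero] at hw; simp [hw]
    · have h1 := ih i hw
      rw [Nat.add_sub_cancel] at h1
      exact Submodule.add_mem _ (Submodule.add_mem _ (F.z_mem_Fil h1 j)
        (F.Fil_mono (by omega) (ih j h1))) (hκ _ _ _ _ hw)

/-- The derivative in the recursion makes the value on degree k depend only on earlier values in
lower degree, so the approximations stabilize on each filtered piece. -/
theorem corrSeq_succ_eq (hκ : ∀ i j k m, m ∈ F.Fil k → κ i j m ∈ F.Fil k) (k : ℕ) (i : I)
    {m : M} (hm : m ∈ F.Fil (k + 1)) : F.corrSeq κ (k + 1) i m = F.corrSeq κ k i m := by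
  induction k generalizing i m with
  | zero =>
    have : ∀ j, F.d j (F.G 1 m) = 0 := fun j => F.mem_Fil_zero.1 (F.d_G_mem_Fil hm j 1)
    simp [corrSeq, this]
  | succ k ih =>
    conv_lhs => rw [corrSeq]
    conv_rhs => rw [corrSeq]
    simp only [LinearMap.sum_apply, Module.End.mul_apply, LinearMap.add_apply]
    refine Finset.sum_congr rfl fun j _ => ?_
    have hw := F.d_G_mem_Fil hm j 1
    rw [ih i hw, ih j (F.Fil_mono (by omega) (F.corrSeq_mem_Fil hκ k i hw))]

theorem corrSeq_stable (hκ : ∀ i j k m, m ∈ F.Fil k → κ i j m ∈ F.Fil k) {k s : ℕ} (h : k ≤ s)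
    (i : I) {m : M} (hm : m ∈ F.Fil k) : F.corrSeq κ s i m = F.corrSeq κ k i m := by
  induction s, h using Nat.le_induction with
  | base => rfl
  | succ s hs ih => rw [F.corrSeq_succ_eq hκ s i (F.Fil_mono (by omega) hm), ih]

theorem exists_corr (hκ : ∀ i j k m, m ∈ F.Fil k → κ i j m ∈ F.Fil k) :
    ∃ C : I → End ℂ M, ∀ i m, ∀ᶠ s in Filter.atTop, F.corrSeq κ s i m = C i m := by
  have : ∀ i, ∃ L : End ℂ M, ∀ m, ∀ᶠ s in Filter.atTop, F.corrSeq κ s i m = L m := by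
    intro i
    refine exists_eventual_limit _ fun m => ?_
    obtain ⟨k, hk⟩ := F.exists_mem_Fil m
    exact ⟨k, fun s hs => F.corrSeq_stable hκ hs i hk⟩
  choose C hC using this
  exact ⟨C, hC⟩

/-- The correction terms `C`, which make `z i + C i` satisfy `[z i + C i, z j + C j] = κ i j`. -/
def corr (hκ : ∀ i j k m, m ∈ F.Fil k → κ i j m ∈ F.Fil k) : I → End ℂ M :=
  Classical.choose (F.exists_corr hκ)

variable (hκ : ∀ i j k m, m ∈ F.Fil k → κ i j m ∈ F.Fil k)

theorem eventually_corrSeq (i : I) (m : M) :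
    ∀ᶠ s in Filter.atTop, F.corrSeq κ s i m = F.corr hκ i m :=
  Classical.choose_spec (F.exists_corr hκ) i m

theorem corr_mem_Fil (i : I) {k : ℕ} {m : M} (hm : m ∈ F.Fil k) :
    F.corr hκ i m ∈ F.Fil (k - 1) := by
  obtain ⟨s, hs⟩ := (F.eventually_corrSeq hκ i m).exists
  rw [← hs]
  exact F.corrSeq_mem_Fil hκ s i hm

theorem corr_eq (i : I) : F.corr hκ i =
    ∑ j, ((F.z j + F.corr hκ j) * F.corr hκ i + κ i j) * F.d j * F.G 1 := by
  ext m
  have h1 := (Filter.tendsto_add_atTop_nat 1).eventually (F.eventually_corrSeq hκ i m)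
  have h2 : ∀ᶠ s in Filter.atTop, ∀ j, F.corrSeq κ s i (F.d j (F.G 1 m)) =
      F.corr hκ i (F.d j (F.G 1 m)) :=
    Filter.eventually_all.2 fun j => F.eventually_corrSeq hκ i _
  have h3 : ∀ᶠ s in Filter.atTop, ∀ j, F.corrSeq κ s j (F.corr hκ i (F.d j (F.G 1 m))) =
      F.corr hκ j (F.corr hκ i (F.d j (F.G 1 m))) :=
    Filter.eventually_all.2 fun j => F.eventually_corrSeq hκ j _
  obtain ⟨s, e1, e2, e3⟩ := (h1.and (h2.and h3)).exists
  rw [← e1, corrSeq]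
  simp only [LinearMap.sum_apply, Module.End.mul_apply, LinearMap.add_apply, e2, e3]

/-- With X_i = z_i + C_i, this equation is forced by the wanted relations: expand X_i E = ∑ X_i X_j
d_j = ∑ (X_j X_i + κ_ij) d_j, assuming ∑ X_j d_j = E and [X_i, X_j] = κ_ij. The lemmas below recover
both assumptions from it. -/
theorem corr_mul_E_add_one (i : I) : F.corr hκ i * (F.E + 1) =
    ∑ j, ((F.z j + F.corr hκ j) * F.corr hκ i + κ i j) * F.d j := by
  have h : F.G 1 * (F.E + 1) = 1 := by simpa using F.G_E 0
  conv_lhs => rw [F.corr_eq hκ i]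
  rw [Finset.sum_mul]
  refine Finset.sum_congr rfl fun j _ => ?_
  rw [mul_assoc, h, mul_one]

/-- The sum T satisfies T E = ∑ X_j T d_j, so if T vanishes in degrees less than k then T E vanishes
in degrees up to k. Since T also vanishes on constants, induction on the degree applies.
Equivalently, ∑ X_j d_j = E, the condition of symmetric ordering. -/
theorem sum_corr_mul_d (hanti : ∀ i j, κ j i = -κ i j) : ∑ i, F.corr hκ i * F.d i = 0 := by
  set T := ∑ i, F.corr hκ i * F.d i with hT
  -- Antisymmetric coefficients are contracted with commuting derivatives.
  have h0 : ∑ i, ∑ j, κ i j * F.d j * F.d i = 0 := by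
    have h : ∑ i, ∑ j, κ i j * F.d j * F.d i = -∑ i, ∑ j, κ i j * F.d j * F.d i := by
      conv_lhs => rw [Finset.sum_comm]
      simp only [← Finset.sum_neg_distrib]
      refine Finset.sum_congr rfl fun i _ => Finset.sum_congr rfl fun j _ => ?_
      rw [hanti i j, mul_assoc, F.d_d, neg_mul, mul_assoc]
    have h2 : (2 : ℂ) • ∑ i, ∑ j, κ i j * F.d j * F.d i = 0 := by
      rw [two_smul]; nth_rewrite 1 [h]; exact neg_add_cancel _
    exact (smul_eq_zero.1 h2).resolve_left two_ne_zero
  have hTE : T * F.E = ∑ j, (F.z j + F.corr hκ j) * (T * F.d j) := by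
    have e1 : T * F.E = ∑ i, (F.corr hκ i * (F.E + 1)) * F.d i := by
      rw [hT, Finset.sum_mul]
      exact Finset.sum_congr rfl fun i _ => by rw [mul_assoc, F.d_E, mul_assoc]
    have e2 : ∀ i, F.corr hκ i * (F.E + 1) * F.d i =
        ∑ j, (F.z j + F.corr hκ j) * (F.corr hκ i * F.d i * F.d j) +
          ∑ j, κ i j * F.d j * F.d i := by
      intro i
      rw [corr_mul_E_add_one, Finset.sum_mul, ← Finset.sum_add_distrib]
      refine Finset.sum_congr rfl fun j _ => ?_
      rw [add_mul, add_mul]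
      simp only [mul_assoc, F.d_d i j]
    rw [e1, Finset.sum_congr rfl fun i _ => e2 i, Finset.sum_add_distrib, h0, add_zero,
      Finset.sum_comm]
    refine Finset.sum_congr rfl fun j _ => ?_
    rw [hT, Finset.sum_mul, Finset.mul_sum]
  have hmain : ∀ k, ∀ m ∈ F.Fil k, T m = 0 := by
    intro k
    induction k with
    | zero => intro m hm; rw [F.mem_Fil_zero] at hm; simp [hm]
    | succ k ih =>
      intro m hm
      have h1 : ∀ m ∈ F.Fil (k + 1), T (F.E m) = 0 := by
        intro m hm
        have := congrArg (fun f => f m) hTE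
        simp only [Module.End.mul_apply, LinearMap.sum_apply] at this
        rw [this]
        exact Finset.sum_eq_zero fun j _ => by rw [ih _ (F.d_mem_Fil hm j), map_zero]
      -- On polynomials `G 0` divides by the degree, with 0⁻¹ = 0 on constants, so this difference
      -- is the constant part. Abstractly, it is killed by every derivative.
      have h2 : ∀ j, F.d j (m - F.E (F.G 0 m)) = 0 := by
        intro j
        have e : F.d j * F.E * F.G 0 = F.d j := by
          have := F.E_G 0
          simp only [Nat.cast_zero, zero_add, one_smul] at this
          rw [F.d_E, mul_assoc, F.d_G, zero_add, ← mul_assoc, this, one_mul]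
        have := congrArg (fun f => f m) e
        simp only [Module.End.mul_apply] at this
        rw [map_sub, this, sub_self]
      have h3 : T (m - F.E (F.G 0 m)) = 0 := by
        simp only [hT, LinearMap.sum_apply, Module.End.mul_apply, h2, map_zero,
          Finset.sum_const_zero]
      rw [map_sub, h1 _ (F.G_mem_Fil hm 0), sub_zero] at h3
      exact h3
  ext m
  obtain ⟨k, hk⟩ := F.exists_mem_Fil m
  exact hmain k m hk

/-- The defect of the commutation relations. -/
def defect (i j : I) : End ℂ M :=
  (F.z i + F.corr hκ i) * (F.z j + F.corr hκ j) - (F.z j + F.corr hκ j) * (F.z i + F.corr hκ i) -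
    κ i j

/-- Reverses the computation that motivates `corr_mul_E_add_one`, now using ∑ X_j d_j = E. -/
theorem sum_defect_mul_d (hanti : ∀ i j, κ j i = -κ i j) (i : I) :
    ∑ j, F.defect hκ i j * F.d j = 0 := by
  set X : I → End ℂ M := fun i => F.z i + F.corr hκ i with hX
  have h1 : ∑ j, X j * F.d j = F.E := by
    simp only [hX, add_mul, Finset.sum_add_distrib, F.sum_corr_mul_d hκ hanti, add_zero, E]
  have h2 : ∑ j, X j * F.z i * F.d j = F.E * F.z i - X i := by
    rw [← h1, Finset.sum_mul, eq_sub_iff_add_eq]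
    have : X i = ∑ j, if j = i then X j else 0 := by simp
    rw [this, ← Finset.sum_add_distrib]
    refine Finset.sum_congr rfl fun j _ => ?_
    rw [mul_assoc, mul_assoc, F.d_z, mul_add]
    split_ifs <;> simp
  have h3 : ∑ j, (X j * F.corr hκ i + κ i j) * F.d j = F.corr hκ i * (F.E + 1) :=
    (F.corr_mul_E_add_one hκ i).symm
  have h4 : ∀ j, F.defect hκ i j * F.d j = X i * (X j * F.d j) - X j * F.z i * F.d j -
      (X j * F.corr hκ i + κ i j) * F.d j := by
    intro j
    simp only [defect, hX]
    noncomm_ring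
  rw [Finset.sum_congr rfl fun j _ => h4 j, Finset.sum_sub_distrib, Finset.sum_sub_distrib,
    ← Finset.mul_sum, h1, h2, h3, F.E_z]
  simp only [hX]
  noncomm_ring

/-- Induction on the degree. The Jacobi identity for the X_i and the hypothesis on κ make the defect
D satisfy a cyclic identity, while ∑ D_ij d_j = 0. Together they give D_ij (E + 2) = 0 in the next
degree, where E + 2 is invertible. -/
theorem defect_eq_zero (hanti : ∀ i j, κ j i = -κ i j)
    (hjac : ∀ i j k, (κ i j * (F.z k + F.corr hκ k) - (F.z k + F.corr hκ k) * κ i j) +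
      (κ j k * (F.z i + F.corr hκ i) - (F.z i + F.corr hκ i) * κ j k) +
      (κ k i * (F.z j + F.corr hκ j) - (F.z j + F.corr hκ j) * κ k i) = 0) (i j : I) :
    F.defect hκ i j = 0 := by
  set X : I → End ℂ M := fun i => F.z i + F.corr hκ i with hX
  set D := F.defect hκ with hD
  have hDX : ∀ i j, D i j = X i * X j - X j * X i - κ i j := fun i j => rfl
  have hDanti : ∀ i j, D j i = -D i j := by
    intro i j
    rw [hDX, hDX, hanti i j]
    abel
  have hcyc : ∀ i j k, D i j * X k + D j k * X i + D k i * X j =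
      X k * D i j + X i * D j k + X j * D k i := by
    intro i j k
    have h := hjac i j k
    rw [← sub_eq_zero]
    have e : D i j * X k + D j k * X i + D k i * X j - (X k * D i j + X i * D j k + X j * D k i) =
      -((κ i j * X k - X k * κ i j) + (κ j k * X i - X i * κ j k) +
        (κ k i * X j - X j * κ k i)) := by
      simp only [hDX]
      noncomm_ring
    rw [e, h, neg_zero]
  have hsum : ∀ i, ∑ j, D i j * F.d j = 0 := F.sum_defect_mul_d hκ hanti
  have hmain : ∀ k, ∀ m ∈ F.Fil k, ∀ i j, D i j m = 0 := by
    intro k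
    induction k with
    | zero => intro m hm; rw [F.mem_Fil_zero] at hm; simp [hm]
    | succ k ih =>
      intro m hm i j
      -- On p the terms of the cyclic identity with D on the right vanish by induction. The
      -- correction in X p has lower degree, so D kills it as well and only z p remains.
      have h1 : ∀ p ∈ F.Fil k, ∀ l, D i j (F.z l p) + D j l (F.z i p) + D l i (F.z j p) = 0 := by
        intro p hp l
        have h := congrArg (fun f => f p) (hcyc i j l)
        have hX0 : ∀ a b c, D a b (X c p) = D a b (F.z c p) := by
          intro a b c
          simp only [hX, LinearMap.add_apply, map_add]
          rw [ih _ (F.Fil_mono (by omega) (F.corr_mem_Fil hκ c hp)), add_zero]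
        simp only [LinearMap.add_apply, Module.End.mul_apply, ih p hp, map_zero, add_zero] at h
        rw [hX0, hX0, hX0] at h
        exact h
      -- Put p = d_l q in `h1` and sum over l. The first term gives D_ij E q. In the other two,
      -- moving d_l to the left of z leaves one copy of D_ij q each, because ∑ D_bl d_l = 0.
      have h2 : ∀ q ∈ F.Fil (k + 1), D i j ((F.E + (2 : ℂ) • 1) q) = 0 := by
        intro q hq
        have hA : ∑ l, D i j (F.z l (F.d l q)) = D i j (F.E q) := by
          rw [← map_sum]; simp [E]
        have hdz : ∀ a l, F.z a (F.d l q) = F.d l (F.z a q) - if l = a then q else 0 := by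
          intro a l
          have := congrArg (fun f => f q) (F.d_z l a)
          simp only [Module.End.mul_apply, LinearMap.add_apply] at this
          rw [this]
          split_ifs <;> simp
        have hB : ∀ a b, ∑ l, D b l (F.z a (F.d l q)) = -D b a q := by
          intro a b
          have h := congrArg (fun f => f (F.z a q)) (hsum b)
          simp only [LinearMap.sum_apply, Module.End.mul_apply, LinearMap.zero_apply] at h
          simp only [hdz, map_sub, Finset.sum_sub_distrib, h, zero_sub]
          congr 1
          rw [Finset.sum_eq_single a]
          · simp
          · intro l _ hl; simp [hl]
          · simp
        have hall : ∑ l, (D i j (F.z l (F.d l q)) + D j l (F.z i (F.d l q)) +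
            D l i (F.z j (F.d l q))) = 0 :=
          Finset.sum_eq_zero fun l _ => h1 _ (F.d_mem_Fil hq l) l
        have hC : ∑ l, D l i (F.z j (F.d l q)) = D i j q := by
          have : ∀ l, D l i (F.z j (F.d l q)) = -D i l (F.z j (F.d l q)) := by
            intro l; rw [hDanti i l]; rfl
          simp only [this, Finset.sum_neg_distrib, hB, neg_neg]
        rw [Finset.sum_add_distrib, Finset.sum_add_distrib, hA, hB, hC, hDanti i j] at hall
        simp only [LinearMap.add_apply, Module.End.one_apply, map_add, two_smul]
        simpa [add_assoc] using hall
      have hG := congrArg (fun f => f m) (F.E_G 1)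
      simp only [Module.End.mul_apply, Module.End.one_apply, Nat.cast_one] at hG
      norm_num at hG
      have := h2 _ (F.G_mem_Fil hm 2)
      rwa [LinearMap.add_apply, LinearMap.smul_apply, Module.End.one_apply, hG] at this
  ext m
  obtain ⟨k, hk⟩ := F.exists_mem_Fil m
  exact hmain k m hk i j

section Equivariance

variable {a : End ℂ M} {A : Matrix I I ℂ}
  (hz : ∀ j, a * F.z j - F.z j * a = ∑ i, A i j • F.z i)
  (hd : ∀ i, a * F.d i - F.d i * a = -∑ j, A i j • F.d j)

include hz hd in
theorem commute_E : a * F.E = F.E * a := by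
  rw [← sub_eq_zero, E, Finset.mul_sum, Finset.sum_mul, ← Finset.sum_sub_distrib]
  have : ∀ j, a * (F.z j * F.d j) - F.z j * F.d j * a =
      (∑ i, A i j • (F.z i * F.d j)) - ∑ i, A j i • (F.z j * F.d i) := by
    intro j
    have e : a * (F.z j * F.d j) - F.z j * F.d j * a =
      (a * F.z j - F.z j * a) * F.d j + F.z j * (a * F.d j - F.d j * a) := by noncomm_ring
    rw [e, hz, hd, Finset.sum_mul, mul_neg, Finset.mul_sum, ← sub_eq_add_neg]
    simp only [smul_mul_assoc, mul_smul_comm]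
  simp only [this, Finset.sum_sub_distrib]
  rw [sub_eq_zero]
  exact Finset.sum_comm

include hz hd in
theorem commute_G (c : ℕ) : a * F.G (c + 1) = F.G (c + 1) * a := by
  have h := F.commute_E hz hd
  have h1 : a * (F.E + (c + 1 : ℂ) • 1) = (F.E + (c + 1 : ℂ) • 1) * a := by
    simp [mul_add, add_mul, h]
  calc a * F.G (c + 1) = F.G (c + 1) * (F.E + (c + 1 : ℂ) • 1) * (a * F.G (c + 1)) := by
        rw [F.G_E, one_mul]
    _ = F.G (c + 1) * ((F.E + (c + 1 : ℂ) • 1) * a) * F.G (c + 1) := by simp only [mul_assoc]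
    _ = F.G (c + 1) * a * ((F.E + (c + 1 : ℂ) • 1) * F.G (c + 1)) := by
        rw [← h1]; simp only [mul_assoc]
    _ = _ := by rw [F.E_G, mul_one]

include hz hd in
-- Every ingredient of the recursion is equivariant: z and κ transform covariantly, d
-- contragrediently, and `G 1` commutes with `a` because the Euler operator does.
theorem lie_corrSeq (hk : ∀ i j, a * κ i j - κ i j * a = ∑ k, (A k i • κ k j + A k j • κ i k))
    (s : ℕ) (i : I) : a * F.corrSeq κ s i - F.corrSeq κ s i * a =
      ∑ k, A k i • F.corrSeq κ s k := by
  induction s generalizing i with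
  | zero => simp [corrSeq]
  | succ s ih =>
    set C := F.corrSeq κ s with hC
    set X : I → End ℂ M := fun j => F.z j + C j with hX
    have hXa : ∀ j, a * X j - X j * a = ∑ k, A k j • X k := by
      intro j
      simp only [hX, smul_add, Finset.sum_add_distrib, ← hz, ← ih]
      noncomm_ring
    have hG := F.commute_G hz hd 0
    rw [zero_add] at hG
    set Y : I → I → End ℂ M := fun i j => X j * C i + κ i j with hY
    have hYa : ∀ i j, a * Y i j - Y i j * a = ∑ k, (A k i • Y k j + A k j • Y i k) := by
      intro i j
      have e : a * Y i j - Y i j * a = (a * X j - X j * a) * C i + X j * (a * C i - C i * a) +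
        (a * κ i j - κ i j * a) := by simp only [hY]; noncomm_ring
      rw [e, hXa, ih, hk, Finset.sum_mul, Finset.mul_sum, ← Finset.sum_add_distrib,
        ← Finset.sum_add_distrib]
      refine Finset.sum_congr rfl fun k _ => ?_
      simp only [hY, smul_mul_assoc, mul_smul_comm, smul_add]
      abel
    have hCs : ∀ i, F.corrSeq κ (s + 1) i = (∑ j, Y i j * F.d j) * F.G 1 := by
      intro i
      rw [corrSeq, Finset.sum_mul]
    have hS : ∀ i, a * (∑ j, Y i j * F.d j) - (∑ j, Y i j * F.d j) * a =
        ∑ k, A k i • ∑ j, Y k j * F.d j := by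
      intro i
      rw [Finset.mul_sum, Finset.sum_mul, ← Finset.sum_sub_distrib]
      have e : ∀ j, a * (Y i j * F.d j) - Y i j * F.d j * a =
          (∑ k, A k i • (Y k j * F.d j)) + ((∑ k, A k j • (Y i k * F.d j)) -
            ∑ k, A j k • (Y i j * F.d k)) := by
        intro j
        have e : a * (Y i j * F.d j) - Y i j * F.d j * a =
          (a * Y i j - Y i j * a) * F.d j + Y i j * (a * F.d j - F.d j * a) := by noncomm_ring
        rw [e, hYa, hd, Finset.sum_mul, mul_neg, Finset.mul_sum, ← add_sub_assoc,
          ← Finset.sum_add_distrib, ← sub_eq_add_neg]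
        simp only [smul_mul_assoc, mul_smul_comm, add_mul]
      simp only [e, Finset.sum_add_distrib, Finset.sum_sub_distrib]
      have e2 : ∑ j, ∑ k, A k j • (Y i k * F.d j) = ∑ j, ∑ k, A j k • (Y i j * F.d k) :=
        Finset.sum_comm
      rw [e2, sub_self, add_zero, Finset.sum_comm]
      simp only [Finset.smul_sum]
    have e : a * ((∑ j, Y i j * F.d j) * F.G 1) - (∑ j, Y i j * F.d j) * F.G 1 * a =
      (a * (∑ j, Y i j * F.d j) - (∑ j, Y i j * F.d j) * a) * F.G 1 := by
      rw [sub_mul, mul_assoc _ (F.G 1) a, ← hG]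
      simp only [mul_assoc]
    simp only [hCs]
    rw [e, hS, Finset.sum_mul]
    simp only [smul_mul_assoc]

include hz hd in
theorem lie_corr (hk : ∀ i j, a * κ i j - κ i j * a = ∑ k, (A k i • κ k j + A k j • κ i k))
    (i : I) : a * F.corr hκ i - F.corr hκ i * a = ∑ k, A k i • F.corr hκ k := by
  ext m
  have h1 : ∀ᶠ s in Filter.atTop, ∀ k, F.corrSeq κ s k m = F.corr hκ k m :=
    Filter.eventually_all.2 fun k => F.eventually_corrSeq hκ k m
  obtain ⟨s, e1, e2⟩ := (h1.and (F.eventually_corrSeq hκ i (a m))).exists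
  have h := congrArg (fun f => f m) (F.lie_corrSeq hz hd hk s i)
  simp only [LinearMap.sub_apply, Module.End.mul_apply, LinearMap.sum_apply, LinearMap.smul_apply,
    e1, e2] at h ⊢
  exact h

end Equivariance

end FockOps

end Fock

/-! ### The polynomial model of the Fock operators -/

section PolynomialFock

variable {I : Type*} [Fintype I] [DecidableEq I]

/-- Multiplication by a variable on polynomials. -/
def polyZ (i : I) : End ℂ (MvPolynomial I ℂ) := LinearMap.mulLeft ℂ (MvPolynomial.X i)

/-- Partial derivative of polynomials. -/
def polyD (i : I) : End ℂ (MvPolynomial I ℂ) := (MvPolynomial.pderiv i).toLinearMap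

/-- Multiplication by `(α + c)⁻¹` in degree `α`. -/
def polyG (c : ℕ) : End ℂ (MvPolynomial I ℂ) :=
  (MvPolynomial.basisMonomials I ℂ).constr ℂ fun α =>
    ((α.degree : ℂ) + c)⁻¹ • MvPolynomial.monomial α 1

theorem polyG_monomial (c : ℕ) (α : I →₀ ℕ) :
    polyG c (MvPolynomial.monomial α (1 : ℂ)) =
      ((α.degree : ℂ) + c)⁻¹ • MvPolynomial.monomial α 1 := by
  have := (MvPolynomial.basisMonomials I ℂ).constr_basis ℂ (fun α =>
    ((α.degree : ℂ) + c)⁻¹ • MvPolynomial.monomial α (1 : ℂ)) α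
  rwa [MvPolynomial.coe_basisMonomials] at this

theorem poly_linearMap_ext {f g : End ℂ (MvPolynomial I ℂ)}
    (h : ∀ α, f (MvPolynomial.monomial α 1) = g (MvPolynomial.monomial α 1)) : f = g := by
  refine (MvPolynomial.basisMonomials I ℂ).ext fun α => ?_
  rw [MvPolynomial.coe_basisMonomials]
  exact h α

theorem polyD_monomial (i : I) (α : I →₀ ℕ) :
    polyD i (MvPolynomial.monomial α (1 : ℂ)) =
      (α i : ℂ) • MvPolynomial.monomial (α - Finsupp.single i 1) 1 := by
  simp [polyD, MvPolynomial.pderiv_monomial, MvPolynomial.smul_monomial]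

theorem degree_sub_single (i : I) (α : I →₀ ℕ) (h : α i ≠ 0) :
    (α - Finsupp.single i 1).degree + 1 = α.degree := by
  have h1 : α - Finsupp.single i 1 + Finsupp.single i 1 = α :=
    tsub_add_cancel_of_le (Finsupp.single_le_iff.2 (Nat.one_le_iff_ne_zero.2 h))
  conv_rhs => rw [← h1]
  simp

theorem polyD_polyZ (i j : I) :
    polyD i * polyZ j = polyZ j * polyD i + if i = j then 1 else 0 := by
  refine LinearMap.ext fun p => ?_
  by_cases h : i = j
  · subst h; simp [polyD, polyZ, add_comm]
  · simp [polyD, polyZ, h, MvPolynomial.pderiv_X_of_ne (Ne.symm h)]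

theorem polyD_polyD (i j : I) : (polyD i * polyD j : End ℂ (MvPolynomial I ℂ)) = polyD j * polyD i := by
  refine poly_linearMap_ext fun α => ?_
  simp only [Module.End.mul_apply, polyD_monomial, map_smul, smul_smul]
  by_cases h : i = j
  · rw [h]
  · rw [tsub_right_comm]
    simp [h, Ne.symm h, mul_comm]

theorem polyD_polyG (i : I) (c : ℕ) : polyD i * polyG c = polyG (c + 1) * polyD i := by
  refine poly_linearMap_ext fun α => ?_
  simp only [Module.End.mul_apply, polyD_monomial, map_smul, polyG_monomial, smul_smul]
  by_cases h : α i = 0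
  · simp [h]
  · have := degree_sub_single i α h
    rw [← this]
    push_cast
    rw [mul_comm, add_right_comm, add_assoc]

theorem polyE_monomial (α : I →₀ ℕ) : (∑ i, polyZ i * polyD i) (MvPolynomial.monomial α (1 : ℂ)) =
    (α.degree : ℂ) • MvPolynomial.monomial α 1 := by
  have h : ∀ i, (polyZ i * polyD i) (MvPolynomial.monomial α (1 : ℂ)) =
      (α i : ℂ) • MvPolynomial.monomial α 1 := by
    intro i
    rw [Module.End.mul_apply, polyD_monomial, map_smul]
    by_cases h : α i = 0
    · simp [h]
    · rw [polyZ, LinearMap.mulLeft_apply, MvPolynomial.X, MvPolynomial.monomial_mul, one_mul,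
        add_tsub_cancel_of_le (Finsupp.single_le_iff.2 (Nat.one_le_iff_ne_zero.2 h))]
  rw [LinearMap.sum_apply, Finset.sum_congr rfl fun i _ => h i, ← Finset.sum_smul,
    Finsupp.degree_eq_sum]
  push_cast
  rfl

theorem polyG_euler (c : ℕ) :
    polyG (c + 1) * (∑ i, polyZ i * polyD i + (c + 1 : ℂ) • 1) =
      (1 : End ℂ (MvPolynomial I ℂ)) := by
  refine poly_linearMap_ext fun α => ?_
  rw [Module.End.mul_apply, LinearMap.add_apply, polyE_monomial, LinearMap.smul_apply,
    Module.End.one_apply, ← add_smul, map_smul, polyG_monomial, smul_smul]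
  have h : (α.degree : ℂ) + (c + 1) ≠ 0 := by norm_cast
  push_cast
  rw [mul_inv_cancel₀ h, one_smul]

theorem euler_polyG (c : ℕ) :
    (∑ i, polyZ i * polyD i + (c + 1 : ℂ) • 1) * polyG (c + 1) =
      (1 : End ℂ (MvPolynomial I ℂ)) := by
  refine poly_linearMap_ext fun α => ?_
  rw [Module.End.mul_apply, polyG_monomial, map_smul, LinearMap.add_apply, polyE_monomial,
    LinearMap.smul_apply, Module.End.one_apply, ← add_smul, smul_smul]
  have h : (α.degree : ℂ) + (c + 1) ≠ 0 := by norm_cast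
  push_cast
  rw [inv_mul_cancel₀ h, one_smul]

variable (I) in
/-- The Fock space operators on polynomials with coefficients in `W`. -/
def polyFock (W : Type*) [AddCommGroup W] [Module ℂ W] :
    FockOps I (MvPolynomial I ℂ ⊗[ℂ] W) where
  z i := Module.End.rTensorAlgHom ℂ _ W (polyZ i)
  d i := Module.End.rTensorAlgHom ℂ _ W (polyD i)
  G c := Module.End.rTensorAlgHom ℂ _ W (polyG c)
  d_z i j := by
    rw [← map_mul, polyD_polyZ, map_add, map_mul]
    split_ifs <;> simp
  d_d i j := by rw [← map_mul, polyD_polyD, map_mul]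
  z_z i j := by
    rw [← map_mul, ← map_mul]
    congr 1
    refine LinearMap.ext fun p => ?_
    simp [polyZ, mul_left_comm]
  d_G i c := by rw [← map_mul, polyD_polyG, map_mul]
  G_euler c := by
    have := congrArg (Module.End.rTensorAlgHom ℂ _ W) (polyG_euler (I := I) c)
    simpa only [map_mul, map_add, map_sum, map_smul, map_one] using this
  euler_G c := by
    have := congrArg (Module.End.rTensorAlgHom ℂ _ W) (euler_polyG (I := I) c)
    simpa only [map_mul, map_add, map_sum, map_smul, map_one] using this
  exhaust m := by
    have hmono : ∀ (k : ℕ) (α : I →₀ ℕ) (w : W), α.degree < k →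
        MvPolynomial.monomial α (1 : ℂ) ⊗ₜ[ℂ] w ∈
          derivFil (fun i => Module.End.rTensorAlgHom ℂ (MvPolynomial I ℂ) W (polyD i)) k := by
      intro k
      induction k with
      | zero => intro α w h; omega
      | succ k ih =>
        intro α w h
        refine mem_derivFil_succ.2 fun i => ?_
        change polyD i (MvPolynomial.monomial α (1 : ℂ)) ⊗ₜ[ℂ] w ∈ _
        rw [polyD_monomial, ← TensorProduct.smul_tmul']
        by_cases hi : α i = 0
        · simp [hi]
        · have := degree_sub_single i α hi
          exact Submodule.smul_mem _ _ (ih _ _ (by omega))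
    have hadd : ∀ m m' : MvPolynomial I ℂ ⊗[ℂ] W,
        (∃ k, m ∈ derivFil (fun i => Module.End.rTensorAlgHom ℂ (MvPolynomial I ℂ) W (polyD i)) k) →
        (∃ k, m' ∈ derivFil (fun i => Module.End.rTensorAlgHom ℂ (MvPolynomial I ℂ) W (polyD i)) k) →
        ∃ k, m + m' ∈
          derivFil (fun i => Module.End.rTensorAlgHom ℂ (MvPolynomial I ℂ) W (polyD i)) k := by
      rintro m m' ⟨k, hk⟩ ⟨k', hk'⟩
      exact ⟨max k k', Submodule.add_mem _ (derivFil_mono _ (le_max_left _ _) hk)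
        (derivFil_mono _ (le_max_right _ _) hk')⟩
    induction m using TensorProduct.induction_on with
    | zero => exact ⟨0, Submodule.zero_mem _⟩
    | add a b ha hb => exact hadd a b ha hb
    | tmul p w =>
      induction p using MvPolynomial.induction_on' with
      | monomial α c =>
        refine ⟨α.degree + 1, ?_⟩
        have : MvPolynomial.monomial α c = c • MvPolynomial.monomial α (1 : ℂ) := by
          simp [MvPolynomial.smul_monomial]
        rw [this, ← TensorProduct.smul_tmul']
        exact Submodule.smul_mem _ _ (hmono _ _ _ (Nat.lt_succ_self _))
      | add p q hp hq =>
        rw [TensorProduct.add_tmul]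
        exact hadd _ _ hp hq

end PolynomialFock

/-! ### Linear vector fields on a Fock space -/

namespace FockOps

variable {I : Type*} [Fintype I] [DecidableEq I] {M : Type*} [AddCommGroup M] [Module ℂ M]
  (F : FockOps I M)

/-- The linear vector field given by a matrix. -/
def rot (A : Matrix I I ℂ) : End ℂ M := ∑ k, ∑ j, A k j • (F.z k * F.d j)

theorem rot_z (A : Matrix I I ℂ) (i : I) :
    F.rot A * F.z i - F.z i * F.rot A = ∑ k, A k i • F.z k := by
  simp only [rot, Finset.sum_mul, Finset.mul_sum, ← Finset.sum_sub_distrib]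
  refine Finset.sum_congr rfl fun k _ => ?_
  have : ∀ j, A k j • (F.z k * F.d j) * F.z i - F.z i * A k j • (F.z k * F.d j) =
      if j = i then A k i • F.z k else 0 := by
    intro j
    rw [smul_mul_assoc, mul_smul_comm, mul_assoc, F.d_z, mul_add, ← mul_assoc, F.z_z k i,
      ← smul_sub, ← mul_assoc]
    split_ifs with h
    · rw [h]; simp
    · simp
  simp only [this, Finset.sum_ite_eq', Finset.mem_univ, if_true]

theorem rot_d (A : Matrix I I ℂ) (i : I) :
    F.rot A * F.d i - F.d i * F.rot A = -∑ j, A i j • F.d j := by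
  simp only [rot, Finset.sum_mul, Finset.mul_sum, ← Finset.sum_sub_distrib]
  rw [Finset.sum_comm, ← Finset.sum_neg_distrib]
  refine Finset.sum_congr rfl fun j _ => ?_
  have : ∀ k, A k j • (F.z k * F.d j) * F.d i - F.d i * A k j • (F.z k * F.d j) =
      if k = i then -(A i j • F.d j) else 0 := by
    intro k
    rw [smul_mul_assoc, mul_smul_comm, ← mul_assoc (F.d i), F.d_z, add_mul, mul_assoc, F.d_d j i,
      ← smul_sub, mul_assoc]
    by_cases h : k = i
    · rw [h]; simp
    · simp [h, Ne.symm h]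
  simp only [this, Finset.sum_ite_eq', Finset.mem_univ, if_true]

theorem rot_lie (A B : Matrix I I ℂ) :
    F.rot A * F.rot B - F.rot B * F.rot A = F.rot (A * B - B * A) := by
  have e : ∀ k l, F.rot A * (F.z k * F.d l) - (F.z k * F.d l) * F.rot A =
      ∑ i, A i k • (F.z i * F.d l) - ∑ j, A l j • (F.z k * F.d j) := by
    intro k l
    have : F.rot A * (F.z k * F.d l) - (F.z k * F.d l) * F.rot A =
        (F.rot A * F.z k - F.z k * F.rot A) * F.d l +
          F.z k * (F.rot A * F.d l - F.d l * F.rot A) := by noncomm_ring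
    rw [this, rot_z, rot_d, Finset.sum_mul, mul_neg, Finset.mul_sum, ← sub_eq_add_neg]
    simp only [smul_mul_assoc, mul_smul_comm]
  have e2 : F.rot A * F.rot B - F.rot B * F.rot A =
      ∑ k, ∑ l, B k l • (F.rot A * (F.z k * F.d l) - (F.z k * F.d l) * F.rot A) := by
    conv_lhs => rw [rot.eq_1 F B]
    simp only [Finset.sum_mul, Finset.mul_sum, ← Finset.sum_sub_distrib, mul_smul_comm,
      smul_mul_assoc, smul_sub]
  rw [e2]
  simp only [e, smul_sub, Finset.sum_sub_distrib, Finset.smul_sum, smul_smul]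
  have r1 : ∑ k, ∑ l, ∑ i, (B k l * A i k) • (F.z i * F.d l) = F.rot (A * B) := by
    rw [Finset.sum_congr rfl fun k _ => Finset.sum_comm, Finset.sum_comm]
    refine Finset.sum_congr rfl fun i _ => ?_
    rw [Finset.sum_comm]
    refine Finset.sum_congr rfl fun l _ => ?_
    rw [Matrix.mul_apply, Finset.sum_smul]
    exact Finset.sum_congr rfl fun k _ => by rw [mul_comm]
  have r2 : ∑ k, ∑ l, ∑ j, (B k l * A l j) • (F.z k * F.d j) = F.rot (B * A) := by
    refine Finset.sum_congr rfl fun k _ => ?_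
    rw [Finset.sum_comm]
    refine Finset.sum_congr rfl fun l _ => ?_
    rw [Matrix.mul_apply, Finset.sum_smul]
  rw [r1, r2]
  simp [rot, sub_smul, Finset.sum_sub_distrib]

theorem rot_add (A B : Matrix I I ℂ) : F.rot (A + B) = F.rot A + F.rot B := by
  simp [rot, add_smul, Finset.sum_add_distrib]

theorem rot_smul (c : ℂ) (A : Matrix I I ℂ) : F.rot (c • A) = c • F.rot A := by
  simp [rot, mul_smul, Finset.smul_sum]

/-- The commutator with each d_i is again a combination of derivatives and so lowers the degree.
Induction then shows that `a` does not raise it. -/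
theorem mem_Fil_of_commutator {a : End ℂ M} {A : Matrix I I ℂ}
    (hd : ∀ i, a * F.d i - F.d i * a = -∑ j, A i j • F.d j) {k : ℕ} {m : M} (hm : m ∈ F.Fil k) :
    a m ∈ F.Fil k := by
  induction k generalizing m with
  | zero => rw [F.mem_Fil_zero] at hm; simp [hm]
  | succ k ih =>
    refine F.mem_Fil_succ.2 fun i => ?_
    have h : F.d i (a m) = a (F.d i m) + ∑ j, A i j • F.d j m := by
      have := congrArg (fun f => f m) (hd i)
      simp only [LinearMap.sub_apply, Module.End.mul_apply, LinearMap.neg_apply,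
        LinearMap.sum_apply, LinearMap.smul_apply] at this
      rw [sub_eq_iff_eq_add] at this
      rw [this]
      abel
    rw [h]
    exact Submodule.add_mem _ (ih (F.d_mem_Fil hm i)) (Submodule.sum_mem _ fun j _ =>
      Submodule.smul_mem _ _ (F.d_mem_Fil hm j))

/-- The operators which preserve the filtration by degree. -/
def filEnd : Subalgebra ℂ (End ℂ M) where
  carrier := {f | ∀ k, ∀ m ∈ F.Fil k, f m ∈ F.Fil k}
  mul_mem' hf hg k m hm := hf k _ (hg k m hm)
  add_mem' hf hg k m hm := Submodule.add_mem _ (hf k m hm) (hg k m hm)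
  algebraMap_mem' c k m hm := by
    rw [Module.algebraMap_end_apply]; exact Submodule.smul_mem _ _ hm

end FockOps

/-! ### Generation of the enveloping algebra -/

section UEA

variable {L : Type*} [LieRing L] [LieAlgebra ℂ L]

theorem uea_adjoin_eq_top :
    Algebra.adjoin ℂ (Set.range (UniversalEnvelopingAlgebra.ι ℂ : L →ₗ⁅ℂ⁆ _)) = ⊤ := by
  set S := Algebra.adjoin ℂ (Set.range (UniversalEnvelopingAlgebra.ι ℂ : L →ₗ⁅ℂ⁆ _))
  let f : L →ₗ⁅ℂ⁆ S :=
    { toFun := fun x => ⟨UniversalEnvelopingAlgebra.ι ℂ x, Algebra.subset_adjoin ⟨x, rfl⟩⟩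
      map_add' := fun x y => by ext; simp
      map_smul' := fun c x => by ext; simp
      map_lie' := fun {x y} => by
        apply Subtype.ext
        exact (UniversalEnvelopingAlgebra.ι ℂ : L →ₗ⁅ℂ⁆ _).map_lie x y }
  have h : S.val.comp (UniversalEnvelopingAlgebra.lift ℂ f) = AlgHom.id ℂ _ := by
    apply UniversalEnvelopingAlgebra.hom_ext
    ext x
    simp only [LieHom.coe_comp, Function.comp_apply, AlgHom.coe_toLieHom, AlgHom.comp_apply,
      UniversalEnvelopingAlgebra.lift_ι_apply]
    rfl
  rw [eq_top_iff]
  rintro u -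
  have := congrArg (fun g => g u) h
  simp only [AlgHom.comp_apply, AlgHom.id_apply] at this
  rw [← this]
  exact (UniversalEnvelopingAlgebra.lift ℂ f u).2

theorem uea_mem_of_ι {A : Type*} [Ring A] [Algebra ℂ A]
    (f : UniversalEnvelopingAlgebra ℂ L →ₐ[ℂ] A) (S : Subalgebra ℂ A)
    (h : ∀ x : L, f (UniversalEnvelopingAlgebra.ι ℂ x) ∈ S) (u : UniversalEnvelopingAlgebra ℂ L) :
    f u ∈ S := by
  have : Algebra.adjoin ℂ (Set.range (UniversalEnvelopingAlgebra.ι ℂ : L →ₗ⁅ℂ⁆ _)) ≤ S.comap f :=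
    Algebra.adjoin_le (by rintro _ ⟨x, rfl⟩; exact h x)
  rw [uea_adjoin_eq_top] at this
  exact this (Set.mem_univ u)

end UEA

/-! ### The pairing as an equivariant antisymmetric form satisfying the Jacobi identity -/

section Pairing

variable {n : ℕ}

theorem genFun_add_left {R : Type*} [CommRing R] [Algebra ℂ R]
    (M : Matrix (Fin n ⊕ Fin n) (Fin n ⊕ Fin n) R) (x x' y : Vec n) :
    genFun M (x + x') y = genFun M x y + genFun M x' y := by
  have : (fun i => algebraMap ℂ (PowerSeries R) ((x + x') i)) = (fun i => algebraMap ℂ _ (x i)) +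
      fun i => algebraMap ℂ _ (x' i) := by
    funext i; simp
  rw [genFun, this, omega_add_left, add_mul]
  rfl

theorem genFun_smul_left {R : Type*} [CommRing R] [Algebra ℂ R]
    (M : Matrix (Fin n ⊕ Fin n) (Fin n ⊕ Fin n) R) (c : ℂ) (x y : Vec n) :
    genFun M (c • x) y = c • genFun M x y := by
  have : (fun i => algebraMap ℂ (PowerSeries R) ((c • x) i)) =
      (algebraMap ℂ (PowerSeries R) c) • fun i => algebraMap ℂ (PowerSeries R) (x i) := by
    funext i; simp
  rw [genFun, this, omega_smul_left, Algebra.smul_def, mul_assoc]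
  rfl

theorem beta_swap (k : ℕ) (x y : Vec n) : beta n k y x = -beta n k x y := by
  have h : (genericMatrix n)ᵀ * Matrix.J (Fin n) _ = Matrix.J (Fin n) _ * -genericMatrix n :=
    genericMatrix_transpose_mul_J (SymmetricAlgebra.ι ℂ (Sp n))
  have := omega_mulVec_left _ _ (oneSubSq_inv_transpose_mul_J h)
  rw [beta, beta, ← map_neg, genFun, genFun, ← this, omega_swap, neg_mul]

/-- The pairing `ζ` as a bilinear map. -/
def pairingL (ζ : ℕ →₀ ℂ) : Vec n →ₗ[ℂ] Vec n →ₗ[ℂ] USp n :=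
  have h1 : ∀ k (x x' y : Vec n), r n k (x + x') y = r n k x y + r n k x' y := fun k x x' y => by
    simp only [r, beta, genFun_add_left, map_add]
  have h2 : ∀ k (c : ℂ) (x y : Vec n), r n k (c • x) y = c • r n k x y := fun k c x y => by
    simp only [r, beta, genFun_smul_left, PowerSeries.coeff_smul, map_smul]
  have h3 : ∀ k (x y : Vec n), r n k x y = - r n k y x := fun k x y => by
    rw [r, beta_swap, map_neg]; rfl
  LinearMap.mk₂ ℂ (pairing ζ)
    (fun x x' y => by simp only [pairing, h1, smul_add, Finsupp.sum_add])
    (fun c x y => by simp only [pairing, h2, Finsupp.smul_sum, smul_comm c])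
    (fun x y y' => by
      simp only [pairing, h3 _ x, h1, smul_add, neg_add, Finsupp.sum_add])
    (fun c x y => by
      simp only [pairing, h3 _ x, h2, Finsupp.smul_sum, smul_comm c, smul_neg])

theorem pairingL_apply (ζ : ℕ →₀ ℂ) (x y : Vec n) : pairingL ζ x y = pairing ζ x y := rfl

theorem pairing_swap (ζ : ℕ →₀ ℂ) (x y : Vec n) : pairing ζ y x = -pairing ζ x y := by
  simp only [pairing, r, beta_swap _ x y, map_neg, smul_neg, Finsupp.sum, Finset.sum_neg_distrib]

theorem lie_pairing (ζ : ℕ →₀ ℂ) (C : Sp n) (x y : Vec n) :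
    UniversalEnvelopingAlgebra.ι ℂ C * pairing ζ x y -
      pairing ζ x y * UniversalEnvelopingAlgebra.ι ℂ C =
      pairing ζ (C.1 *ᵥ x) y + pairing ζ x (C.1 *ᵥ y) := by
  simp only [pairing, Finsupp.sum, Finset.mul_sum, Finset.sum_mul, mul_smul_comm, smul_mul_assoc,
    ← Finset.sum_sub_distrib, ← Finset.sum_add_distrib, ← smul_sub, ← smul_add, lie_r]

theorem jacobi_pairing (ζ : ℕ →₀ ℂ) (x y z : Vec n) :
    (ofUSp n (pairing ζ x y) * semiV n z - semiV n z * ofUSp n (pairing ζ x y)) +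
    (ofUSp n (pairing ζ y z) * semiV n x - semiV n x * ofUSp n (pairing ζ y z)) +
    (ofUSp n (pairing ζ z x) * semiV n y - semiV n y * ofUSp n (pairing ζ z x)) = 0 := by
  simp only [pairing, Finsupp.sum, map_sum, map_smul, Finset.mul_sum, Finset.sum_mul,
    mul_smul_comm, smul_mul_assoc, ← Finset.sum_sub_distrib, ← Finset.sum_add_distrib]
  refine Finset.sum_eq_zero fun k _ => ?_
  have h := jacobi_r k x y z
  rw [← neg_eq_zero] at h
  have e : ∀ a b c d e f : Semi n, (a - b) + (c - d) + (e - f) = -((b - a) + (d - c) + (f - e)) := by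
    intros; abel
  have hz := congrArg (fun s => ζ k • s) h
  simp only [smul_neg, smul_add, smul_sub, smul_zero] at hz
  rw [e]
  exact hz

end Pairing

/-! ### The Fock representation of H_ζ and the resulting components -/

section FockRep

/-- The canonical map `U(sp_{2n}) → H_ζ(sp_{2n})`. -/
def ofH (n : ℕ) (ζ : ℕ →₀ ℂ) : USp n →ₐ[ℂ] H n ζ :=
  (RingQuot.mkAlgHom ℂ (CherednikRel ζ)).comp (ofUSp n)

theorem ofH_ι {n : ℕ} (ζ : ℕ →₀ ℂ) (A : Sp n) : ofH n ζ (UniversalEnvelopingAlgebra.ι ℂ A) = gen n ζ (.inl A) := by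
  rw [ofH, AlgHom.comp_apply, ofUSp_ι]
  rfl

/-- The constant term of a polynomial with coefficients in `W`. -/
def polyConst (I W : Type*) [AddCommGroup W] [Module ℂ W] :
    MvPolynomial I ℂ ⊗[ℂ] W →ₗ[ℂ] W :=
  (TensorProduct.lid ℂ W).toLinearMap ∘ₗ
    LinearMap.rTensor W (MvPolynomial.aeval (0 : I → ℂ)).toLinearMap

theorem polyConst_z {I W : Type*} [Fintype I] [DecidableEq I] [AddCommGroup W] [Module ℂ W] (i : I)
    (m : MvPolynomial I ℂ ⊗[ℂ] W) : polyConst I W ((polyFock I W).z i m) = 0 := by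
  induction m using TensorProduct.induction_on with
  | zero => rw [map_zero, map_zero]
  | add a b ha hb => rw [map_add, map_add, ha, hb, add_zero]
  | tmul p u =>
    change (MvPolynomial.aeval (0 : I → ℂ) (MvPolynomial.X i * p)) • u = 0
    rw [map_mul, MvPolynomial.aeval_X, Pi.zero_apply, zero_mul, zero_smul]

theorem polyConst_one_tmul {I W : Type*} [AddCommGroup W] [Module ℂ W] (w : W) :
    polyConst I W (1 ⊗ₜ w) = w := by
  simp [polyConst]

/-- A Fock space with coefficients in `U(sp_{2n})`. -/
structure CoeffFock (n : ℕ) (M : Type*) [AddCommGroup M] [Module ℂ M] extends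
    FockOps (Fin n ⊕ Fin n) M where
  /-- left multiplication on the coefficients -/
  coeff : USp n →ₐ[ℂ] End ℂ M
  coeff_z : ∀ u i, coeff u * z i = z i * coeff u
  coeff_d : ∀ u i, coeff u * d i = d i * coeff u
  /-- the constants -/
  vac : USp n →ₗ[ℂ] M
  d_vac : ∀ i u, d i (vac u) = 0
  coeff_vac : ∀ u w, coeff u (vac w) = vac (u * w)
  /-- the constant term -/
  constTerm : M →ₗ[ℂ] USp n
  constTerm_vac : ∀ u, constTerm (vac u) = u
  constTerm_z : ∀ i m, constTerm (z i m) = 0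

namespace CoeffFock

variable {n : ℕ} {M : Type*} [AddCommGroup M] [Module ℂ M] (F : CoeffFock n M)

theorem coeff_rot (u : USp n) (A) :
    F.coeff u * F.toFockOps.rot A = F.toFockOps.rot A * F.coeff u := by
  simp only [FockOps.rot, Finset.mul_sum, Finset.sum_mul, mul_smul_comm, smul_mul_assoc]
  refine Finset.sum_congr rfl fun k _ => Finset.sum_congr rfl fun j _ => ?_
  rw [← mul_assoc, F.coeff_z, mul_assoc, F.coeff_d, mul_assoc]

/-- The action of `sp_{2n}` on the Fock space. -/
def spFock : Sp n →ₗ⁅ℂ⁆ End ℂ M where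
  toFun A := F.toFockOps.rot A.1 + F.coeff (UniversalEnvelopingAlgebra.ι ℂ A)
  map_add' A B := by
    have h : (A + B : Sp n).1 = A.1 + B.1 := rfl
    rw [h, FockOps.rot_add, map_add, map_add]
    abel
  map_smul' c A := by
    have h : (c • A : Sp n).1 = c • A.1 := rfl
    rw [h, FockOps.rot_smul, map_smul, map_smul, smul_add]
    rfl
  map_lie' {A B} := by
    have h : (⁅A, B⁆ : Sp n).1 = A.1 * B.1 - B.1 * A.1 := rfl
    rw [h, ← FockOps.rot_lie, LieHom.map_lie, LieRing.of_associative_ring_bracket,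
      LieRing.of_associative_ring_bracket, map_sub, map_mul, map_mul]
    simp only [mul_add, add_mul, F.coeff_rot]
    abel

/-- The action of `U(sp_{2n})` on the Fock space. -/
def uFock : USp n →ₐ[ℂ] End ℂ M := UniversalEnvelopingAlgebra.lift ℂ F.spFock

theorem uFock_ι (A : Sp n) : F.uFock (UniversalEnvelopingAlgebra.ι ℂ A) =
    F.toFockOps.rot A.1 + F.coeff (UniversalEnvelopingAlgebra.ι ℂ A) := by
  rw [uFock, UniversalEnvelopingAlgebra.lift_ι_apply]
  rfl

theorem uFock_ι_z (A : Sp n) (i) :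
    F.uFock (UniversalEnvelopingAlgebra.ι ℂ A) * F.z i -
      F.z i * F.uFock (UniversalEnvelopingAlgebra.ι ℂ A) = ∑ k, A.1 k i • F.z k := by
  rw [← FockOps.rot_z, uFock_ι, add_mul, mul_add, F.coeff_z]
  abel

theorem uFock_ι_d (A : Sp n) (i) :
    F.uFock (UniversalEnvelopingAlgebra.ι ℂ A) * F.d i -
      F.d i * F.uFock (UniversalEnvelopingAlgebra.ι ℂ A) = -∑ k, A.1 i k • F.d k := by
  rw [← FockOps.rot_d, uFock_ι, add_mul, mul_add, F.coeff_d]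
  abel

theorem uFock_mem_Fil (u : USp n) {k : ℕ} {m : M} (hm : m ∈ F.toFockOps.Fil k) :
    F.uFock u m ∈ F.toFockOps.Fil k := by
  have h := uea_mem_of_ι F.uFock F.toFockOps.filEnd (fun A k m hm =>
    F.toFockOps.mem_Fil_of_commutator (F.uFock_ι_d A) hm) u
  exact h k m hm

variable (ζ : ℕ →₀ ℂ)

/-- The commutators of the basis vectors, as operators on the Fock space. -/
def kappa (i j : Fin n ⊕ Fin n) : End ℂ M :=
  F.uFock (pairing ζ (Pi.single i 1) (Pi.single j 1))

theorem kappa_mem_Fil (i j : Fin n ⊕ Fin n) (k : ℕ) (m : M)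
    (hm : m ∈ F.toFockOps.Fil k) : F.kappa ζ i j m ∈ F.toFockOps.Fil k := F.uFock_mem_Fil _ hm

theorem mulVec_single_one_eq_sum (C : Sp n) (i : Fin n ⊕ Fin n) :
    C.1 *ᵥ (Pi.single i 1 : Vec n) = ∑ k, C.1 k i • Pi.single k 1 := by
  conv_lhs => rw [pi_eq_sum_univ' (C.1 *ᵥ (Pi.single i 1 : Vec n))]
  simp

theorem lie_kappa (C : Sp n) (i j : Fin n ⊕ Fin n) :
    F.uFock (UniversalEnvelopingAlgebra.ι ℂ C) * F.kappa ζ i j -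
      F.kappa ζ i j * F.uFock (UniversalEnvelopingAlgebra.ι ℂ C) =
      ∑ k, (C.1 k i • F.kappa ζ k j + C.1 k j • F.kappa ζ i k) := by
  have e : ∀ x y : Vec n, pairing ζ x y = pairingL ζ x y := fun _ _ => rfl
  simp only [kappa]
  rw [← map_mul, ← map_mul, ← map_sub, lie_pairing, mulVec_single_one_eq_sum,
    mulVec_single_one_eq_sum]
  simp only [e, map_add, map_sum, map_smul, LinearMap.sum_apply, LinearMap.smul_apply,
    Finset.sum_add_distrib]

/-- The action of the basis vectors of `V_{2n}` on the Fock space. -/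
def vBasisFock (i : Fin n ⊕ Fin n) : End ℂ M :=
  F.z i + F.toFockOps.corr (F.kappa_mem_Fil ζ) i

/-- The action of `V_{2n}` on the Fock space. -/
def vFock : Vec n →ₗ[ℂ] End ℂ M := Fintype.linearCombination ℂ (F.vBasisFock ζ)

theorem vFock_apply (v : Vec n) : F.vFock ζ v = ∑ i, v i • F.vBasisFock ζ i := rfl

theorem vFock_single (i : Fin n ⊕ Fin n) : F.vFock ζ (Pi.single i 1) = F.vBasisFock ζ i := by
  simp [vFock]

/-- The correction terms are equivariant (`lie_corr`), so the deformed operators transform under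
sp_{2n} as the variables do. This makes the semidirect product act before any relation among the
vectors is known. -/
theorem uFock_lie_vFock (A : Sp n) (v : Vec n) :
    F.uFock (UniversalEnvelopingAlgebra.ι ℂ A) * F.vFock ζ v -
      F.vFock ζ v * F.uFock (UniversalEnvelopingAlgebra.ι ℂ A) = F.vFock ζ (A.1 *ᵥ v) := by
  have h : ∀ i, F.uFock (UniversalEnvelopingAlgebra.ι ℂ A) * F.vBasisFock ζ i -
      F.vBasisFock ζ i * F.uFock (UniversalEnvelopingAlgebra.ι ℂ A) =
      ∑ k, A.1 k i • F.vBasisFock ζ k := by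
    intro i
    simp only [vBasisFock, smul_add, Finset.sum_add_distrib]
    rw [← F.uFock_ι_z, ← F.toFockOps.lie_corr (F.kappa_mem_Fil ζ) (F.uFock_ι_z A) (F.uFock_ι_d A)
      (F.lie_kappa ζ A)]
    noncomm_ring
  simp only [vFock_apply, Finset.mul_sum, Finset.sum_mul, mul_smul_comm, smul_mul_assoc,
    ← Finset.sum_sub_distrib, ← smul_sub, h, Matrix.mulVec, dotProduct, Finset.sum_smul,
    Finset.smul_sum, smul_smul]
  rw [Finset.sum_comm]
  simp only [mul_comm]

/-- The action of `U(sp_{2n}) ⋉ T(V_{2n})` on the Fock space. -/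
def semiFock : Semi n →ₐ[ℂ] End ℂ M :=
  RingQuot.liftAlgHom ℂ ⟨TensorAlgebra.lift ℂ
    ((F.uFock.toLinearMap ∘ₗ
      (UniversalEnvelopingAlgebra.ι ℂ : Sp n →ₗ⁅ℂ⁆ USp n).toLinearMap).coprod (F.vFock ζ)), by
    intro a b h
    have hG : ∀ A : Sp n, TensorAlgebra.lift ℂ ((F.uFock.toLinearMap ∘ₗ
      (UniversalEnvelopingAlgebra.ι ℂ : Sp n →ₗ⁅ℂ⁆ USp n).toLinearMap).coprod (F.vFock ζ))
        (tGen n (.inl A)) = F.uFock (UniversalEnvelopingAlgebra.ι ℂ A) := by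
      intro A
      simp only [tGen, TensorAlgebra.lift_ι_apply, LinearMap.coprod_apply, map_zero, add_zero]
      rfl
    have hV : ∀ v : Vec n, TensorAlgebra.lift ℂ ((F.uFock.toLinearMap ∘ₗ
      (UniversalEnvelopingAlgebra.ι ℂ : Sp n →ₗ⁅ℂ⁆ USp n).toLinearMap).coprod (F.vFock ζ))
        (tGen n (.inr v)) = F.vFock ζ v := by
      intro v
      simp only [tGen, TensorAlgebra.lift_ι_apply, LinearMap.coprod_apply, map_zero, zero_add]
    cases h with
    | lie A B =>
      rw [map_sub, map_mul, map_mul, hG, hG, hG, LieHom.map_lie,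
        LieRing.of_associative_ring_bracket, map_sub, map_mul, map_mul]
    | act A v => rw [map_sub, map_mul, map_mul, hG, hV, hV, uFock_lie_vFock]⟩

theorem semiFock_G (A : Sp n) :
    F.semiFock ζ (semiGen n (.inl A)) = F.uFock (UniversalEnvelopingAlgebra.ι ℂ A) := by
  rw [semiFock, semiGen, RingQuot.liftAlgHom_mkAlgHom_apply]
  simp only [tGen, TensorAlgebra.lift_ι_apply, LinearMap.coprod_apply, map_zero, add_zero]
  rfl

theorem semiFock_V (v : Vec n) : F.semiFock ζ (semiGen n (.inr v)) = F.vFock ζ v := by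
  rw [semiFock, semiGen, RingQuot.liftAlgHom_mkAlgHom_apply]
  simp only [tGen, TensorAlgebra.lift_ι_apply, LinearMap.coprod_apply, map_zero, zero_add]

theorem semiFock_ofUSp (u : USp n) : F.semiFock ζ (ofUSp n u) = F.uFock u := by
  have : (F.semiFock ζ).comp (ofUSp n) = F.uFock := by
    apply UniversalEnvelopingAlgebra.hom_ext
    ext1 A
    change F.semiFock ζ (ofUSp n (UniversalEnvelopingAlgebra.ι ℂ A)) = _
    rw [ofUSp_ι, semiFock_G]
    rfl
  exact congrArg (fun f => f u) this

/-- The Jacobi hypothesis of `defect_eq_zero` is the image of `jacobi_pairing` under `semiFock`.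
There is no circularity, since that identity holds in U ⋉ T(V), where vectors satisfy no relations
among themselves. -/
theorem vFock_commutator (x y : Vec n) :
    F.vFock ζ x * F.vFock ζ y - F.vFock ζ y * F.vFock ζ x = F.uFock (pairing ζ x y) := by
  have hanti : ∀ i j : Fin n ⊕ Fin n, F.kappa ζ j i = -F.kappa ζ i j := fun i j => by
    rw [kappa, pairing_swap, map_neg]; rfl
  have hjac := F.toFockOps.defect_eq_zero (F.kappa_mem_Fil ζ) hanti (fun i j k => by
    have h := congrArg (F.semiFock ζ)
      (jacobi_pairing ζ (Pi.single i 1 : Vec n) (Pi.single j 1) (Pi.single k 1))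
    simp only [map_add, map_sub, map_mul, semiFock_ofUSp, semiV_apply, semiFock_V, vFock_single,
      map_zero] at h
    exact h)
  have hb : ∀ i j, F.vBasisFock ζ i * F.vBasisFock ζ j - F.vBasisFock ζ j * F.vBasisFock ζ i =
      F.kappa ζ i j := fun i j => sub_eq_zero.1 (hjac i j)
  have hx : pairing ζ x y = ∑ i, ∑ j, (x i * y j) • pairing ζ (Pi.single i 1) (Pi.single j 1) := by
    rw [← pairingL_apply]
    conv_lhs => rw [pi_eq_sum_univ' x, pi_eq_sum_univ' y]
    simp only [map_sum, map_smul, LinearMap.sum_apply, LinearMap.smul_apply, Finset.smul_sum,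
      smul_smul, pairingL_apply]
    rw [Finset.sum_comm]
    exact Finset.sum_congr rfl fun i _ => Finset.sum_congr rfl fun j _ => by rw [mul_comm]
  have e2 : F.vFock ζ y * F.vFock ζ x =
      ∑ i, ∑ j, (x i * y j) • (F.vBasisFock ζ j * F.vBasisFock ζ i) := by
    simp only [vFock_apply, Finset.sum_mul, Finset.mul_sum, smul_mul_assoc, mul_smul_comm,
      smul_smul, Finset.smul_sum]
  have e1 : F.vFock ζ x * F.vFock ζ y =
      ∑ i, ∑ j, (x i * y j) • (F.vBasisFock ζ i * F.vBasisFock ζ j) := by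
    simp only [vFock_apply, Finset.sum_mul, Finset.mul_sum, smul_mul_assoc, mul_smul_comm,
      smul_smul, Finset.smul_sum]
    rw [Finset.sum_comm]
    exact Finset.sum_congr rfl fun i _ => Finset.sum_congr rfl fun j _ => by rw [mul_comm (y j)]
  rw [hx, e1, e2]
  simp only [map_sum, map_smul, ← Finset.sum_sub_distrib, ← smul_sub, hb, kappa]

/-- The Fock representation of `H_ζ(sp_{2n})`. -/
def hFock : H n ζ →ₐ[ℂ] End ℂ M :=
  RingQuot.liftAlgHom ℂ ⟨F.semiFock ζ, by
    rintro a b ⟨x, y⟩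
    rw [map_sub, map_mul, map_mul, semiFock_V, semiFock_V, vFock_commutator, semiFock_ofUSp]⟩

theorem hFock_ofH (u : USp n) : F.hFock ζ (ofH n ζ u) = F.uFock u := by
  rw [hFock, ofH, AlgHom.comp_apply, RingQuot.liftAlgHom_mkAlgHom_apply, semiFock_ofUSp]

theorem hFock_gen_inr (v : Vec n) : F.hFock ζ (gen n ζ (.inr v)) = F.vFock ζ v := by
  rw [hFock, gen, RingQuot.liftAlgHom_mkAlgHom_apply, semiFock_V]

theorem uFock_vac (u w : USp n) : F.uFock u (F.vac w) = F.vac (u * w) := by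
  have hι : ∀ A (w : USp n), F.uFock (UniversalEnvelopingAlgebra.ι ℂ A) (F.vac w) =
        F.vac (UniversalEnvelopingAlgebra.ι ℂ A * w) := by
    intro A w
    rw [uFock_ι, LinearMap.add_apply, F.coeff_vac]
    simp only [FockOps.rot, LinearMap.sum_apply, LinearMap.smul_apply, Module.End.mul_apply,
      F.d_vac, map_zero, smul_zero, Finset.sum_const_zero, zero_add]
  have hu : u ∈ Algebra.adjoin ℂ (Set.range (UniversalEnvelopingAlgebra.ι ℂ : Sp n →ₗ⁅ℂ⁆ _)) := by
    rw [uea_adjoin_eq_top]; trivial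
  induction hu using Algebra.adjoin_induction generalizing w with
  | mem x hx => obtain ⟨A, rfl⟩ := hx; exact hι A w
  | algebraMap c =>
    rw [AlgHom.commutes, Module.algebraMap_end_apply, Algebra.algebraMap_eq_smul_one,
      smul_mul_assoc, one_mul, map_smul]
  | add a b _ _ ha hb => rw [map_add, LinearMap.add_apply, ha, hb, add_mul, map_add]
  | mul a b _ _ ha hb => rw [map_mul, Module.End.mul_apply, hb, ha, mul_assoc]

/-- The vacuum has degree zero and the corrections lower the degree, so they vanish on it. -/
theorem vFock_vac (v : Vec n) : F.vFock ζ v (F.vac 1) = ∑ i, v i • F.z i (F.vac 1) := by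
  have hvac : F.vac 1 ∈ F.toFockOps.Fil 1 :=
    F.toFockOps.mem_Fil_succ.2 fun i => by rw [F.d_vac]; exact Submodule.zero_mem _
  have hC : ∀ i, F.toFockOps.corr (F.kappa_mem_Fil ζ) i (F.vac 1) = 0 := fun i =>
    F.toFockOps.mem_Fil_zero.1 (F.toFockOps.corr_mem_Fil (F.kappa_mem_Fil ζ) i hvac)
  rw [vFock_apply, LinearMap.sum_apply]
  refine Finset.sum_congr rfl fun i _ => ?_
  rw [LinearMap.smul_apply, vBasisFock, LinearMap.add_apply, hC, add_zero]

/-- The `U(sp_{2n})`-component of an element of `H_ζ(sp_{2n})`. -/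
def projU : H n ζ →ₗ[ℂ] USp n :=
  F.constTerm ∘ₗ LinearMap.applyₗ (F.vac 1) ∘ₗ (F.hFock ζ).toLinearMap

/-- The component in `V_{2n} ⊗ U(sp_{2n})` of an element of `H_ζ(sp_{2n})`. -/
def projV (i : Fin n ⊕ Fin n) : H n ζ →ₗ[ℂ] USp n :=
  F.constTerm ∘ₗ F.d i ∘ₗ LinearMap.applyₗ (F.vac 1) ∘ₗ (F.hFock ζ).toLinearMap

theorem projU_ofH (u : USp n) : F.projU ζ (ofH n ζ u) = u := by
  simp only [projU, LinearMap.comp_apply, AlgHom.toLinearMap_apply, hFock_ofH,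
    LinearMap.applyₗ_apply_apply, uFock_vac, F.constTerm_vac, mul_one]

theorem projU_gen_inr (v : Vec n) : F.projU ζ (gen n ζ (.inr v)) = 0 := by
  simp only [projU, LinearMap.comp_apply, AlgHom.toLinearMap_apply, hFock_gen_inr,
    LinearMap.applyₗ_apply_apply, vFock_vac, map_sum, map_smul, F.constTerm_z, smul_zero,
    Finset.sum_const_zero]

theorem projV_ofH (i) (u : USp n) : F.projV ζ i (ofH n ζ u) = 0 := by
  simp only [projV, LinearMap.comp_apply, AlgHom.toLinearMap_apply, hFock_ofH,
    LinearMap.applyₗ_apply_apply, uFock_vac, F.d_vac, map_zero]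

theorem projV_gen_inr (i) (v : Vec n) : F.projV ζ i (gen n ζ (.inr v)) = algebraMap ℂ _ (v i) := by
  simp only [projV, LinearMap.comp_apply, AlgHom.toLinearMap_apply, hFock_gen_inr,
    LinearMap.applyₗ_apply_apply, vFock_vac, map_sum, map_smul]
  have : ∀ j, F.d i (F.z j (F.vac 1)) = if i = j then F.vac 1 else 0 := by
    intro j
    have h := congrArg (fun f => f (F.vac 1)) (F.d_z i j)
    simp only [Module.End.mul_apply, LinearMap.add_apply, F.d_vac, map_zero, zero_add] at h
    rw [h]
    split_ifs <;> rfl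
  simp only [this]
  rw [Finset.sum_eq_single i]
  · simp [F.constTerm_vac, Algebra.algebraMap_eq_smul_one]
  · intro j _ hj; simp [hj.symm]
  · simp

end CoeffFock

variable (n : ℕ)

/-- The Fock space of polynomials with coefficients in `U(sp_{2n})`. -/
def spFockSpace : CoeffFock n (MvPolynomial (Fin n ⊕ Fin n) ℂ ⊗[ℂ] USp n) where
  toFockOps := polyFock (Fin n ⊕ Fin n) (USp n)
  coeff := (Module.End.lTensorAlgHom ℂ (USp n) (MvPolynomial (Fin n ⊕ Fin n) ℂ)).comp
    (Algebra.lmul ℂ (USp n))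
  coeff_z u i := TensorProduct.ext' fun p w => rfl
  coeff_d u i := TensorProduct.ext' fun p w => rfl
  vac := TensorProduct.mk ℂ _ _ 1
  d_vac i u := by
    change (MvPolynomial.pderiv i (1 : MvPolynomial (Fin n ⊕ Fin n) ℂ)) ⊗ₜ[ℂ] u = 0
    rw [MvPolynomial.pderiv_one, TensorProduct.zero_tmul]
  coeff_vac u w := rfl
  constTerm := polyConst _ _
  constTerm_vac u := polyConst_one_tmul u
  constTerm_z i m := polyConst_z i m

/-- There are well-defined components in `U(sp_{2n})` and `V_{2n}` of elements of `H_ζ(sp_{2n})`. -/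
theorem exists_proj (ζ : ℕ →₀ ℂ) : ∃ (pU : H n ζ →ₗ[ℂ] USp n)
    (pV : (Fin n ⊕ Fin n) → (H n ζ →ₗ[ℂ] USp n)), (∀ u, pU (ofH n ζ u) = u) ∧
    (∀ v, pU (gen n ζ (.inr v)) = 0) ∧ (∀ i u, pV i (ofH n ζ u) = 0) ∧
    ∀ i v, pV i (gen n ζ (.inr v)) = algebraMap ℂ _ (v i) :=
  ⟨(spFockSpace n).projU ζ, (spFockSpace n).projV ζ, (spFockSpace n).projU_ofH ζ,
    (spFockSpace n).projU_gen_inr ζ, (spFockSpace n).projV_ofH ζ, (spFockSpace n).projV_gen_inr ζ⟩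

end FockRep

/-! ### Homogeneity of the polynomials β -/

section Homogeneity

/-- The power series over a symmetric algebra whose `k`-th coefficient has degree `k`. -/
def gradedSeries (L : Type*) [AddCommGroup L] [Module ℂ L] :
    Subalgebra ℂ (PowerSeries (SymmetricAlgebra ℂ L)) where
  carrier := {f | ∀ k, PowerSeries.coeff k f ∈ (LinearMap.range (SymmetricAlgebra.ι ℂ L)) ^ k}
  mul_mem' {f g} hf hg k := by
    rw [PowerSeries.coeff_mul]
    refine Submodule.sum_mem _ fun p hp => ?_
    rw [← Finset.HasAntidiagonal.mem_antidiagonal.1 hp, pow_add]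
    exact Submodule.mul_mem_mul (hf _) (hg _)
  add_mem' hf hg k := by
    rw [map_add]; exact Submodule.add_mem _ (hf k) (hg k)
  algebraMap_mem' c k := by
    rw [PowerSeries.algebraMap_apply, PowerSeries.coeff_C]
    split_ifs with h
    · rw [h, pow_zero]; exact Submodule.algebraMap_mem c
    · exact Submodule.zero_mem _

variable {L : Type*} [AddCommGroup L] [Module ℂ L] {n : ℕ}

/-- The equation Y = 1 + τWY determines the coefficients recursively, each step multiplying by one
entry of W. -/
theorem mem_gradedSeries_of_fixed {m : Type*} [Fintype m]
    {Y : Matrix m m (PowerSeries (SymmetricAlgebra ℂ L))} [DecidableEq m]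
    {W : Matrix m m (SymmetricAlgebra ℂ L)}
    (hW : ∀ a b, W a b ∈ LinearMap.range (SymmetricAlgebra.ι ℂ L))
    (hY : Y = 1 + (PowerSeries.X : PowerSeries (SymmetricAlgebra ℂ L)) •
      (W.map PowerSeries.C * Y)) (a b : m) : Y a b ∈ gradedSeries L := by
  intro k
  induction k generalizing a b with
  | zero =>
    have h := congrFun (congrFun hY a) b
    rw [h, Matrix.add_apply, Matrix.smul_apply, smul_eq_mul, map_add, mul_comm,
      PowerSeries.coeff_zero_mul_X, add_zero, Matrix.one_apply, pow_zero]
    split_ifs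
    · rw [PowerSeries.coeff_zero_one]; exact Submodule.one_le.1 le_rfl
    · rw [map_zero]; exact Submodule.zero_mem _
  | succ k ih =>
    have h := congrFun (congrFun hY a) b
    rw [h, Matrix.add_apply, Matrix.smul_apply, smul_eq_mul, map_add, mul_comm,
      PowerSeries.coeff_succ_mul_X, Matrix.mul_apply, map_sum, Matrix.one_apply]
    refine Submodule.add_mem _ ?_ (Submodule.sum_mem _ fun c _ => ?_)
    · split_ifs
      · rw [PowerSeries.coeff_one, if_neg k.succ_ne_zero]; exact Submodule.zero_mem _
      · rw [map_zero]; exact Submodule.zero_mem _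
    · rw [Matrix.map_apply, PowerSeries.coeff_C_mul, pow_succ']
      exact Submodule.mul_mem_mul (hW a c) (ih c b)

theorem oneSub_neg_mul_oneSub {R : Type*} [CommRing R]
    (M : Matrix (Fin n ⊕ Fin n) (Fin n ⊕ Fin n) R) : oneSub M * oneSub (-M) = oneSubSq M := by
  have h1 : (M ^ 2).map (PowerSeries.C : R →+* _) = M.map PowerSeries.C * M.map PowerSeries.C := by
    rw [sq]
    exact (PowerSeries.C : R →+* _).mapMatrix.map_mul M M
  have h2 : (-M).map (PowerSeries.C : R →+* _) = -M.map PowerSeries.C := by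
    ext1 a b; simp
  rw [oneSub, oneSub, oneSubSq, h1, h2]
  simp only [sub_mul, one_mul, mul_one, smul_mul_assoc, smul_neg, mul_smul_comm,
    sub_neg_eq_add, mul_add, sq, mul_smul, smul_sub]
  abel

theorem oneSub_inv_mem_gradedSeries
    {M : Matrix (Fin n ⊕ Fin n) (Fin n ⊕ Fin n) (SymmetricAlgebra ℂ L)}
    (hM : ∀ a b, M a b ∈ LinearMap.range (SymmetricAlgebra.ι ℂ L)) (a b) :
    (oneSub M)⁻¹ a b ∈ gradedSeries L := by
  refine mem_gradedSeries_of_fixed hM ?_ a b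
  have h := Matrix.mul_nonsing_inv _ (isUnit_det_oneSub M)
  nth_rewrite 1 [oneSub] at h
  rw [sub_mul, one_mul, smul_mul_assoc, sub_eq_iff_eq_add] at h
  exact h

/-- In the generating function τ always accompanies the generic matrix, so the power of τ counts the
degree. Only the subalgebra property of `gradedSeries` is needed once the entries of (1 ∓ τM)⁻¹ are
known to lie in it. -/
theorem beta_mem_pow (k : ℕ) (x y : Vec n) :
    beta n k x y ∈ (LinearMap.range (SymmetricAlgebra.ι ℂ (Sp n))) ^ (2 * k) := by
  have hM : ∀ a b, genericMatrix n a b ∈ LinearMap.range (SymmetricAlgebra.ι ℂ (Sp n)) :=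
    fun a b => ⟨_, rfl⟩
  have hM' : ∀ a b, (-genericMatrix n) a b ∈ LinearMap.range (SymmetricAlgebra.ι ℂ (Sp n)) :=
    fun a b => Submodule.neg_mem _ (hM a b)
  have hQ : ∀ a b, (oneSubSq (genericMatrix n))⁻¹ a b ∈ gradedSeries (Sp n) := by
    intro a b
    rw [← oneSub_neg_mul_oneSub, Matrix.mul_inv_rev, Matrix.mul_apply]
    exact Subalgebra.sum_mem _ fun c _ => Subalgebra.mul_mem _ (oneSub_inv_mem_gradedSeries hM' _ _)
      (oneSub_inv_mem_gradedSeries hM _ _)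
  have hJ : ∀ a b, Matrix.J (Fin n) (PowerSeries (SymmetricAlgebra ℂ (Sp n))) a b ∈
      gradedSeries (Sp n) := by
    intro i j
    rcases i with i | i <;> rcases j with j | j <;> by_cases h : i = j <;>
      simp [Matrix.J, h]
  have hdet : ((oneSub (genericMatrix n))⁻¹).det ∈ gradedSeries (Sp n) := by
    rw [Matrix.det_apply]
    refine Subalgebra.sum_mem _ fun σ _ => ?_
    have hp := Subalgebra.prod_mem (gradedSeries (Sp n)) (t := Finset.univ) fun i _ =>
      oneSub_inv_mem_gradedSeries hM (σ i) i
    rcases Int.units_eq_one_or (Equiv.Perm.sign σ) with h | h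
    · rw [h, one_smul]; exact hp
    · rw [h, Units.neg_smul, one_smul]; exact (gradedSeries (Sp n)).neg_mem hp
  have hall : genFun (genericMatrix n) x y ∈ gradedSeries (Sp n) := by
    refine Subalgebra.mul_mem _ ?_ hdet
    unfold omega
    simp only [dotProduct, mulVec]
    refine (gradedSeries (Sp n)).sum_mem fun i _ => (gradedSeries (Sp n)).mul_mem
      ((gradedSeries (Sp n)).algebraMap_mem (x i)) ?_
    refine (gradedSeries (Sp n)).sum_mem fun j _ => (gradedSeries (Sp n)).mul_mem (hJ _ _) ?_
    exact (gradedSeries (Sp n)).sum_mem fun k _ => (gradedSeries (Sp n)).mul_mem (hQ _ _)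
      ((gradedSeries (Sp n)).algebraMap_mem (y k))
  exact hall (2 * k)

theorem pow_range_ι_le_span (d : ℕ) : (LinearMap.range (SymmetricAlgebra.ι ℂ L)) ^ d ≤
    Submodule.span ℂ {s | ∃ b : Fin d → L, ∏ i, SymmetricAlgebra.ι ℂ L (b i) = s} := by
  induction d with
  | zero =>
    rw [pow_zero, Submodule.one_eq_span]
    exact Submodule.span_mono (by rintro _ rfl; exact ⟨Fin.elim0, by simp⟩)
  | succ d ih =>
    rw [pow_succ']
    refine Submodule.mul_le.2 ?_
    rintro _ ⟨x, rfl⟩ s hs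
    replace hs := ih hs
    induction hs using Submodule.span_induction with
    | mem s h =>
      obtain ⟨b, rfl⟩ := h
      exact Submodule.subset_span ⟨Fin.cons x b, by simp [Fin.prod_univ_succ]⟩
    | zero => rw [mul_zero]; exact Submodule.zero_mem _
    | add a b _ _ ha hb => rw [mul_add]; exact Submodule.add_mem _ ha hb
    | smul c a _ ha => rw [mul_smul_comm]; exact Submodule.smul_mem _ _ ha

end Homogeneity

/-! ### Reading leading symbols in the enveloping algebra -/

section SymbolFunctional

theorem derivation_mem_pow {R : Type*} [CommRing R] [Algebra ℂ R] (I : Ideal R)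
    (D : Derivation ℂ R R) (k : ℕ) {f : R} (hf : f ∈ I ^ (k + 1)) : D f ∈ I ^ k := by
  induction k generalizing f with
  | zero => simp
  | succ k ih =>
    rw [pow_succ] at hf
    induction hf using Submodule.mul_induction_on' with
    | mem_mul_mem a ha b hb =>
      rw [D.leibniz, smul_eq_mul, smul_eq_mul]
      refine Ideal.add_mem _ (Ideal.mul_mem_right _ _ ha) ?_
      rw [mul_comm, pow_succ]
      exact Ideal.mul_mem_mul (ih ha) hb
    | add a _ b _ ha hb => rw [map_add]; exact Ideal.add_mem _ ha hb

/-- To lowest order in powers of I, every derivation must hit a fresh factor f. The error drops by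
at most one power of I with each derivation and therefore stays one power ahead of the main term. -/
theorem list_derivation_pow_mem {R : Type*} [CommRing R] [Algebra ℂ R] (I : Ideal R) {f : R}
    (hf : f ∈ I) (d : ℕ) (l : List (Derivation ℂ R R)) (hl : l.length ≤ d) :
    (l.map fun D : Derivation ℂ R R => (D.toLinearMap : Module.End ℂ R)).prod (f ^ d) -
      (d.descFactorial l.length : R) * f ^ (d - l.length) * (l.map fun D => D f).prod ∈
      I ^ (d - l.length + 1) := by
  induction l with
  | nil => simp
  | cons D l ih =>
    rw [List.length_cons] at hl ⊢
    obtain ⟨e, he⟩ : ∃ e, d - l.length = e + 1 := ⟨d - l.length - 1, by omega⟩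
    have he' : d - (l.length + 1) = e := by omega
    have ih := derivation_mem_pow I D _ (ih (by omega))
    rw [he] at ih
    rw [he', List.map_cons, List.prod_cons, List.map_cons, List.prod_cons, Module.End.mul_apply,
      Nat.descFactorial_succ, he]
    set g := (l.map fun D : Derivation ℂ R R => (D.toLinearMap : Module.End ℂ R)).prod (f ^ d)
    set P := (l.map fun D => D f).prod
    have h1 : D ((d.descFactorial l.length : R) * f ^ (e + 1) * P) =
        ((e + 1) * d.descFactorial l.length : R) * f ^ e * (D f * P) +
          f ^ (e + 1) * ((d.descFactorial l.length : R) * D P) := by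
      rw [D.leibniz, D.leibniz, D.leibniz_pow, Derivation.map_natCast]
      simp only [smul_eq_mul, nsmul_eq_mul, Nat.add_sub_cancel]
      push_cast
      ring
    rw [map_sub, h1] at ih
    have h2 : f ^ (e + 1) * ((d.descFactorial l.length : R) * D P) ∈ I ^ (e + 1) :=
      Ideal.mul_mem_right _ _ (Ideal.pow_mem_pow hf _)
    have h3 := Ideal.add_mem _ ih h2
    push_cast
    convert h3 using 1
    ring

variable (n : ℕ)

/-- The coordinate ring of the space of matrices. -/
abbrev MatPoly : Type := MvPolynomial ((Fin n ⊕ Fin n) × (Fin n ⊕ Fin n)) ℂ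

variable {n}

/-- The invariant vector field `X ↦ X B` on the space of matrices. -/
def matField (B : Matrix (Fin n ⊕ Fin n) (Fin n ⊕ Fin n) ℂ) :
    Derivation ℂ (MatPoly n) (MatPoly n) :=
  MvPolynomial.mkDerivation ℂ fun p => ∑ c, B c p.2 • MvPolynomial.X (p.1, c)

theorem matField_X (B : Matrix (Fin n ⊕ Fin n) (Fin n ⊕ Fin n) ℂ) (a b) :
    matField B (MvPolynomial.X (a, b)) = ∑ c, B c b • MvPolynomial.X (a, c) :=
  MvPolynomial.mkDerivation_X _ _ _

theorem matField_lie (B C : Matrix (Fin n ⊕ Fin n) (Fin n ⊕ Fin n) ℂ) :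
    ⁅matField B, matField C⁆ = matField (B * C - C * B) := by
  apply MvPolynomial.derivation_ext
  rintro ⟨a, b⟩
  have h : ∀ B C : Matrix (Fin n ⊕ Fin n) (Fin n ⊕ Fin n) ℂ,
      matField B (matField C (MvPolynomial.X (a, b))) =
      ∑ d, (B * C) d b • MvPolynomial.X (a, d) := by
    intro B C
    simp only [matField_X, map_sum, Derivation.map_smul, Finset.smul_sum, smul_smul,
      Matrix.mul_apply, Finset.sum_smul]
    rw [Finset.sum_comm]
    simp only [mul_comm]
  rw [Derivation.commutator_apply, h, h, matField_X, ← Finset.sum_sub_distrib]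
  simp only [Matrix.sub_apply, sub_smul]

theorem matField_add (B C : Matrix (Fin n ⊕ Fin n) (Fin n ⊕ Fin n) ℂ) :
    matField (B + C) = matField B + matField C := by
  apply MvPolynomial.derivation_ext
  rintro ⟨a, b⟩
  simp [matField_X, add_smul, Finset.sum_add_distrib]

theorem matField_smul (c : ℂ) (B : Matrix (Fin n ⊕ Fin n) (Fin n ⊕ Fin n) ℂ) :
    matField (c • B) = c • matField B := by
  apply MvPolynomial.derivation_ext
  rintro ⟨a, b⟩
  simp [matField_X, mul_smul, Finset.smul_sum]

/-- The action of `sp_{2n}` on polynomial functions of a matrix. -/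
def spMat : Sp n →ₗ⁅ℂ⁆ End ℂ (MatPoly n) where
  toFun B := (matField B.1 : MatPoly n →ₗ[ℂ] MatPoly n)
  map_add' A B := by
    have h : (A + B : Sp n).1 = A.1 + B.1 := rfl
    rw [h, matField_add]
    rfl
  map_smul' c A := by
    have h : (c • A : Sp n).1 = c • A.1 := rfl
    rw [h, matField_smul]
    rfl
  map_lie' {A B} := by
    have h : (⁅A, B⁆ : Sp n).1 = A.1 * B.1 - B.1 * A.1 := rfl
    rw [h, ← matField_lie, Derivation.commutator_coe_linear_map]

/-- Evaluation of polynomial functions at the identity matrix. -/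
def evalOne : MatPoly n →ₐ[ℂ] ℂ :=
  MvPolynomial.aeval fun p => (1 : Matrix (Fin n ⊕ Fin n) (Fin n ⊕ Fin n) ℂ) p.1 p.2

/-- The function `X ↦ tr (A (X - 1))`. -/
def linFun (A : Matrix (Fin n ⊕ Fin n) (Fin n ⊕ Fin n) ℂ) : MatPoly n :=
  ∑ a, ∑ b, A b a • (MvPolynomial.X (a, b) -
    MvPolynomial.C ((1 : Matrix (Fin n ⊕ Fin n) (Fin n ⊕ Fin n) ℂ) a b))

theorem evalOne_linFun (A : Matrix (Fin n ⊕ Fin n) (Fin n ⊕ Fin n) ℂ) :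
    evalOne (linFun A) = 0 := by
  simp [evalOne, linFun]

theorem evalOne_matField_linFun (A B : Matrix (Fin n ⊕ Fin n) (Fin n ⊕ Fin n) ℂ) :
    evalOne (matField B (linFun A)) = (B * A).trace := by
  simp only [linFun, map_sum, Derivation.map_smul, map_sub, matField_X, MvPolynomial.derivation_C,
    sub_zero, map_smul, evalOne, MvPolynomial.aeval_X, Matrix.one_apply, smul_eq_mul, mul_ite,
    mul_one, mul_zero, Finset.sum_ite_eq, Finset.mem_univ, if_true, Matrix.trace,
    Matrix.diag_apply, Matrix.mul_apply]
  exact Finset.sum_congr rfl fun a _ => Finset.sum_congr rfl fun b _ => mul_comm _ _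

/-- A functional on `U(sp_{2n})` which detects the value at `A` of the symbol in degree `d`. -/
def symbolFunctional (A : Sp n) (d : ℕ) : USp n →ₗ[ℂ] ℂ :=
  evalOne.toLinearMap ∘ₗ LinearMap.applyₗ (linFun A.1 ^ d) ∘ₗ
    (UniversalEnvelopingAlgebra.lift ℂ spMat).toLinearMap

/-- The elements of sp_{2n} act as vector fields, and f = `linFun A.1` vanishes at the identity.
Fewer than d of them leave a factor f in the main term of f^d, while exactly d give d! times the
product of the derivatives of f at the identity, which are trace pairings with A. -/
theorem symbolFunctional_ofFn (A : Sp n) (d e : ℕ) (he : e ≤ d) (b : Fin e → Sp n) :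
    symbolFunctional A d (List.ofFn fun i => UniversalEnvelopingAlgebra.ι ℂ (b i)).prod =
      if e = d then (d.factorial : ℂ) * ∏ i, ((b i).1 * A.1).trace else 0 := by
  have h1 : symbolFunctional A d (List.ofFn fun i => UniversalEnvelopingAlgebra.ι ℂ (b i)).prod =
      evalOne (((List.ofFn fun i => matField (b i).1).map
        fun D : Derivation ℂ (MatPoly n) (MatPoly n) =>
          (D.toLinearMap : Module.End ℂ (MatPoly n))).prod
        (linFun A.1 ^ d)) := by
    simp only [symbolFunctional, LinearMap.comp_apply, AlgHom.toLinearMap_apply,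
      LinearMap.applyₗ_apply_apply, map_list_prod, List.map_ofFn]
    congr 4
    funext i
    exact UniversalEnvelopingAlgebra.lift_ι_apply ℂ spMat (b i)
  have hker : ∀ f : MatPoly n, f ∈ RingHom.ker (evalOne (n := n)) ↔ evalOne f = 0 :=
    fun f => RingHom.mem_ker
  have h2 := list_derivation_pow_mem (RingHom.ker (evalOne (n := n)))
    ((hker _).2 (evalOne_linFun A.1)) d (List.ofFn fun i => matField (b i).1) (by simpa using he)
  rw [List.length_ofFn] at h2
  have h3 := (hker _).1 (Ideal.pow_le_self (Nat.succ_ne_zero _) h2)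
  rw [map_sub, sub_eq_zero, ← h1] at h3
  rw [h3, map_mul, map_mul, map_natCast, map_pow, evalOne_linFun, map_list_prod, List.map_ofFn,
    List.map_ofFn, List.prod_ofFn]
  split_ifs with h
  · subst h
    rw [Nat.sub_self, pow_zero, mul_one, Nat.descFactorial_self]
    congr 1
    exact Finset.prod_congr rfl fun i _ => evalOne_matField_linFun _ _
  · rw [zero_pow (by omega), mul_zero, zero_mul]

theorem symbolFunctional_symmetrization (A : Sp n) {d e : ℕ} (he : e ≤ d)
    {s : SymmetricAlgebra ℂ (Sp n)} (hs : s ∈ (LinearMap.range (SymmetricAlgebra.ι ℂ (Sp n))) ^ e) :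
    symbolFunctional A d (symmetrization s) =
      if e = d then (d.factorial : ℂ) * evalAt A s else 0 := by
  replace hs := pow_range_ι_le_span e hs
  induction hs using Submodule.span_induction with
  | mem s h =>
    obtain ⟨b, rfl⟩ := h
    rw [symmetrization_prod, symProd, map_smul, map_sum]
    have hσ : ∀ σ : Equiv.Perm (Fin e), symbolFunctional A d
        (List.ofFn fun i => UniversalEnvelopingAlgebra.ι ℂ (b (σ i))).prod =
        if e = d then (d.factorial : ℂ) * ∏ i, ((b i).1 * A.1).trace else 0 := by
      intro σ
      rw [symbolFunctional_ofFn A d e he fun i => b (σ i)]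
      rw [Equiv.prod_comp σ fun i => ((b i).1 * A.1).trace]
    rw [Finset.sum_congr rfl fun σ _ => hσ σ, Finset.sum_const, Finset.card_univ,
      Fintype.card_perm, Fintype.card_fin, nsmul_eq_mul, smul_eq_mul, ← mul_assoc,
      inv_mul_cancel₀ (by exact_mod_cast e.factorial_ne_zero), one_mul, map_prod]
    simp [evalAt, traceWith]
  | zero => simp
  | add a b _ _ ha hb => rw [map_add, map_add, ha, hb, map_add]; split_ifs <;> ring
  | smul c a _ ha =>
    rw [map_smul, map_smul, ha, map_smul]
    split_ifs
    · simp only [smul_eq_mul]; ring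
    · simp

end SymbolFunctional

/-! ### Linear independence of the elements r -/

section Independence

variable {n : ℕ}

/-- The diagonal element `diag(1, …, 1, -1, …, -1)` of `sp_{2n}`. -/
def hElt (n : ℕ) : Sp n :=
  ⟨Matrix.diagonal (Sum.elim (fun _ => 1) fun _ => -1), by
    apply mem_sp_of_transpose_mul_J
    rw [Matrix.diagonal_transpose]
    ext i j
    rw [Matrix.diagonal_mul, Matrix.mul_neg, Matrix.neg_apply, Matrix.mul_diagonal]
    rcases i with i | i <;> rcases j with j | j <;> by_cases h : i = j <;> simp [Matrix.J, h]⟩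

/-- Over ℕ nothing cancels, so a single term of the convolution bounds the coefficient from below.
-/
theorem coeff_geometric_pow_pos (m k : ℕ) : 1 ≤ PowerSeries.coeff (2 * k)
    ((PowerSeries.mk fun i => if Even i then 1 else 0 : PowerSeries ℕ) ^ (m + 1)) := by
  set G := (PowerSeries.mk fun i => if Even i then 1 else 0 : PowerSeries ℕ) with hG
  rw [pow_succ, PowerSeries.coeff_mul]
  refine le_trans ?_ (Finset.single_le_sum
    (f := fun p : ℕ × ℕ => PowerSeries.coeff p.1 (G ^ m) * PowerSeries.coeff p.2 G)
    (fun _ _ => Nat.zero_le _)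
    (a := (0, 2 * k)) (Finset.HasAntidiagonal.mem_antidiagonal.2 (zero_add (2 * k))))
  simp [hG, PowerSeries.coeff_mk]

theorem one_sub_X_sq_mul_geometric :
    (1 - PowerSeries.X ^ 2 : PowerSeries ℂ) *
      PowerSeries.map (Nat.castRingHom ℂ) (PowerSeries.mk fun i => if Even i then 1 else 0) = 1 := by
  ext k
  rw [sub_mul, one_mul, map_sub, PowerSeries.coeff_X_pow_mul', PowerSeries.coeff_one]
  simp only [PowerSeries.coeff_map, PowerSeries.coeff_mk]
  rcases k with _ | _ | k
  · simp
  · simp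
  · have h : (Even (k + 2)) ↔ Even k := by simp [Nat.even_add]
    simp [h]

/-- The matrix diag(1, -1) squares to the identity, so the generating function there is (1 - τ²)⁻¹
ω(x, y) · (1 - τ²)⁻ⁿ, whose even coefficients are positive multiples of ω(x, y). -/
theorem coeff_genFun_hElt_ne_zero (k : ℕ) {x y : Vec n} (h : omega x y = 1) :
    PowerSeries.coeff (2 * k) (genFun (hElt n).1 x y) ≠ 0 := by
  set u : PowerSeries ℂ := 1 - PowerSeries.X ^ 2 with hu
  set G : PowerSeries ℂ :=
    PowerSeries.map (Nat.castRingHom ℂ) (PowerSeries.mk fun i => if Even i then 1 else 0) with hG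
  have huG : u * G = 1 := one_sub_X_sq_mul_geometric
  have hsq : (hElt n).1 ^ 2 = 1 := by
    simp only [hElt, sq, Matrix.diagonal_mul_diagonal]
    rw [← Matrix.diagonal_one]
    congr 1
    funext i
    rcases i with i | i <;> simp
  have hQ : oneSubSq (hElt n).1 = u • (1 : Matrix (Fin n ⊕ Fin n) (Fin n ⊕ Fin n) (PowerSeries ℂ)) := by
    rw [oneSubSq, hsq, hu, sub_smul, one_smul]
    congr 2
    ext1 i j
    by_cases hij : i = j <;> simp [hij, Matrix.one_apply]
  have hQi : (oneSubSq (hElt n).1)⁻¹ =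
      G • (1 : Matrix (Fin n ⊕ Fin n) (Fin n ⊕ Fin n) (PowerSeries ℂ)) := by
    apply Matrix.inv_eq_right_inv
    rw [hQ, smul_mul_smul_comm, huG, one_smul, one_mul]
  have hD : (oneSub (hElt n).1).det = u ^ n := by
    have : oneSub (hElt n).1 = Matrix.diagonal
        (Sum.elim (fun _ => 1 - PowerSeries.X) fun _ => 1 + PowerSeries.X) := by
      ext1 i j
      by_cases hij : i = j
      · subst hij
        rcases i with i | i <;> simp [oneSub, hElt]
      · simp [oneSub, hElt, hij]
    rw [this, Matrix.det_diagonal, Fintype.prod_sum_type]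
    simp only [Sum.elim_inl, Sum.elim_inr, Finset.prod_const, Finset.card_univ, Fintype.card_fin]
    rw [← mul_pow, hu]
    congr 1
    ring
  have hDi : ((oneSub (hElt n).1)⁻¹).det = G ^ n := by
    have h1 : ((oneSub (hElt n).1)⁻¹).det * u ^ n = 1 := by
      rw [← hD, ← Matrix.det_mul, Matrix.nonsing_inv_mul _ (isUnit_det_oneSub _), Matrix.det_one]
    calc _ = ((oneSub (hElt n).1)⁻¹).det * (u ^ n * G ^ n) := by
          rw [← mul_pow, huG, one_pow, mul_one]
      _ = _ := by rw [← mul_assoc, h1, one_mul]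
  have hg : genFun (hElt n).1 x y = G ^ (n + 1) := by
    have e : omega (fun i => algebraMap ℂ (PowerSeries ℂ) (x i))
        (fun i => algebraMap ℂ (PowerSeries ℂ) (y i)) = 1 := by
      have := map_omega (algebraMap ℂ (PowerSeries ℂ)) x y
      rw [← this, h, map_one]
    rw [genFun, hQi, hDi, smul_mulVec, one_mulVec, omega_smul_right, e, mul_one, pow_succ']
  rw [hg, hG, ← map_pow, PowerSeries.coeff_map]
  have := coeff_geometric_pow_pos n k
  rw [eq_natCast, Nat.cast_ne_zero]
  omega

theorem exists_omega_eq_one (hn : 1 ≤ n) : ∃ x y : Vec n, omega x y = 1 := by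
  refine ⟨Pi.single (Sum.inr ⟨0, hn⟩) 1, Pi.single (Sum.inl ⟨0, hn⟩) 1, ?_⟩
  simp [omega, Matrix.J]

/-- The `r_{2j}` are linearly independent. -/
theorem eq_zero_of_pairing_eq_zero (hn : 1 ≤ n) (ζ : ℕ →₀ ℂ)
    (h : ∀ x y : Vec n, pairing ζ x y = 0) : ζ = 0 := by
  by_contra hζ
  have hne : ζ.support.Nonempty := Finsupp.support_nonempty_iff.2 hζ
  -- At the top index the symbol in degree 2K sees only r_{2K}; all the other terms have lower
  -- degree.
  set K := ζ.support.max' hne with hK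
  obtain ⟨x, y, hxy⟩ := exists_omega_eq_one hn
  have h1 := congrArg (symbolFunctional (hElt n) (2 * K)) (h x y)
  rw [pairing, Finsupp.sum, map_sum, map_zero, Finset.sum_eq_single K] at h1
  · rw [map_smul, r, symbolFunctional_symmetrization _ le_rfl (beta_mem_pow K x y), if_pos rfl,
      evalAt_beta] at h1
    have h2 : ζ K ≠ 0 := Finsupp.mem_support_iff.1 (ζ.support.max'_mem hne)
    have h3 : ((2 * K).factorial : ℂ) ≠ 0 := by exact_mod_cast (2 * K).factorial_ne_zero
    exact (mul_ne_zero h2 (mul_ne_zero h3 (coeff_genFun_hElt_ne_zero K hxy))) h1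
  · intro k hk hkK
    have : k ≤ K := ζ.support.le_max' k hk
    rw [map_smul, r, symbolFunctional_symmetrization _ (by omega) (beta_mem_pow k x y),
      if_neg (by omega), smul_zero]
  · intro hK'
    exact absurd (ζ.support.max'_mem hne) hK'

end Independence

/-! ### Invariant forms and characters -/

section InvariantForms

variable {n : ℕ}

theorem vec_ext_omega {v w : Vec n} (h : ∀ x, omega x v = omega x w) : v = w := by
  have h1 : Matrix.J (Fin n) ℂ *ᵥ v = Matrix.J (Fin n) ℂ *ᵥ w :=
    dotProduct_eq _ _ fun x => by rw [dotProduct_comm, dotProduct_comm _ x]; exact h x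
  have h2 := congrArg (fun z => -(Matrix.J (Fin n) ℂ *ᵥ z)) h1
  simpa [Matrix.J_squared, neg_mulVec] using h2

/-- The element `v ↦ ω(x, v) x` of `sp_{2n}`. -/
def sqElt (x : Vec n) : Sp n :=
  ⟨vecMulVec x (x ᵥ* Matrix.J (Fin n) ℂ), by
    apply mem_sp_of_transpose_mul_J
    have h : Matrix.J (Fin n) ℂ *ᵥ x = -(x ᵥ* Matrix.J (Fin n) ℂ) := by
      rw [← vecMul_transpose, Matrix.J_transpose, vecMul_neg]
    rw [transpose_vecMulVec, vecMulVec_mul, mul_neg, mul_vecMulVec, h, neg_vecMulVec, neg_neg]⟩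

theorem sqElt_mulVec (x v : Vec n) : (sqElt x).1 *ᵥ v = omega x v • x := by
  rw [sqElt, vecMulVec_mulVec, ← dotProduct_mulVec]
  ext i
  simp [omega, mul_comm]

/-- The invariant bilinear forms on the standard representation are the multiples of `ω`. -/
theorem exists_eq_omega_of_invariant (c : Vec n →ₗ[ℂ] Vec n →ₗ[ℂ] ℂ)
    (hc : ∀ (A : Sp n) v w, c (A.1 *ᵥ v) w + c v (A.1 *ᵥ w) = 0) :
    ∃ k : ℂ, ∀ v w, c v w = k * omega v w := by
  -- Invariance is only needed for the rank one elements v ↦ ω(x, v) x. They make c alternating and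
  -- c(x, ·) proportional to ω(x, ·).
  have hpt : ∀ x v w : Vec n, omega x v * c x w + omega x w * c v x = 0 := by
    intro x v w
    have := hc (sqElt x) v w
    rw [sqElt_mulVec, sqElt_mulVec, map_smul, map_smul] at this
    simpa using this
  have hxx : ∀ x : Vec n, omega x x = 0 := fun x => by
    have := omega_swap x x
    linear_combination (1 / 2 : ℂ) * this
  have hself : ∀ x, c x x = 0 := by
    intro x
    by_cases hx : ∀ v, omega v x = 0
    · have : x = 0 := vec_ext_omega fun v => by rw [hx v]; simp [omega]
      rw [this, map_zero]
    · push Not at hx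
      obtain ⟨v, hv⟩ := hx
      have := hpt x v x
      rw [hxx, zero_mul, add_zero, omega_swap] at this
      exact (mul_eq_zero.1 this).resolve_left (neg_ne_zero.2 hv)
  have hswap : ∀ v w, c v w = -c w v := by
    intro v w
    have := hself (v + w)
    simp only [map_add, LinearMap.add_apply, hself] at this
    linear_combination this
  have hpt' : ∀ x v w : Vec n, omega x v * c x w = omega x w * c x v := by
    intro x v w
    have := hpt x v w
    rw [hswap v x] at this
    linear_combination this
  rcases Nat.eq_zero_or_pos n with rfl | hn
  · refine ⟨0, fun v w => ?_⟩
    have : v = 0 := Subsingleton.elim _ _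
    rw [this, map_zero]; simp
  obtain ⟨p, q, hpq⟩ := exists_omega_eq_one hn
  have hqp : omega q p = -1 := by rw [omega_swap, hpq]
  refine ⟨c p q, ?_⟩
  have hp : ∀ w, c p w = c p q * omega p w := fun w => by
    have := hpt' p q w
    rw [hpq] at this
    linear_combination this
  have hq : ∀ w, c q w = c p q * omega q w := fun w => by
    have := hpt' q p w
    rw [hqp, hswap q p] at this
    linear_combination -this
  -- When ω(x, p) ≠ 0, comparing c(x, p) with c(p, x) identifies the factor at x with the one at p.
  have hne : ∀ x w, omega x p ≠ 0 → c x w = c p q * omega x w := by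
    intro x w hx
    have h1 := hpt' x p w
    rw [hswap x p, hp, omega_swap x p] at h1
    apply mul_left_cancel₀ hx
    linear_combination h1
  intro x w
  by_cases hx : omega x p = 0
  -- If x is orthogonal to p, then x + q is not, and the known value at q is subtracted.
  · have h1 := hne (x + q) w (by rw [omega_add_left, hx, hqp]; norm_num)
    rw [map_add, LinearMap.add_apply, hq, omega_add_left] at h1
    linear_combination h1
  · exact hne x w hx

/-- The form `ω` on the standard representation, as a bilinear map. -/
def omegaL (n : ℕ) : Vec n →ₗ[ℂ] Vec n →ₗ[ℂ] ℂ :=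
  LinearMap.mk₂ ℂ omega omega_add_left (fun c x y => omega_smul_left x y c) omega_add_right
    fun c x y => omega_smul_right x y c

theorem omega_sp_mulVec (A : Sp n) (v w : Vec n) :
    omega (A.1 *ᵥ v) w = -omega v (A.1 *ᵥ w) := by
  rw [omega_mulVec_left _ _ (transpose_mul_J A), neg_mulVec, omega_neg_right]

/-- `sp_{2n}` has no nonzero characters. -/
theorem eq_zero_of_map_lie_eq_zero (f : Sp n →ₗ[ℂ] ℂ) (hf : ∀ A B : Sp n, f ⁅A, B⁆ = 0) :
    f = 0 := by
  set L : Matrix (Fin n ⊕ Fin n) (Fin n ⊕ Fin n) ℂ := Matrix.of fun a b => f (coordElt n a b)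
    with hL
  have hcomm : ∀ C : Sp n, L * C.1 = C.1 * L := by
    intro C
    ext a b
    have := hf C (coordElt n a b)
    rw [lie_coordElt, map_sum] at this
    simp only [map_sub, map_smul, Finset.sum_sub_distrib, smul_eq_mul, sub_eq_zero] at this
    simp only [Matrix.mul_apply, hL, Matrix.of_apply]
    rw [← this]
    exact Finset.sum_congr rfl fun _ _ => mul_comm _ _
  obtain ⟨k, hk⟩ := exists_eq_omega_of_invariant ((omegaL n).compl₂ L.mulVecLin) (by
    intro A v w
    change omega (A.1 *ᵥ v) (L *ᵥ w) + omega v (L *ᵥ (A.1 *ᵥ w)) = 0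
    rw [omega_sp_mulVec, mulVec_mulVec, mulVec_mulVec, hcomm, neg_add_cancel])
  replace hk : ∀ v w, omega v (L *ᵥ w) = k * omega v w := hk
  have hsk := omega_mulVec_left L (-L) (genericMatrix_transpose_mul_J f)
  have h0 : ∀ v w : Vec n, omega v (L *ᵥ w) = 0 := by
    intro v w
    have h1 := hsk v w
    rw [neg_mulVec, omega_neg_right, omega_swap, hk w v, hk v w, omega_swap v w] at h1
    rw [hk]
    linear_combination (1 / 2 : ℂ) * h1
  have hLv : ∀ w : Vec n, L *ᵥ w = 0 := fun w => vec_ext_omega fun x => by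
    rw [h0]; simp [omega]
  have hL0 : ∀ a b, f (coordElt n a b) = 0 := by
    intro a b
    have := congrFun (hLv (Pi.single b 1)) a
    simpa [hL] using this
  ext A
  rw [← sum_coordElt A]
  simp [hL0]

end InvariantForms

/-! ### Parity of weights -/

section Weights

variable {n : ℕ}

/-- The inner derivation of `U(sp_{2n})` given by the diagonal element `hElt`. -/
def adH (n : ℕ) : End ℂ (USp n) :=
  LinearMap.mulLeft ℂ (UniversalEnvelopingAlgebra.ι ℂ (hElt n)) -
    LinearMap.mulRight ℂ (UniversalEnvelopingAlgebra.ι ℂ (hElt n))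

theorem adH_apply (u : USp n) : adH n u =
    UniversalEnvelopingAlgebra.ι ℂ (hElt n) * u - u * UniversalEnvelopingAlgebra.ι ℂ (hElt n) :=
  rfl

/-- The span of the weight vectors of even weight. -/
def evenPart (n : ℕ) : Submodule ℂ (USp n) :=
  ⨆ k : ℤ, (adH n).eigenspace (2 * k : ℂ)

theorem mem_evenPart_of_adH {u : USp n} (k : ℤ) (h : adH n u = (2 * k : ℂ) • u) :
    u ∈ evenPart n :=
  Submodule.mem_iSup_of_mem k (Module.End.mem_eigenspace_iff.2 h)

/-- The span of the weight vectors of even weight, as a subalgebra. -/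
def evenSubalgebra (n : ℕ) : Subalgebra ℂ (USp n) :=
  (evenPart n).toSubalgebra
    (mem_evenPart_of_adH 0 (by simp [adH_apply]))
    fun x y hx hy => by
      have : evenPart n * evenPart n ≤ evenPart n := by
        unfold evenPart
        rw [Submodule.iSup_mul]
        refine iSup_le fun k => ?_
        rw [Submodule.mul_iSup]
        refine iSup_le fun l => Submodule.mul_le.2 fun u hu v hv => ?_
        rw [Module.End.mem_eigenspace_iff, adH_apply] at hu hv
        refine mem_evenPart_of_adH (k + l) ?_
        have h1 : adH n (u * v) = adH n u * v + u * adH n v := by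
          simp only [adH_apply]; noncomm_ring
        rw [h1, adH_apply, adH_apply, hu, hv, smul_mul_assoc, mul_smul_comm, ← add_smul]
        push_cast
        ring_nf
      exact this (Submodule.mul_mem_mul hx hy)

/-- The weights of diag(1, -1) on sp_{2n} are 0 and ±2, and weights add under multiplication. -/
theorem evenPart_eq_top : evenPart n = ⊤ := by
  have h1 : ∀ A : Sp n, UniversalEnvelopingAlgebra.ι ℂ A ∈ evenSubalgebra n := by
    intro A
    rw [← sum_coordElt A, map_sum]
    refine Subalgebra.sum_mem _ fun a _ => ?_
    rw [map_sum]
    refine Subalgebra.sum_mem _ fun b _ => ?_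
    rw [map_smul]
    refine Subalgebra.smul_mem _ ?_ _
    have h2 : ∃ k : ℤ, ⁅hElt n, coordElt n a b⁆ = (2 * k : ℂ) • coordElt n a b := by
      have h3 : ⁅hElt n, coordElt n a b⁆ = ((hElt n).1 b b - (hElt n).1 a a) • coordElt n a b := by
        rw [lie_coordElt, Finset.sum_sub_distrib, sub_smul]
        congr 1
        · exact Finset.sum_eq_single b (fun k _ hk => by simp [hElt, hk]) (by simp)
        · exact Finset.sum_eq_single a (fun k _ hk => by simp [hElt, hk.symm]) (by simp)
      rw [h3]
      rcases a with a | a <;> rcases b with b | b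
      · exact ⟨0, by simp [hElt]⟩
      · exact ⟨-1, by simp [hElt]; norm_num⟩
      · exact ⟨1, by simp [hElt]; norm_num⟩
      · exact ⟨0, by simp [hElt]⟩
    obtain ⟨k, hk⟩ := h2
    refine mem_evenPart_of_adH k ?_
    rw [adH_apply, ← map_smul, ← hk, LieHom.map_lie, LieRing.of_associative_ring_bracket]
  rw [eq_top_iff]
  rintro u -
  exact uea_mem_of_ι (AlgHom.id ℂ (USp n)) (evenSubalgebra n) h1 u

/-- Eigenspaces for distinct eigenvalues are independent, and those with even eigenvalue already
span. -/
theorem eq_zero_of_adH_eq {u : USp n} {c : ℂ} (hc : ∀ k : ℤ, c ≠ 2 * k) (h : adH n u = c • u) :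
    u = 0 := by
  have h1 := Module.End.eigenspaces_iSupIndep (adH n) c
  have h2 : evenPart n ≤ ⨆ j, ⨆ (_ : j ≠ c), (adH n).eigenspace j :=
    iSup_le fun k => le_iSup₂_of_le (2 * k : ℂ) (hc k).symm le_rfl
  rw [evenPart_eq_top, top_le_iff] at h2
  rw [h2, disjoint_top] at h1
  have h3 := Module.End.mem_eigenspace_iff.2 h
  rwa [h1, Submodule.mem_bot] at h3

/-- The standard representation does not occur in `U(sp_{2n})`. -/
theorem eq_zero_of_equivariant (u : Vec n →ₗ[ℂ] USp n)
    (hu : ∀ (A : Sp n) v, u (A.1 *ᵥ v) = UniversalEnvelopingAlgebra.ι ℂ A * u v -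
      u v * UniversalEnvelopingAlgebra.ι ℂ A) : u = 0 := by
  apply LinearMap.pi_ext'
  intro i
  ext
  simp only [LinearMap.comp_apply, LinearMap.zero_apply, LinearMap.single_apply]
  have h := hu (hElt n) (Pi.single i 1)
  have hodd : ∀ k : ℤ, (1 : ℂ) ≠ 2 * k := by
    intro k hk
    have : (1 : ℤ) = 2 * k := by exact_mod_cast hk
    omega
  rw [← adH_apply] at h
  have hm : (hElt n).1 *ᵥ Pi.single i 1 = (hElt n).1 i i • (Pi.single i 1 : Vec n) := by
    ext j
    by_cases hj : j = i
    · subst hj; simp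
    · simp [hElt, hj]
  rw [hm, map_smul] at h
  rcases i with i | i
  · refine eq_zero_of_adH_eq hodd (h.symm.trans ?_)
    simp [hElt]
  · refine eq_zero_of_adH_eq (c := -1) (fun k hk => hodd (-k) ?_) (h.symm.trans ?_)
    · push_cast; linear_combination -hk
    · simp [hElt]

end Weights

/-! ### Compatibility of the pairings with symplectic similitudes -/

section Similitudes

variable {n : ℕ}

theorem transpose_mul_J_of_omega {A B : Matrix (Fin n ⊕ Fin n) (Fin n ⊕ Fin n) ℂ}
    (h : ∀ v w : Vec n, omega (A *ᵥ v) w = omega v (B *ᵥ w)) :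
    Aᵀ * Matrix.J (Fin n) ℂ = Matrix.J (Fin n) ℂ * B := by
  ext a b
  have := h (Pi.single a 1) (Pi.single b 1)
  simp only [omega, mulVec_single_one, single_one_dotProduct] at this
  exact this

theorem oneSub_mul_map {R : Type*} [CommRing R] [Algebra ℂ R]
    {M M' : Matrix (Fin n ⊕ Fin n) (Fin n ⊕ Fin n) R}
    {S : Matrix (Fin n ⊕ Fin n) (Fin n ⊕ Fin n) ℂ}
    (hM : M * S.map (algebraMap ℂ R) = S.map (algebraMap ℂ R) * M') :
    oneSub M * S.map (algebraMap ℂ (PowerSeries R)) =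
        S.map (algebraMap ℂ (PowerSeries R)) * oneSub M' ∧
      oneSubSq M * S.map (algebraMap ℂ (PowerSeries R)) =
        S.map (algebraMap ℂ (PowerSeries R)) * oneSubSq M' := by
  set T := S.map (algebraMap ℂ (PowerSeries R)) with hT
  have hTC : T = (S.map (algebraMap ℂ R)).map PowerSeries.C := by
    ext1 a b
    simp [hT, PowerSeries.algebraMap_apply]
  have h1 : M.map PowerSeries.C * T = T * M'.map PowerSeries.C := by
    rw [hTC]
    have := congrArg (PowerSeries.C : R →+* PowerSeries R).mapMatrix hM
    rwa [map_mul, map_mul] at this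
  constructor
  · rw [oneSub, oneSub, sub_mul, mul_sub, one_mul, mul_one, smul_mul_assoc, mul_smul_comm, h1]
  · rw [oneSubSq_eq, oneSubSq_eq, sub_mul, mul_sub, one_mul, mul_one, smul_mul_assoc,
      mul_smul_comm, mul_assoc, h1, ← mul_assoc, h1, mul_assoc]

/-- The behaviour of the generating function under a symplectic similitude `S`. -/
theorem genFun_conj {R : Type*} [CommRing R] [Algebra ℂ R]
    {M M' : Matrix (Fin n ⊕ Fin n) (Fin n ⊕ Fin n) R}
    {S B : Matrix (Fin n ⊕ Fin n) (Fin n ⊕ Fin n) ℂ} {c : ℂ} (hS : IsUnit S.det)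
    (hB : Sᵀ * Matrix.J (Fin n) ℂ = Matrix.J (Fin n) ℂ * B) (hBS : B * S = c • 1)
    (hM : M * S.map (algebraMap ℂ R) = S.map (algebraMap ℂ R) * M') (x y : Vec n) :
    genFun M (S *ᵥ x) (S *ᵥ y) = c • genFun M' x y := by
  obtain ⟨h1, h2⟩ := oneSub_mul_map hM
  set f := algebraMap ℂ (PowerSeries R) with hf
  have hmv : ∀ z : Vec n, (fun i => f ((S *ᵥ z) i)) = S.map f *ᵥ fun i => f (z i) := by
    intro z
    ext1 i
    rw [RingHom.map_mulVec]
    rfl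
  have hinv : ∀ z, (oneSubSq M)⁻¹ *ᵥ (S.map f *ᵥ z) = S.map f *ᵥ ((oneSubSq M')⁻¹ *ᵥ z) := by
    intro z
    rw [mulVec_mulVec, mulVec_mulVec]
    congr 1
    calc _ = (oneSubSq M)⁻¹ * (S.map f * oneSubSq M') * (oneSubSq M')⁻¹ := by
          rw [mul_assoc, mul_assoc, Matrix.mul_nonsing_inv _ (isUnit_det_oneSubSq M'), mul_one]
      _ = _ := by
          rw [← h2, ← mul_assoc, Matrix.nonsing_inv_mul _ (isUnit_det_oneSubSq M), one_mul]
  have hSf : IsUnit (S.map f).det := by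
    have : (S.map f).det = f S.det := (RingHom.map_det f S).symm
    rw [this]
    exact hS.map f
  have hdet : ((oneSub M)⁻¹).det = ((oneSub M')⁻¹).det := by
    have h3 := congrArg Matrix.det h1
    rw [Matrix.det_mul, Matrix.det_mul, mul_comm] at h3
    rw [Matrix.det_nonsing_inv, Matrix.det_nonsing_inv, hSf.mul_left_cancel h3]
  have hBSf : B.map f * S.map f = f c • 1 := by
    have h3 := congrArg f.mapMatrix hBS
    rw [map_mul] at h3
    refine h3.trans ?_
    ext1 i j
    by_cases hij : i = j <;> simp [hij]
  rw [genFun, genFun, hmv, hmv, hinv, hdet,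
    omega_mulVec_left _ _ (transpose_mul_J_map f hB), mulVec_mulVec, hBSf, smul_mulVec, one_mulVec,
    omega_smul_right, Algebra.smul_def, mul_assoc]

variable {S B : Matrix (Fin n ⊕ Fin n) (Fin n ⊕ Fin n) ℂ} {c : ℂ} {φ : Sp n →ₗ[ℂ] Sp n}

/-- Conjugation by S preserves the trace form. Applying it to the elements dual to the matrix
entries therefore has the effect of conjugating the generic matrix by S in the opposite sense. -/
theorem genericMatrix_mul_map (hS : IsUnit S.det) (hφ : ∀ A, (φ A).1 * S = S * A.1)
    (hsurj : Function.Surjective φ) :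
    genericMatrix n * S.map (algebraMap ℂ (SymmetricAlgebra ℂ (Sp n))) =
      S.map (algebraMap ℂ (SymmetricAlgebra ℂ (Sp n))) *
        Matrix.of fun a b => SymmetricAlgebra.ι ℂ (Sp n) (φ (coordElt n a b)) := by
  have htr : ∀ A D : Sp n, ((φ A).1 * (φ D).1).trace = (A.1 * D.1).trace := by
    intro A D
    have h1 : ∀ A : Sp n, (φ A).1 = S * A.1 * S⁻¹ := by
      intro A
      rw [← hφ, mul_assoc, Matrix.mul_nonsing_inv _ hS, mul_one]
    rw [h1, h1, Matrix.trace_mul_comm, ← mul_assoc, ← mul_assoc, Matrix.trace_mul_comm,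
      Matrix.trace_mul_comm A.1]
    congr 1
    calc _ = (S⁻¹ * S) * D.1 * (S⁻¹ * S) * A.1 := by simp only [mul_assoc]
      _ = _ := by rw [Matrix.nonsing_inv_mul _ hS, one_mul, mul_one]
  have key : ∀ a b, ∑ k, S k b • coordElt n a k = ∑ k, S a k • φ (coordElt n k b) := by
    intro a b
    apply sp_ext_trace
    intro C
    obtain ⟨D, rfl⟩ := hsurj C
    have h1 : (∑ k, S k b • coordElt n a k : Sp n).1 = ∑ k, S k b • (coordElt n a k).1 := by simp
    have h2 : (∑ k, S a k • φ (coordElt n k b) : Sp n).1 = ∑ k, S a k • (φ (coordElt n k b)).1 := by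
      simp
    have h3 := congrFun (congrFun (hφ D) a) b
    rw [h1, h2]
    simp only [Finset.sum_mul, Matrix.trace_sum, smul_mul_assoc, Matrix.trace_smul, htr,
      trace_coordElt_mul, smul_eq_mul]
    rw [Matrix.mul_apply, Matrix.mul_apply] at h3
    rw [← h3]
    exact Finset.sum_congr rfl fun _ _ => mul_comm _ _
  ext1 a b
  have h := congrArg (SymmetricAlgebra.ι ℂ (Sp n)) (key a b)
  simp only [map_sum, map_smul, Algebra.smul_def] at h
  rw [Matrix.mul_apply, Matrix.mul_apply]
  simp only [genericMatrix, Matrix.of_apply, Matrix.map_apply]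
  rw [← h]
  exact Finset.sum_congr rfl fun _ _ => mul_comm _ _

theorem beta_mulVec (hS : IsUnit S.det)
    (hB : Sᵀ * Matrix.J (Fin n) ℂ = Matrix.J (Fin n) ℂ * B) (hBS : B * S = c • 1)
    (hφ : ∀ A, (φ A).1 * S = S * A.1) (hsurj : Function.Surjective φ) (k : ℕ) (x y : Vec n) :
    beta n k (S *ᵥ x) (S *ᵥ y) = c • symMap φ (beta n k x y) := by
  rw [symMap_beta, beta, genFun_conj hS hB hBS (genericMatrix_mul_map hS hφ hsurj),
    LinearMap.map_smul_of_tower]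

/-- The pairings are compatible with the automorphism of `U(sp_{2n})` induced by a symplectic
similitude `S`. -/
theorem pairing_mulVec (hS : IsUnit S.det)
    (hB : Sᵀ * Matrix.J (Fin n) ℂ = Matrix.J (Fin n) ℂ * B) (hBS : B * S = c • 1)
    (φ : Sp n →ₗ⁅ℂ⁆ Sp n) (hφ : ∀ A, (φ A).1 * S = S * A.1) (hsurj : Function.Surjective φ)
    (f : USp n →ₐ[ℂ] USp n)
    (hf : ∀ A, f (UniversalEnvelopingAlgebra.ι ℂ A) = UniversalEnvelopingAlgebra.ι ℂ (φ A))
    (ζ : ℕ →₀ ℂ) (x y : Vec n) :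
    pairing ζ (S *ᵥ x) (S *ᵥ y) = c • f (pairing ζ x y) := by
  simp only [pairing, Finsupp.sum, map_sum, Finset.smul_sum]
  refine Finset.sum_congr rfl fun k _ => ?_
  have h := beta_mulVec (φ := φ.toLinearMap) hS hB hBS hφ hsurj k x y
  rw [map_smul, smul_comm c, r, h, map_smul, symmetrization_symMap φ f hf, r]

end Similitudes

/-! ### Generators, augmentation and the standard representation -/

section Generators

variable {n : ℕ}

/-- The generators of `H_ζ(sp_{2n})` in `V_{2n}`, as a linear map. -/
def genV (n : ℕ) (ζ : ℕ →₀ ℂ) : Vec n →ₗ[ℂ] H n ζ :=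
  (RingQuot.mkAlgHom ℂ (CherednikRel ζ)).toLinearMap ∘ₗ semiV n

theorem genV_apply (ζ : ℕ →₀ ℂ) (v : Vec n) : genV n ζ v = gen n ζ (.inr v) := rfl

theorem ofH_mul_genV_sub (ζ : ℕ →₀ ℂ) (A : Sp n) (v : Vec n) :
    ofH n ζ (UniversalEnvelopingAlgebra.ι ℂ A) * genV n ζ v -
      genV n ζ v * ofH n ζ (UniversalEnvelopingAlgebra.ι ℂ A) = genV n ζ (A.1 *ᵥ v) := by
  rw [ofH_ι]
  have := congrArg (RingQuot.mkAlgHom ℂ (CherednikRel ζ)) (semi_act A v)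
  rwa [map_sub, map_mul, map_mul] at this

theorem genV_commutator (ζ : ℕ →₀ ℂ) (x y : Vec n) :
    genV n ζ x * genV n ζ y - genV n ζ y * genV n ζ x = ofH n ζ (pairing ζ x y) := by
  have := RingQuot.mkAlgHom_rel ℂ (CherednikRel.comm (ζ := ζ) x y)
  rwa [map_sub, map_mul, map_mul] at this

/-- The augmentation of `U(sp_{2n})`. -/
def augmentation (n : ℕ) : USp n →ₐ[ℂ] ℂ := UniversalEnvelopingAlgebra.lift ℂ 0

theorem augmentation_ι (A : Sp n) : augmentation n (UniversalEnvelopingAlgebra.ι ℂ A) = 0 := by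
  rw [augmentation, UniversalEnvelopingAlgebra.lift_ι_apply, LieHom.zero_apply]

/-- The standard representation of `U(sp_{2n})`. -/
def stdRep (n : ℕ) : USp n →ₐ[ℂ] Matrix (Fin n ⊕ Fin n) (Fin n ⊕ Fin n) ℂ :=
  UniversalEnvelopingAlgebra.lift ℂ (LieAlgebra.Symplectic.sp (Fin n) ℂ).incl

theorem stdRep_ι (A : Sp n) : stdRep n (UniversalEnvelopingAlgebra.ι ℂ A) = A.1 := by
  rw [stdRep, UniversalEnvelopingAlgebra.lift_ι_apply]
  rfl

end Generators

/-! ### The filtered pieces of degree 2 and N -/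

section FilteredPieces

variable {n N : ℕ} {ζ : ℕ →₀ ℂ}

theorem gen_inl_mem_stdFiltration (A : Sp n) : gen n ζ (.inl A) ∈ stdFiltration n N ζ 2 :=
  Submodule.subset_span ⟨[.inl A], by simp [genDeg], by simp⟩

theorem gen_inr_mem_stdFiltration (v : Vec n) : gen n ζ (.inr v) ∈ stdFiltration n N ζ N :=
  Submodule.subset_span ⟨[.inr v], by simp [genDeg], by simp⟩

/-- A word of degree at most 2 is empty or one letter of sp_{2n}: two letters cost at least 4, and a
vector costs N ≥ 3. -/
theorem exists_of_mem_stdFiltration_two (hN : 3 ≤ N) {a : H n ζ}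
    (ha : a ∈ stdFiltration n N ζ 2) : ∃ (c : ℂ) (A : Sp n),
      a = ofH n ζ (algebraMap ℂ _ c + UniversalEnvelopingAlgebra.ι ℂ A) := by
  induction ha using Submodule.span_induction with
  | mem a h =>
    obtain ⟨w, hw, rfl⟩ := h
    rcases w with _ | ⟨A | v, _ | ⟨s, w⟩⟩
    · exact ⟨1, 0, by simp⟩
    · refine ⟨0, A, ?_⟩
      rw [map_zero, zero_add, ofH_ι]
      simp
    · exfalso
      rcases s with B | v <;> simp [genDeg] at hw <;> omega
    · simp [genDeg] at hw; omega
    · simp [genDeg] at hw; omega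
  | zero => exact ⟨0, 0, by simp⟩
  | add a b _ _ ha hb =>
    obtain ⟨c, A, rfl⟩ := ha
    obtain ⟨d, B, rfl⟩ := hb
    refine ⟨c + d, A + B, ?_⟩
    simp only [map_add]
    abel
  | smul k a _ ha =>
    obtain ⟨c, A, rfl⟩ := ha
    refine ⟨k * c, k • A, ?_⟩
    rw [← map_smul, smul_add, ← map_smul (UniversalEnvelopingAlgebra.ι ℂ), map_mul,
      ← Algebra.smul_def]

/-- A word of degree at most N that contains a vector has no room for another letter. -/
theorem exists_of_mem_stdFiltration (hN : 3 ≤ N) {a : H n ζ}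
    (ha : a ∈ stdFiltration n N ζ N) : ∃ (u : USp n) (v : Vec n),
      a = ofH n ζ u + genV n ζ v := by
  induction ha using Submodule.span_induction with
  | mem a h =>
    obtain ⟨w, hw, rfl⟩ := h
    have h1 : (∃ u, (w.map (gen n ζ)).prod = ofH n ζ u) ∨ ∃ v, w = [.inr v] := by
      induction w with
      | nil => exact .inl ⟨1, by simp⟩
      | cons s w ih =>
        rw [List.map_cons, List.sum_cons] at hw
        rcases s with A | v
        · simp only [genDeg] at hw
          rcases ih (by omega) with ⟨u, hu⟩ | ⟨v, rfl⟩
          · refine .inl ⟨UniversalEnvelopingAlgebra.ι ℂ A * u, ?_⟩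
            rw [List.map_cons, List.prod_cons, hu, map_mul, ofH_ι]
          · simp [genDeg] at hw
        · rcases w with _ | ⟨s, w⟩
          · exact .inr ⟨v, rfl⟩
          · rcases s with B | v <;> simp [genDeg] at hw <;> omega
    rcases h1 with ⟨u, hu⟩ | ⟨v, rfl⟩
    · exact ⟨u, 0, by rw [hu, map_zero, add_zero]⟩
    · exact ⟨0, v, by simp [genV_apply]⟩
  | zero => exact ⟨0, 0, by simp⟩
  | add a b _ _ ha hb =>
    obtain ⟨u, v, rfl⟩ := ha
    obtain ⟨u', v', rfl⟩ := hb
    refine ⟨u + u', v + v', ?_⟩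
    rw [map_add, map_add]
    abel
  | smul k a _ ha =>
    obtain ⟨u, v, rfl⟩ := ha
    exact ⟨k • u, k • v, by rw [map_smul, map_smul, smul_add]⟩

end FilteredPieces

/-! ### Components of a filtered isomorphism -/

section FilteredMaps

variable {n N : ℕ} {ζ ζ' : ℕ →₀ ℂ}

/-- The form of a filtered isomorphism on the generators. -/
theorem exists_components (hN : 3 ≤ N) (Φ : H n ζ ≃ₐ[ℂ] H n ζ')
    (hΦ : ∀ k, (stdFiltration n N ζ k).map Φ.toLinearMap = stdFiltration n N ζ' k) :
    ∃ (l : Sp n →ₗ[ℂ] ℂ) (φ : Sp n →ₗ[ℂ] Sp n) (ψ : Vec n →ₗ[ℂ] Vec n) (t : Vec n →ₗ[ℂ] USp n),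
      (∀ A, Φ (ofH n ζ (UniversalEnvelopingAlgebra.ι ℂ A)) =
        ofH n ζ' (algebraMap ℂ _ (l A) + UniversalEnvelopingAlgebra.ι ℂ (φ A))) ∧
      (∀ v, Φ (genV n ζ v) = ofH n ζ' (t v) + genV n ζ' (ψ v)) ∧ Function.Surjective ψ := by
  obtain ⟨pU, pV, hUU, hUV, hVU, hVV⟩ := exists_proj n ζ'
  have hmem : ∀ {k a}, a ∈ stdFiltration n N ζ k → Φ a ∈ stdFiltration n N ζ' k := by
    intro k a ha
    rw [← hΦ k]
    exact ⟨a, ha, rfl⟩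
  have hG : ∀ A, ∃ (c : ℂ) (B : Sp n), Φ (ofH n ζ (UniversalEnvelopingAlgebra.ι ℂ A)) =
      ofH n ζ' (algebraMap ℂ _ c + UniversalEnvelopingAlgebra.ι ℂ B) := fun A => by
    rw [ofH_ι]
    exact exists_of_mem_stdFiltration_two hN (hmem (gen_inl_mem_stdFiltration A))
  have hV : ∀ v, ∃ (u : USp n) (w : Vec n), Φ (genV n ζ v) = ofH n ζ' u + genV n ζ' w := fun v =>
    exists_of_mem_stdFiltration hN (hmem (gen_inr_mem_stdFiltration v))
  let T : Sp n →ₗ[ℂ] USp n := pU ∘ₗ Φ.toLinearMap ∘ₗ (ofH n ζ).toLinearMap ∘ₗ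
    (UniversalEnvelopingAlgebra.ι ℂ : Sp n →ₗ⁅ℂ⁆ _).toLinearMap
  have hT : ∀ A c B, Φ (ofH n ζ (UniversalEnvelopingAlgebra.ι ℂ A)) =
      ofH n ζ' (algebraMap ℂ _ c + UniversalEnvelopingAlgebra.ι ℂ B) →
      T A = algebraMap ℂ _ c + UniversalEnvelopingAlgebra.ι ℂ B := by
    intro A c B h
    change pU (Φ (ofH n ζ (UniversalEnvelopingAlgebra.ι ℂ A))) = _
    rw [h, hUU]
  -- In a sum c + B the augmentation reads off c, and the standard representation, with c removed,
  -- reads off B. Defining the components by linear formulas makes their linearity automatic.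
  let l : Sp n →ₗ[ℂ] ℂ := (augmentation n).toLinearMap ∘ₗ T
  have hl : ∀ A c B, T A = algebraMap ℂ _ c + UniversalEnvelopingAlgebra.ι ℂ B → l A = c := by
    intro A c B h
    change augmentation n (T A) = c
    rw [h, map_add, augmentation_ι, AlgHom.commutes, add_zero]
    rfl
  let φ₀ : Sp n →ₗ[ℂ] Matrix (Fin n ⊕ Fin n) (Fin n ⊕ Fin n) ℂ :=
    (stdRep n).toLinearMap ∘ₗ T - (Algebra.linearMap ℂ _) ∘ₗ l
  have hφ₀ : ∀ A c B, T A = algebraMap ℂ _ c + UniversalEnvelopingAlgebra.ι ℂ B → φ₀ A = B.1 := by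
    intro A c B h
    change stdRep n (T A) - algebraMap ℂ _ (l A) = B.1
    rw [hl A c B h, h, map_add, stdRep_ι, AlgHom.commutes, add_sub_cancel_left]
  let φ : Sp n →ₗ[ℂ] Sp n :=
    LinearMap.codRestrict (LieAlgebra.Symplectic.sp (Fin n) ℂ).toSubmodule φ₀ fun A => by
      obtain ⟨c, B, h⟩ := hG A
      rw [hφ₀ A c B (hT A c B h)]
      exact B.2
  let ψ : Vec n →ₗ[ℂ] Vec n := LinearMap.pi fun i =>
    (augmentation n).toLinearMap ∘ₗ pV i ∘ₗ Φ.toLinearMap ∘ₗ genV n ζ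
  let t : Vec n →ₗ[ℂ] USp n := pU ∘ₗ Φ.toLinearMap ∘ₗ genV n ζ
  have hpV : ∀ u w, (fun i => augmentation n (pV i (ofH n ζ' u + genV n ζ' w))) = w := by
    intro u w
    ext1 i
    rw [map_add, hVU, zero_add, genV_apply, hVV, AlgHom.commutes]
    rfl
  have hψ : ∀ v u w, Φ (genV n ζ v) = ofH n ζ' u + genV n ζ' w → ψ v = w := by
    intro v u w h
    rw [← hpV u w, ← h]
    rfl
  have ht : ∀ v u w, Φ (genV n ζ v) = ofH n ζ' u + genV n ζ' w → t v = u := by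
    intro v u w h
    change pU (Φ (genV n ζ v)) = u
    rw [h, map_add, hUU, genV_apply, hUV, add_zero]
  have hψt : ∀ v, Φ (genV n ζ v) = ofH n ζ' (t v) + genV n ζ' (ψ v) := by
    intro v
    obtain ⟨u, w, h⟩ := hV v
    rw [hψ v u w h, ht v u w h, h]
  refine ⟨l, φ, ψ, t, fun A => ?_, hψt, fun w => ?_⟩
  · obtain ⟨c, B, h⟩ := hG A
    have h1 : φ A = B := Subtype.ext (hφ₀ A c B (hT A c B h))
    rw [hl A c B (hT A c B h), h1, h]
  · have hw : genV n ζ' w ∈ stdFiltration n N ζ' N := gen_inr_mem_stdFiltration w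
    rw [← hΦ N] at hw
    obtain ⟨a, ha, haw⟩ := hw
    obtain ⟨u, v, rfl⟩ := exists_of_mem_stdFiltration hN ha
    refine ⟨v, ?_⟩
    -- The image of U(sp_{2n}) stays in U(sp_{2n}), so in a preimage of w only the vector v
    -- contributes to the V-component.
    obtain ⟨u', hu'⟩ := uea_mem_of_ι (A := H n ζ') ((Φ : H n ζ →ₐ[ℂ] H n ζ').comp (ofH n ζ)) (ofH n ζ').range
      (fun A => by
        obtain ⟨c, B, h⟩ := hG A
        exact ⟨_, h.symm⟩) u
    have h1 : Φ (ofH n ζ u + genV n ζ v) = ofH n ζ' (u' + t v) + genV n ζ' (ψ v) := by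
      have h2 : Φ (ofH n ζ u) = ofH n ζ' u' := hu'.symm
      rw [map_add, h2, hψt, map_add, add_assoc]
    have h3 : Φ (ofH n ζ u + genV n ζ v) = ofH n ζ' 0 + genV n ζ' w := by
      rw [map_zero, zero_add]; exact haw
    rw [← hpV (u' + t v) (ψ v), ← h1, h3, hpV]

end FilteredMaps

/-! ### A filtered isomorphism is a symplectic similitude -/

section Necessity

variable {n N : ℕ} {ζ ζ' : ℕ →₀ ℂ}

theorem h_map_sub (Φ : H n ζ ≃ₐ[ℂ] H n ζ') (a b : H n ζ) : Φ (a - b) = Φ a - Φ b :=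
  eq_sub_of_add_eq ((map_add Φ (a - b) b).symm.trans (congrArg Φ (sub_add_cancel a b)))

theorem sp_ext_mulVec {A B : Sp n} (h : ∀ v : Vec n, A.1 *ᵥ v = B.1 *ᵥ v) : A = B :=
  Subtype.ext (Matrix.ext_of_mulVec_single fun _ => h _)

/-- A filtered isomorphism preserves `U(sp_{2n})` and `V_{2n}`. -/
theorem exists_similitude_of_components (hn : 1 ≤ n) (Φ : H n ζ ≃ₐ[ℂ] H n ζ')
    (l : Sp n →ₗ[ℂ] ℂ) (φ : Sp n →ₗ[ℂ] Sp n) (ψ : Vec n →ₗ[ℂ] Vec n) (t : Vec n →ₗ[ℂ] USp n)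
    (hφ : ∀ A, Φ (ofH n ζ (UniversalEnvelopingAlgebra.ι ℂ A)) =
        ofH n ζ' (algebraMap ℂ _ (l A) + UniversalEnvelopingAlgebra.ι ℂ (φ A)))
    (hψ : ∀ v, Φ (genV n ζ v) = ofH n ζ' (t v) + genV n ζ' (ψ v))
    (hsurj : Function.Surjective ψ) :
    l = 0 ∧ t = 0 ∧ (∀ A B, φ ⁅A, B⁆ = ⁅φ A, φ B⁆) ∧ Function.Surjective φ ∧
      (∀ A v, (φ A).1 *ᵥ ψ v = ψ (A.1 *ᵥ v)) ∧
      ∃ c : ℂ, c ≠ 0 ∧ ∀ v w, omega (ψ v) (ψ w) = c * omega v w := by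
  obtain ⟨pU, pV, hUU, hUV, hVU, hVV⟩ := exists_proj n ζ'
  have hofH : ∀ u w, ofH n ζ' u = ofH n ζ' w → u = w := fun u w h => by
    rw [← hUU u, h, hUU]
  have hinj : Function.Injective ψ := LinearMap.injective_iff_surjective.2 hsurj
  have hlie : ∀ A B, algebraMap ℂ (USp n) (l ⁅A, B⁆) + UniversalEnvelopingAlgebra.ι ℂ (φ ⁅A, B⁆) =
      UniversalEnvelopingAlgebra.ι ℂ ⁅φ A, φ B⁆ := by
    intro A B
    apply hofH
    rw [← hφ, LieHom.map_lie, LieHom.map_lie, LieRing.of_associative_ring_bracket,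
      LieRing.of_associative_ring_bracket, map_sub, map_mul, map_mul, h_map_sub, map_mul, map_mul,
      hφ, hφ, ← map_mul (ofH n ζ'), ← map_mul (ofH n ζ'), ← map_sub (ofH n ζ')]
    congr 1
    -- Scalars are central, so they drop out of the commutator and l vanishes on brackets.
    have h1 := Algebra.commutes (A := USp n) (l A) (UniversalEnvelopingAlgebra.ι ℂ (φ B))
    have h2 := Algebra.commutes (A := USp n) (l B) (UniversalEnvelopingAlgebra.ι ℂ (φ A))
    have h3 := Algebra.commutes (A := USp n) (l A) (algebraMap ℂ (USp n) (l B))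
    rw [add_mul, mul_add, mul_add, add_mul, mul_add, mul_add, h1, h2, h3]
    abel
  have hl : l = 0 := eq_zero_of_map_lie_eq_zero l fun A B => by
    have := congrArg (augmentation n) (hlie A B)
    rw [map_add, augmentation_ι, augmentation_ι, add_zero, AlgHom.commutes] at this
    exact this
  have hφlie : ∀ A B, φ ⁅A, B⁆ = ⁅φ A, φ B⁆ := fun A B => by
    have := congrArg (stdRep n) (hlie A B)
    rw [hl, LinearMap.zero_apply, map_zero, zero_add, stdRep_ι, stdRep_ι] at this
    exact Subtype.ext this
  -- Applying Φ to Av = [A, v] and separating components gives one equivariance for t and one for ψ.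
  have hact : ∀ (A : Sp n) v, ofH n ζ' (t (A.1 *ᵥ v)) + genV n ζ' (ψ (A.1 *ᵥ v)) =
      ofH n ζ' (UniversalEnvelopingAlgebra.ι ℂ (φ A) * t v -
        t v * UniversalEnvelopingAlgebra.ι ℂ (φ A)) + genV n ζ' ((φ A).1 *ᵥ ψ v) := by
    intro A v
    rw [← hψ, ← ofH_mul_genV_sub, h_map_sub, map_mul, map_mul, hφ, hψ, hl, LinearMap.zero_apply,
      map_zero, zero_add, ← ofH_mul_genV_sub, map_sub, map_mul, map_mul]
    noncomm_ring
  have ht : ∀ (A : Sp n) v, t (A.1 *ᵥ v) = UniversalEnvelopingAlgebra.ι ℂ (φ A) * t v -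
        t v * UniversalEnvelopingAlgebra.ι ℂ (φ A) := fun A v => by
    have := congrArg pU (hact A v)
    rwa [map_add, map_add, hUU, hUU, genV_apply, genV_apply, hUV, hUV, add_zero, add_zero] at this
  have hψφ : ∀ (A : Sp n) v, (φ A).1 *ᵥ ψ v = ψ (A.1 *ᵥ v) := fun A v => by
    ext i
    have := congrArg (fun a => augmentation n (pV i a)) (hact A v)
    simp only [map_add, hVU, genV_apply, hVV, AlgHom.commutes, zero_add] at this
    exact this.symm
  have hφinj : Function.Injective φ := by
    rw [injective_iff_map_eq_zero]
    intro A hA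
    refine sp_ext_mulVec fun v => hinj ?_
    rw [← hψφ, hA]
    change (0 : Matrix (Fin n ⊕ Fin n) (Fin n ⊕ Fin n) ℂ) *ᵥ ψ v =
      ψ ((0 : Matrix (Fin n ⊕ Fin n) (Fin n ⊕ Fin n) ℂ) *ᵥ v)
    rw [zero_mulVec, zero_mulVec, map_zero]
  have hφsurj : Function.Surjective φ := LinearMap.injective_iff_surjective.1 hφinj
  let e : Vec n ≃ₗ[ℂ] Vec n := LinearEquiv.ofBijective ψ ⟨hinj, hsurj⟩
  -- Precomposing with the inverse of ψ removes the twist by φ and leaves an ordinary equivariant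
  -- map.
  have ht0 : t ∘ₗ e.symm.toLinearMap = 0 := by
    apply eq_zero_of_equivariant
    intro B v
    obtain ⟨A, rfl⟩ := hφsurj B
    obtain ⟨w, rfl⟩ := hsurj v
    have h1 : ∀ w, e.symm (ψ w) = w := fun w => e.symm_apply_apply w
    simp only [LinearMap.comp_apply, LinearEquiv.coe_coe]
    rw [hψφ, h1, h1, ht]
  refine ⟨hl, ?_, hφlie, hφsurj, hψφ, ?_⟩
  · refine LinearMap.ext fun v => ?_
    have := congrArg (fun f => f (e v)) ht0
    simpa using this
  · obtain ⟨c, hc⟩ := exists_eq_omega_of_invariant ((omegaL n).compl₁₂ ψ ψ) (by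
      intro A v w
      change omega (ψ (A.1 *ᵥ v)) (ψ w) + omega (ψ v) (ψ (A.1 *ᵥ w)) = 0
      rw [← hψφ, ← hψφ, omega_sp_mulVec, neg_add_cancel])
    replace hc : ∀ v w, omega (ψ v) (ψ w) = c * omega v w := hc
    refine ⟨c, ?_, hc⟩
    rintro rfl
    obtain ⟨x, y, hxy⟩ := exists_omega_eq_one hn
    obtain ⟨v, rfl⟩ := hsurj x
    obtain ⟨w, rfl⟩ := hsurj y
    rw [hc, zero_mul] at hxy
    exact zero_ne_one hxy

theorem exists_smul_eq_of_filteredIsomorphic (hn : 1 ≤ n) (hN : 3 ≤ N)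
    (h : FilteredIsomorphic n N ζ ζ') : ∃ θ : ℂ, θ ≠ 0 ∧ ζ' = θ • ζ := by
  obtain ⟨Φ, hΦ⟩ := h
  obtain ⟨l, φ, ψ, t, hφ, hψ, hsurj⟩ := exists_components hN Φ hΦ
  obtain ⟨rfl, rfl, hlie, hφsurj, hψφ, c, hc0, hc⟩ :=
    exists_similitude_of_components hn Φ l φ ψ t hφ hψ hsurj
  let φ' : Sp n →ₗ⁅ℂ⁆ Sp n := { φ with map_lie' := fun {A B} => hlie A B }
  let f : USp n →ₐ[ℂ] USp n := UniversalEnvelopingAlgebra.lift ℂ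
    ((UniversalEnvelopingAlgebra.ι ℂ).comp φ')
  have hf : ∀ A, f (UniversalEnvelopingAlgebra.ι ℂ A) =
      UniversalEnvelopingAlgebra.ι ℂ (φ' A) := fun A => by
    rw [UniversalEnvelopingAlgebra.lift_ι_apply]
    rfl
  have hΦf : (Φ : H n ζ →ₐ[ℂ] H n ζ').comp (ofH n ζ) = (ofH n ζ').comp f := by
    apply UniversalEnvelopingAlgebra.hom_ext ℂ (A := H n ζ')
    ext A
    change Φ (ofH n ζ (UniversalEnvelopingAlgebra.ι ℂ A)) =
      ofH n ζ' (f (UniversalEnvelopingAlgebra.ι ℂ A))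
    rw [hf, hφ, LinearMap.zero_apply, map_zero, zero_add]
    rfl
  -- Apply Φ to [x, y] = ζ(x, y); the result can be compared in U(sp_{2n}) because it embeds in
  -- H_{ζ'}.
  have hpair : ∀ x y : Vec n, f (pairing ζ x y) = pairing ζ' (ψ x) (ψ y) := by
    intro x y
    obtain ⟨pU, -, hUU, -⟩ := exists_proj n ζ'
    rw [← hUU (f _), ← hUU (pairing ζ' _ _), ← genV_commutator]
    have h1 : Φ (ofH n ζ (pairing ζ x y)) = ofH n ζ' (f (pairing ζ x y)) :=
      congrArg (fun F => F (pairing ζ x y)) hΦf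
    rw [← h1, ← genV_commutator, h_map_sub, map_mul, map_mul, hψ, hψ, LinearMap.zero_apply,
      LinearMap.zero_apply, map_zero, zero_add, zero_add]
  let e : Vec n ≃ₗ[ℂ] Vec n :=
    LinearEquiv.ofBijective ψ ⟨LinearMap.injective_iff_surjective.2 hsurj, hsurj⟩
  set S := LinearMap.toMatrix' ψ with hS
  -- The adjoint of S for ω is c S⁻¹, since S multiplies ω by c.
  set B := c • LinearMap.toMatrix' e.symm.toLinearMap with hB
  have hSv : ∀ v, S *ᵥ v = ψ v := fun v => LinearMap.toMatrix'_mulVec ψ v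
  have hBv : ∀ v, B *ᵥ v = c • e.symm v := fun v => by
    rw [hB, smul_mulVec, LinearMap.toMatrix'_mulVec]
    rfl
  have he : ∀ v, ψ (e.symm v) = v := fun v => e.apply_symm_apply v
  have hes : ∀ v, e.symm (ψ v) = v := fun v => e.symm_apply_apply v
  have hSB : Sᵀ * Matrix.J (Fin n) ℂ = Matrix.J (Fin n) ℂ * B := by
    refine transpose_mul_J_of_omega fun v w => ?_
    rw [hSv, hBv, omega_smul_right, ← hc, he]
  have hBS : B * S = c • 1 := by
    refine Matrix.ext_of_mulVec_single fun i => ?_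
    rw [← mulVec_mulVec, hSv, hBv, hes, smul_mulVec, one_mulVec]
  have hdet : IsUnit S.det := by
    have : B.det * S.det = c ^ Fintype.card (Fin n ⊕ Fin n) := by
      rw [← Matrix.det_mul, hBS, Matrix.det_smul, Matrix.det_one, mul_one]
    exact isUnit_of_mul_isUnit_right (x := B.det) (this ▸ (isUnit_iff_ne_zero.2 (pow_ne_zero _ hc0)))
  have hφS : ∀ A, (φ' A).1 * S = S * A.1 := fun A => by
    refine Matrix.ext_of_mulVec_single fun i => ?_
    rw [← mulVec_mulVec, ← mulVec_mulVec, hSv, hSv]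
    exact hψφ A _
  -- The similitude formula gives ζ(ψv, ψw) = c f(ζ(v, w)) = c ζ'(ψv, ψw), and ψ is onto. Hence θ =
  -- c⁻¹ below.
  have hzero : ζ - c • ζ' = 0 := by
    apply eq_zero_of_pairing_eq_zero hn
    intro x y
    obtain ⟨v, rfl⟩ := hsurj x
    obtain ⟨w, rfl⟩ := hsurj y
    have h1 := pairing_mulVec hdet hSB hBS φ' hφS hφsurj f hf ζ v w
    rw [hSv, hSv, hpair] at h1
    have h2 : ∀ (x y : Vec n), pairing (ζ - c • ζ') x y = pairing ζ x y - c • pairing ζ' x y := by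
      intro x y
      unfold pairing
      rw [Finsupp.sum_sub_index (by intros; rw [sub_smul]), Finsupp.sum_smul_index (by simp),
        Finsupp.smul_sum]
      simp only [mul_smul]
    rw [h2, h1, sub_self]
  refine ⟨c⁻¹, inv_ne_zero hc0, ?_⟩
  rw [sub_eq_zero.1 hzero, smul_smul, inv_mul_cancel₀ hc0, one_smul]

end Necessity

/-! ### Rescaling the vectors -/

section Sufficiency

variable {n N : ℕ}

theorem pairing_smul (θ : ℂ) (ζ : ℕ →₀ ℂ) (x y : Vec n) :
    pairing (θ • ζ) x y = θ • pairing ζ x y := by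
  unfold pairing
  rw [Finsupp.sum_smul_index (by simp), Finsupp.smul_sum]
  simp only [mul_smul]

/-- Rescaling of `V_{2n}` by `c`, as an endomorphism of `U(sp_{2n}) ⋉ T(V_{2n})`. -/
def semiScale (n : ℕ) (c : ℂ) : Semi n →ₐ[ℂ] Semi n :=
  RingQuot.liftAlgHom ℂ ⟨TensorAlgebra.lift ℂ ((semiG n).coprod (c • semiV n)), by
    have hG : ∀ A, TensorAlgebra.lift ℂ ((semiG n).coprod (c • semiV n)) (tGen n (.inl A)) =
        semiGen n (.inl A) := fun A => by simp [tGen, semiG_apply]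
    have hV : ∀ v, TensorAlgebra.lift ℂ ((semiG n).coprod (c • semiV n)) (tGen n (.inr v)) =
        c • semiGen n (.inr v) := fun v => by simp [tGen, semiV_apply]
    rintro _ _ (⟨A, B⟩ | ⟨A, v⟩)
    · rw [map_sub, map_mul, map_mul, hG, hG, hG]
      have := RingQuot.mkAlgHom_rel ℂ (SemiRel.lie A B)
      rwa [map_sub, map_mul, map_mul] at this
    · rw [map_sub, map_mul, map_mul, hG, hV, hV, mul_smul_comm, smul_mul_assoc, ← semi_act,
        smul_sub]⟩

theorem semiScale_inl (c : ℂ) (A : Sp n) :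
    semiScale n c (semiGen n (.inl A)) = semiGen n (.inl A) := by
  rw [semiScale, semiGen, RingQuot.liftAlgHom_mkAlgHom_apply]
  simp [tGen, semiG_apply, semiGen]

theorem semiScale_inr (c : ℂ) (v : Vec n) :
    semiScale n c (semiGen n (.inr v)) = c • semiGen n (.inr v) := by
  rw [semiScale, semiGen, RingQuot.liftAlgHom_mkAlgHom_apply]
  simp [tGen, semiV_apply, semiGen]

theorem semiScale_ofUSp (c : ℂ) (u : USp n) : semiScale n c (ofUSp n u) = ofUSp n u := by
  have : (semiScale n c).comp (ofUSp n) = ofUSp n := by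
    apply UniversalEnvelopingAlgebra.hom_ext
    ext A
    change semiScale n c (ofUSp n (UniversalEnvelopingAlgebra.ι ℂ A)) =
      ofUSp n (UniversalEnvelopingAlgebra.ι ℂ A)
    rw [ofUSp_ι, semiScale_inl]
  exact congrArg (fun F => F u) this

/-- Rescaling of `V_{2n}` by `c`, as a map from `H_{c²ζ}` to `H_ζ`. -/
def hScale (n : ℕ) {ζ ζ' : ℕ →₀ ℂ} {c : ℂ} (h : ζ = c ^ 2 • ζ') : H n ζ →ₐ[ℂ] H n ζ' :=
  RingQuot.liftAlgHom ℂ ⟨(RingQuot.mkAlgHom ℂ (CherednikRel ζ')).comp (semiScale n c), by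
    rintro _ _ ⟨x, y⟩
    have := RingQuot.mkAlgHom_rel ℂ (CherednikRel.comm (ζ := ζ') x y)
    rw [AlgHom.comp_apply, AlgHom.comp_apply, semiScale_ofUSp, h, pairing_smul, map_smul, map_smul,
      ← this]
    simp only [map_sub, map_mul, semiScale_inr, map_smul, smul_mul_smul_comm, sq, smul_sub]⟩

theorem hScale_inl {ζ ζ' : ℕ →₀ ℂ} {c : ℂ} (h : ζ = c ^ 2 • ζ') (A : Sp n) :
    hScale n h (gen n ζ (.inl A)) = gen n ζ' (.inl A) := by
  rw [hScale, gen, RingQuot.liftAlgHom_mkAlgHom_apply, AlgHom.comp_apply, semiScale_inl]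
  rfl

theorem hScale_inr {ζ ζ' : ℕ →₀ ℂ} {c : ℂ} (h : ζ = c ^ 2 • ζ') (v : Vec n) :
    hScale n h (gen n ζ (.inr v)) = c • gen n ζ' (.inr v) := by
  rw [hScale, gen, RingQuot.liftAlgHom_mkAlgHom_apply, AlgHom.comp_apply, semiScale_inr, map_smul]
  rfl

theorem h_algHom_ext {ζ : ℕ →₀ ℂ} {A : Type*} [Semiring A] [Algebra ℂ A] {f g : H n ζ →ₐ[ℂ] A}
    (h : ∀ s, f (gen n ζ s) = g (gen n ζ s)) : f = g := by
  apply RingQuot.ringQuot_ext'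
  apply RingQuot.ringQuot_ext'
  apply TensorAlgebra.hom_ext
  apply LinearMap.prod_ext
  · ext A
    exact h (.inl A)
  · refine LinearMap.ext fun v => ?_
    exact h (.inr v)

theorem hScale_comp {ζ ζ' : ℕ →₀ ℂ} {c d : ℂ} (h : ζ = c ^ 2 • ζ') (h' : ζ' = d ^ 2 • ζ)
    (hcd : c * d = 1) : (hScale n h').comp (hScale n h) = AlgHom.id ℂ _ := by
  apply h_algHom_ext
  rintro (A | v)
  · rw [AlgHom.comp_apply, hScale_inl, hScale_inl, AlgHom.id_apply]
  · rw [AlgHom.comp_apply, hScale_inr, map_smul, hScale_inr, smul_smul, hcd, one_smul,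
      AlgHom.id_apply]

theorem map_hScale_le {ζ ζ' : ℕ →₀ ℂ} {c : ℂ} (h : ζ = c ^ 2 • ζ') (k : ℕ) :
    (stdFiltration n N ζ k).map (hScale n h).toLinearMap ≤ stdFiltration n N ζ' k := by
  rw [stdFiltration, Submodule.map_span_le]
  rintro _ ⟨w, hw, rfl⟩
  have h1 : ∃ a : ℂ, hScale n h (w.map (gen n ζ)).prod = a • (w.map (gen n ζ')).prod := by
    clear hw
    induction w with
    | nil => exact ⟨1, by simp⟩
    | cons s w ih =>
      obtain ⟨a, ha⟩ := ih
      rw [List.map_cons, List.prod_cons, map_mul, ha, List.map_cons, List.prod_cons]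
      rcases s with A | v
      · exact ⟨a, by rw [hScale_inl, mul_smul_comm]⟩
      · exact ⟨c * a, by rw [hScale_inr, smul_mul_smul_comm]⟩
  obtain ⟨a, ha⟩ := h1
  rw [AlgHom.toLinearMap_apply, ha]
  exact Submodule.smul_mem _ _ (Submodule.subset_span ⟨w, hw, rfl⟩)

theorem filteredIsomorphic_smul {ζ : ℕ →₀ ℂ} {θ : ℂ} (hθ : θ ≠ 0) :
    FilteredIsomorphic n N ζ (θ • ζ) := by
  -- The commutator is quadratic in the vectors, so scaling the pairing by θ requires a square root
  -- of θ.
  obtain ⟨d, hd⟩ := IsAlgClosed.exists_pow_nat_eq θ two_pos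
  have hd0 : d ≠ 0 := by
    rintro rfl
    simp at hd
    exact hθ hd.symm
  have h1 : θ • ζ = d ^ 2 • ζ := by rw [hd]
  have h2 : ζ = d⁻¹ ^ 2 • θ • ζ := by
    rw [h1, smul_smul, ← mul_pow, inv_mul_cancel₀ hd0, one_pow, one_smul]
  refine ⟨AlgEquiv.ofAlgHom (hScale n h2) (hScale n h1)
    (hScale_comp h1 h2 (mul_inv_cancel₀ hd0)) (hScale_comp h2 h1 (inv_mul_cancel₀ hd0)),
    fun k => le_antisymm (map_hScale_le h2 k) fun a ha => ?_⟩
  refine ⟨hScale n h1 a, map_hScale_le h1 k ⟨a, ha, rfl⟩, ?_⟩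
  exact congrArg (fun F => F a) (hScale_comp h1 h2 (mul_inv_cancel₀ hd0))

end Sufficiency

end InfCherednik

end

theorem lemma1p3 (n : ℕ) (hn : 1 ≤ n) (N : ℕ) (ζ ζ' : ℕ →₀ ℂ)
    (hN : max (2 * InfCherednik.length ζ + 1) (max (2 * InfCherednik.length ζ' + 1) 3) ≤ (N : ℤ)) :
    InfCherednik.FilteredIsomorphic n N ζ ζ' ↔ ∃ θ : ℂ, θ ≠ 0 ∧ ζ' = θ • ζ := by
  have h3 : 3 ≤ N := by
    have := (le_max_right _ _).trans ((le_max_right _ _).trans hN)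
    exact_mod_cast this
  refine ⟨InfCherednik.exists_smul_eq_of_filteredIsomorphic hn h3, ?_⟩
  rintro ⟨θ, hθ, rfl⟩
  exact InfCherednik.filteredIsomorphic_smul hθ
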